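/- **Conventions.** A monoid with $0$ is a commutative (multiplicative) monoid $A$ with an element $0$ such that $0\cdot a=0$ for all $a$; $\{0\}$ is allowed. Homomorphisms preserve products, $1$ and $0$; $\mathcal M_0$ is the resulting category. Rings are commutative with $1$, and a ring $R$ is also regarded as a monoid with $0$ via its multiplication. An ideal of $A$ is a subset $I\ni 0$ with $IA\subseteq I$; it is prime if $A\setminus I$ is a submonoid. $\operatorname{Spec}A$ is the set of prime ideals of $A$ with the topology whose closed sets are the sets $\{\mathfrak p\supseteq I\}$, $I$ an ideal, and with the sheaf of monoids with $0$ whose sections are the families of elements of the localizations $A_{\mathfrak p}$ that are locally fractions. A monoidal space with $0$ is a topological space with a sheaf of monoids with $0$; a morphism is a continuous map $f:X\to Y$ together with a morphism of sheaves $\mathcal O_Y\to f_*\mathcal O_X$ such that each induced homomorphism of stalks $f_x^\sharp:\mathcal O_{Y,f(x)}\to\mathcal O_{X,x}$ is local, i.e. $(f_x^\sharp)^{-1}(\mathcal O_{X,x}^\times)=\mathcal O_{Y,f(x)}^\times$. A *geometric $\mathcal M_0$-scheme* is a monoidal space with $0$ that has an open covering by subspaces isomorphic to spectra of monoids with $0$.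 The *base extension* $X\mapsto X_{\mathbb Z}$ is the functor from geometric $\mathcal M_0$-schemes to schemes obtained by gluing $(\operatorname{Spec}A)_{\mathbb Z}=\operatorname{Spec}\bigl(\mathbb Z[A]/(1\cdot 0_A)\bigr)$; here $1\cdot 0_A$ is the basis element of the monoid ring $\mathbb Z[A]$ that corresponds to $0_A\in A$. A *generalized torified scheme* is a triple $(\widetilde X,X,e_X)$ of a geometric $\mathcal M_0$-scheme $\widetilde X$, a scheme $X$ and a morphism of schemes $e_X:\widetilde X_{\mathbb Z}\to X$ that induces a bijection $\widetilde X_{\mathbb Z}(k)\to X(k)$ for every field $k$. A morphism $(\widetilde Y,Y,e_Y)\to(\widetilde X,X,e_X)$ is a pair of morphisms $\widetilde\varphi:\widetilde Y\to\widetilde X$ and $\varphi:Y\to X$ with $e_X\circ\widetilde\varphi_{\mathbb Z}=\varphi\circ e_Y$. An *$\mathcal M_0$-functor* is a functor $F:\mathcal M_0\to\mathrm{Sets}$; it is affine if it is isomorphic to $\operatorname{Hom}(A,-)$ for some $A$. A subfunctor $G\subseteq F$ is open if for all $A$ and all $\varphi:\operatorname{Hom}(A,-)\to F$ there is an ideal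 $I$ of $A$ such that, for all $B$ and all $\rho:A\to B$, $\varphi(\rho)\in G(B)$ if and only if $\rho(I)B=B$. An open cover of $F$ is a non-empty collection of open subfunctors $F_i$ such that $\coprod_i F_i(H)\to F(H)$ is surjective for every $H$ that is the disjoint union of a group and $\{0\}$. An *$\mathcal M_0$-scheme* is an $\mathcal M_0$-functor that has an open cover by affine $\mathcal M_0$-functors. The points of an $\mathcal M_0$-functor $F$ are the elements of $F(\{0,1\})$; the stalk at $x$ is the colimit of the monoids of natural transformations $U\Rightarrow(A\mapsto A)$ over the open subfunctors $U$ of $F$ with $x\in U(\{0,1\})$. A morphism of $\mathcal M_0$-schemes is a natural transformation whose induced homomorphisms of stalks are all local. The base extension $F_{\mathbb Z}$ of an $\mathcal M_0$-functor $F$ is the functor on rings that is the Zariski sheaf associated with $R\mapsto F(R)$. A *CC-scheme* is a triple $(F,G,\mathrm{ev})$ of an $\mathcal M_0$-scheme $F$, a functor $G$ from rings to sets that is isomorphic to the functor of points of a scheme, and a natural transformation $\mathrm{ev}:F_{\mathbb Z}\Rightarrow G$ that is bijective on $k$ for every field $k$. A morphism $(F',G',\mathrm{ev}')\to(F,G,\mathrm{ev})$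 is a pair of a morphism of $\mathcal M_0$-schemes $\widetilde\varphi:F'\Rightarrow F$ and a natural transformation $\varphi:G'\Rightarrow G$ with $\mathrm{ev}\circ\widetilde\varphi_{\mathbb Z}=\varphi\circ\mathrm{ev}'$. For a geometric $\mathcal M_0$-scheme $\widetilde X$ and a scheme $X$ put $\underline{\widetilde X}(A)=\operatorname{Hom}(\operatorname{Spec}A,\widetilde X)$ and $\underline X(R)=\operatorname{Hom}(\operatorname{Spec}R,X)$. For a morphism $e:\widetilde X_{\mathbb Z}\to X$ let $\underline e:(\underline{\widetilde X})_{\mathbb Z}\Rightarrow\underline X$ be the natural transformation induced by the maps $\underline{\widetilde X}(R)\to\underline X(R)$ that send $f$ to the composite of the canonical morphism from the affine scheme of the ring $R$ to $(\operatorname{Spec}R)_{\mathbb Z}$ (where the second $R$ is regarded as a monoid with $0$), of $f_{\mathbb Z}$ and of $e$. **Theorem.** $X_{\mathbb Z}$ is a scheme for every geometric $\mathcal M_0$-scheme $X$. The assignment $$\mathcal I:\ (\widetilde X,X,e_X)\longmapsto(\underline{\widetilde X},\underline X,\underline e_X),\qquad(\widetilde\varphi,\varphi)\longmapsto(\underline{\widetilde\varphi},\underline\varphi)$$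 is a functor from the category of generalized torified schemes to the category of CC-schemes, and it is an equivalence of categories. -/

import Mathlib

open CategoryTheory Opposite TopologicalSpace

universe u

namespace FOne

/-! ## Commutative monoids with zero -/

/-- The category of commutative monoids with zero (an absorbing element). The one-element monoid,
in which `0 = 1`, is an object of it. -/
structure CommMonZ : Type (u + 1) where
  /-- The underlying type. -/
  carrier : Type u
  [str : CommMonoidWithZero carrier]

attribute [instance] CommMonZ.str

namespace CommMonZ

instance : CoeSort CommMonZ.{u} (Type u) := ⟨carrier⟩

/-- The object attached to a commutative monoid with zero. -/
abbrev of (A : Type u) [CommMonoidWithZero A] : CommMonZ.{u} := ⟨A⟩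

/-- Morphisms preserve products, `1` and `0`. -/
@[ext]
structure Hom (A B : CommMonZ.{u}) where
  /-- The underlying homomorphism. -/
  hom' : A →*₀ B

instance : Category CommMonZ.{u} where
  Hom A B := Hom A B
  id A := ⟨MonoidWithZeroHom.id A⟩
  comp f g := ⟨g.hom'.comp f.hom'⟩

instance : ConcreteCategory CommMonZ.{u} (fun A B => A →*₀ B) where
  hom := Hom.hom'
  ofHom := Hom.mk

/-- The underlying homomorphism of a morphism. -/
abbrev Hom.hom {A B : CommMonZ.{u}} (f : A ⟶ B) : A →*₀ B :=
  ConcreteCategory.hom (C := CommMonZ) f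

/-- The morphism attached to a homomorphism. -/
abbrev ofHom {A B : Type u} [CommMonoidWithZero A] [CommMonoidWithZero B] (f : A →*₀ B) :
    of A ⟶ of B :=
  ConcreteCategory.ofHom (C := CommMonZ) f

@[simp]
lemma hom_id {A : CommMonZ.{u}} : Hom.hom (𝟙 A) = MonoidWithZeroHom.id A := rfl

@[simp]
lemma hom_comp {A B C : CommMonZ.{u}} (f : A ⟶ B) (g : B ⟶ C) :
    Hom.hom (f ≫ g) = (Hom.hom g).comp (Hom.hom f) := rfl

@[ext]
lemma hom_ext {A B : CommMonZ.{u}} {f g : A ⟶ B} (h : ∀ a : A, f a = g a) : f = g :=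
  ConcreteCategory.hom_ext _ _ h

end CommMonZ

/-- The multiplicative monoid with zero of a commutative ring. -/
def forgetAdd : CommRingCat.{u} ⥤ CommMonZ.{u} where
  obj R := CommMonZ.of R
  map f := CommMonZ.ofHom f.hom.toMonoidWithZeroHom

/-! ## Ideals, prime ideals and the Zariski topology -/

section Spec

variable (A : Type u) [CommMonoidWithZero A]

/-- An ideal of a monoid with zero: a subset that contains `0` and absorbs products. -/
structure MIdeal where
  /-- The underlying subset. -/
  carrier : Set A
  zero_mem : (0 : A) ∈ carrier
  mul_mem : ∀ {x : A} (a : A), x ∈ carrier → x * a ∈ carrier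

/-- A prime ideal: an ideal whose complement is a submonoid. -/
@[ext]
structure MSpec where
  /-- The underlying subset. -/
  carrier : Set A
  zero_mem : (0 : A) ∈ carrier
  mul_mem : ∀ {x : A} (a : A), x ∈ carrier → x * a ∈ carrier
  one_notMem : (1 : A) ∉ carrier
  mul_notMem : ∀ {x y : A}, x ∉ carrier → y ∉ carrier → x * y ∉ carrier

variable {A}

/-- The complement of a prime ideal, as a submonoid. -/
def MSpec.compl (p : MSpec A) : Submonoid A where
  carrier := p.carrierᶜ
  one_mem' := p.one_notMem
  mul_mem' := p.mul_notMem

/-- The set `V(I)` of the prime ideals that contain the ideal `I`. -/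
def zeroLocus (I : MIdeal A) : Set (MSpec A) := {p | I.carrier ⊆ p.carrier}

/-- The Zariski topology: the closed sets are the sets `V(I)`, for the ideals `I`. -/
instance : TopologicalSpace (MSpec A) :=
  TopologicalSpace.ofClosed (Set.range zeroLocus)
    (by
      refine ⟨⟨Set.univ, trivial, fun _ _ => trivial⟩, ?_⟩
      ext p
      simp only [zeroLocus, Set.mem_ofPred_eq, Set.mem_empty_iff_false, iff_false]
      exact fun h => p.one_notMem (h trivial))
    (by
      intro T hT
      refine ⟨⟨{x | x = 0 ∨ ∃ I : MIdeal A, zeroLocus I ∈ T ∧ x ∈ I.carrier}, Or.inl rfl, ?_⟩, ?_⟩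
      · rintro x a (rfl | ⟨I, hI, hx⟩)
        · exact Or.inl (zero_mul a)
        · exact Or.inr ⟨I, hI, I.mul_mem a hx⟩
      · ext p
        constructor
        · intro h Z hZ
          obtain ⟨I, rfl⟩ := hT hZ
          exact fun x hx => h (Or.inr ⟨I, hZ, hx⟩)
        · rintro h x (rfl | ⟨I, hI, hx⟩)
          · exact p.zero_mem
          · exact h _ hI hx)
    (by
      rintro _ ⟨I, rfl⟩ _ ⟨J, rfl⟩
      refine ⟨⟨I.carrier ∩ J.carrier, ⟨I.zero_mem, J.zero_mem⟩,
        fun a h => ⟨I.mul_mem a h.1, J.mul_mem a h.2⟩⟩, ?_⟩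
      ext p
      constructor
      · intro h
        by_contra hc
        simp only [Set.mem_union, not_or, zeroLocus, Set.mem_ofPred_eq, Set.not_subset] at hc
        obtain ⟨⟨x, hx, hxp⟩, y, hy, hyp⟩ := hc
        exact p.mul_notMem hxp hyp (h ⟨I.mul_mem y hx, mul_comm y x ▸ J.mul_mem x hy⟩)
      · rintro (h | h)
        · exact fun x hx => h hx.1
        · exact fun x hx => h hx.2)

lemma isClosed_iff_zeroLocus (Z : Set (MSpec A)) : IsClosed Z ↔ ∃ I : MIdeal A, zeroLocus I = Z :=
  isOpen_compl_iff.symm.trans (by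
    change Zᶜᶜ ∈ Set.range zeroLocus ↔ _
    rw [compl_compl]
    rfl)

/-- The set of the prime ideals that do not contain a given element is open. -/
def basicOpen (f : A) : Opens (MSpec A) where
  carrier := {p | f ∉ p.carrier}
  is_open' := by
    rw [← isClosed_compl_iff, isClosed_iff_zeroLocus]
    refine ⟨⟨Set.range (f * ·), ⟨0, mul_zero f⟩, ?_⟩, ?_⟩
    · rintro _ a ⟨b, rfl⟩
      exact ⟨b * a, (mul_assoc f b a).symm⟩
    · ext p
      simp only [zeroLocus, Set.mem_ofPred_eq, Set.mem_compl_iff, not_not]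
      constructor
      · exact fun h => h ⟨1, mul_one f⟩
      · rintro h _ ⟨b, rfl⟩
        exact p.mul_mem b h

/-- The localization `A_p`. -/
abbrev LocAt (p : MSpec A) : Type u := Localization p.compl

/-- A function on an open set is a fraction if it is given by a single quotient `a / f`. -/
def isFractionPrelocal (A : Type u) [CommMonoidWithZero A] :
    TopCat.PrelocalPredicate (X := TopCat.of (MSpec A)) (fun p => LocAt p) where
  pred {U} s := ∃ a f : A, ∀ p : U, ∃ hf : f ∈ p.1.compl, s p = Localization.mk a ⟨f, hf⟩
  res := by
    rintro V U i s ⟨a, f, h⟩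
    exact ⟨a, f, fun p => h ⟨p.1, i.le p.2⟩⟩

/-- The functions that are locally quotients of elements of `A`. -/
def isLocallyFraction (A : Type u) [CommMonoidWithZero A] :
    TopCat.LocalPredicate (X := TopCat.of (MSpec A)) (fun p => LocAt p) :=
  (isFractionPrelocal A).sheafify

/-- The sheaf of sets underlying the structure sheaf: a section over `U` is a function
`s : ∏_{p ∈ U} A_p` that is locally a quotient of elements of `A`. -/
def sectionsInType (A : Type u) [CommMonoidWithZero A] :
    TopCat.Presheaf (Type u) (TopCat.of (MSpec A)) :=
  TopCat.subpresheafToTypes (isLocallyFraction A).toPrelocalPredicate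

/-- Sections form a monoid with zero under pointwise multiplication. -/
instance (U : (Opens (TopCat.of (MSpec A)))ᵒᵖ) :
    CommMonoidWithZero ((sectionsInType A).obj U) where
  mul s t := ⟨fun p => s.1 p * t.1 p, fun x => by
    obtain ⟨V, hV, i, a, f, h⟩ := s.2 x
    obtain ⟨W, hW, j, b, g, k⟩ := t.2 x
    refine ⟨V ⊓ W, ⟨hV, hW⟩, Opens.infLELeft _ _ ≫ i, a * b, f * g, fun p => ?_⟩
    obtain ⟨h1, h2⟩ := h ⟨p.1, p.2.1⟩
    obtain ⟨k1, k2⟩ := k ⟨p.1, p.2.2⟩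
    refine ⟨p.1.compl.mul_mem h1 k1, ?_⟩
    exact (congrArg₂ (· * ·) h2 k2).trans (Localization.mk_mul _ _ _ _)⟩
  one := ⟨fun _ => 1, fun x => ⟨unop U, x.2, 𝟙 _, 1, 1, fun p =>
    ⟨p.1.compl.one_mem, Localization.mk_one.symm⟩⟩⟩
  zero := ⟨fun _ => 0, fun x => ⟨unop U, x.2, 𝟙 _, 0, 1, fun p =>
    ⟨p.1.compl.one_mem, (Localization.mk_zero _).symm⟩⟩⟩
  mul_assoc _ _ _ := Subtype.ext (funext fun _ => mul_assoc _ _ _)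
  one_mul _ := Subtype.ext (funext fun _ => one_mul _)
  mul_one _ := Subtype.ext (funext fun _ => mul_one _)
  mul_comm _ _ := Subtype.ext (funext fun _ => mul_comm _ _)
  zero_mul _ := Subtype.ext (funext fun _ => zero_mul _)
  mul_zero _ := Subtype.ext (funext fun _ => mul_zero _)

lemma mul_val {U : (Opens (TopCat.of (MSpec A)))ᵒᵖ} (s t : (sectionsInType A).obj U)
    (p : U.unop) : (s * t).1 p = s.1 p * t.1 p := rfl

/-- The structure sheaf of the spectrum, with values in monoids with zero. -/
def structurePresheaf (A : Type u) [CommMonoidWithZero A] :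
    TopCat.Presheaf CommMonZ.{u} (TopCat.of (MSpec A)) where
  obj U := CommMonZ.of ((sectionsInType A).obj U)
  map i := CommMonZ.ofHom
    { toFun := (sectionsInType A).map i
      map_zero' := rfl
      map_one' := rfl
      map_mul' _ _ := rfl }

end Spec

/-! ## Monoidal spaces with zero -/

section Stalk

variable {X : TopCat.{u}} (F : TopCat.Presheaf CommMonZ.{u} X) (x : X)

instance : IsDirectedOrder (OpenNhds x)ᵒᵈ :=
  ⟨fun U V => ⟨OrderDual.toDual (OrderDual.ofDual U ⊓ OrderDual.ofDual V),
    inf_le_left (a := OrderDual.ofDual U), inf_le_right (a := OrderDual.ofDual U)⟩⟩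

instance : Nonempty (OpenNhds x)ᵒᵈ := ⟨OrderDual.toDual ⊤⟩

/-- Restriction of sections between open neighbourhoods of a point. -/
def nhdsRes (U V : (OpenNhds x)ᵒᵈ) (h : U ≤ V) :
    F.obj (op (OrderDual.ofDual U).1) →*₀ F.obj (op (OrderDual.ofDual V).1) :=
  CommMonZ.Hom.hom (F.map (homOfLE (show (OrderDual.ofDual V).1 ≤ (OrderDual.ofDual U).1 from h)).op)

lemma res_self (U : Opens X) (i : op U ⟶ op U) (s : F.obj (op U)) :
    CommMonZ.Hom.hom (F.map i) s = s := by
  rw [Subsingleton.elim i (𝟙 _), F.map_id]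
  rfl

instance : DirectedSystem (fun U : (OpenNhds x)ᵒᵈ => F.obj (op (OrderDual.ofDual U).1))
    (fun U V h => nhdsRes F x U V h) where
  map_self U s := res_self F _ _ s
  map_map U V W h k s := by
    change CommMonZ.Hom.hom (F.map _ ≫ F.map _) s = CommMonZ.Hom.hom (F.map _) s
    rw [← F.map_comp]
    rfl

/-- The stalk of a presheaf of monoids with zero: the direct limit of the sections over the open
neighbourhoods of the point. -/
noncomputable def stalk : CommMonZ.{u} :=
  CommMonZ.of (DirectLimit (fun U : (OpenNhds x)ᵒᵈ => F.obj (op (OrderDual.ofDual U).1))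
    (nhdsRes F x))

/-- The germ at a point of a section over an open neighbourhood. -/
noncomputable def germ (U : Opens X) (hx : x ∈ U) : F.obj (op U) ⟶ stalk F x :=
  CommMonZ.ofHom (B := DirectLimit (fun U : (OpenNhds x)ᵒᵈ => F.obj (op (OrderDual.ofDual U).1))
    (nhdsRes F x))
    { toFun s := ⟦⟨OrderDual.toDual ⟨U, hx⟩, s⟩⟧
      map_zero' := (DirectLimit.zero_def (f := nhdsRes F x) (OrderDual.toDual ⟨U, hx⟩)).symm
      map_one' := (DirectLimit.one_def (f := nhdsRes F x) (OrderDual.toDual ⟨U, hx⟩)).symm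
      map_mul' s t :=
        (DirectLimit.mul_def (f := nhdsRes F x) (OrderDual.toDual ⟨U, hx⟩) s t).symm }

lemma germ_res {U V : Opens X} (i : op U ⟶ op V) (hU : x ∈ U) (hV : x ∈ V) :
    F.map i ≫ germ F x V hV = germ F x U hU := by
  ext s
  exact DirectLimit.mk_apply (f := nhdsRes F x) (OrderDual.toDual ⟨U, hU⟩)
    (OrderDual.toDual ⟨V, hV⟩) s i.unop.le

lemma exists_germ (t : stalk F x) :
    ∃ (U : Opens X) (hx : x ∈ U) (s : F.obj (op U)), CommMonZ.Hom.hom (germ F x U hx) s = t := by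
  obtain ⟨U, s, rfl⟩ := DirectLimit.exists_eq_mk (nhdsRes F x) t
  exact ⟨(OrderDual.ofDual U).1, (OrderDual.ofDual U).2, s, rfl⟩

variable {F x}

lemma stalk_hom_ext {B : CommMonZ.{u}} {f g : stalk F x ⟶ B}
    (h : ∀ (U : Opens X) (hx : x ∈ U), germ F x U hx ≫ f = germ F x U hx ≫ g) : f = g := by
  ext t
  obtain ⟨U, hx, s, rfl⟩ := exists_germ F x t
  exact congrArg (fun k => CommMonZ.Hom.hom k s) (h U hx)

variable (F x)

/-- The universal property of the stalk. -/
noncomputable def stalkLift {B : CommMonZ.{u}}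
    (g : ∀ U : Opens X, x ∈ U → (F.obj (op U) ⟶ B))
    (hg : ∀ (U V : Opens X) (hU : x ∈ U) (hV : x ∈ V) (i : op U ⟶ op V),
      F.map i ≫ g V hV = g U hU) :
    stalk F x ⟶ B :=
  CommMonZ.ofHom (A := DirectLimit (fun U : (OpenNhds x)ᵒᵈ => F.obj (op (OrderDual.ofDual U).1))
    (nhdsRes F x))
    { toFun := DirectLimit.lift (nhdsRes F x)
        (fun U s => CommMonZ.Hom.hom (g (OrderDual.ofDual U).1 (OrderDual.ofDual U).2) s)
        (fun U V h s => (congrArg (fun k => CommMonZ.Hom.hom k s) (hg _ _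
          (OrderDual.ofDual U).2 (OrderDual.ofDual V).2
          (homOfLE (show (OrderDual.ofDual V).1 ≤ (OrderDual.ofDual U).1 from h)).op)).symm)
      map_zero' := by
        rw [DirectLimit.zero_def (f := nhdsRes F x) (OrderDual.toDual ⊤)]
        exact map_zero _
      map_one' := by
        rw [DirectLimit.one_def (f := nhdsRes F x) (OrderDual.toDual ⊤)]
        exact map_one _
      map_mul' := DirectLimit.induction₂ _ fun U s t => by
        rw [DirectLimit.mul_def]
        exact map_mul _ s t }

lemma germ_stalkLift {B : CommMonZ.{u}} (g : ∀ U : Opens X, x ∈ U → (F.obj (op U) ⟶ B))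
    (hg : ∀ (U V : Opens X) (hU : x ∈ U) (hV : x ∈ V) (i : op U ⟶ op V),
      F.map i ≫ g V hV = g U hU) (U : Opens X) (hx : x ∈ U) :
    germ F x U hx ≫ stalkLift F x g hg = g U hx := rfl

variable {x}

/-- If `x` specializes to `y`, then every open neighbourhood of `y` is one of `x`. -/
noncomputable def stalkSpecializes {y : X} (h : x ⤳ y) : stalk F y ⟶ stalk F x :=
  stalkLift F y (fun U hy => germ F x U (h.mem_open U.2 hy)) (fun _ _ _ _ i => germ_res F x i _ _)

end Stalk

section Map

open AlgebraicGeometry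

variable {X Y Z : PresheafedSpace.{u, u + 1, u} CommMonZ.{u}}

/-- The homomorphism of stalks induced by a morphism. -/
noncomputable def stalkMap (f : X ⟶ Y) (x : X) :
    stalk Y.presheaf (f.base x) ⟶ stalk X.presheaf x :=
  stalkLift _ _ (fun U hx => f.c.app (op U) ≫ germ X.presheaf x ((Opens.map f.base).obj U) hx)
    (fun U V hU hV i => by
      rw [← Category.assoc, f.c.naturality, Category.assoc]
      congr 1
      exact germ_res X.presheaf x ((Opens.map f.base).op.map i) hU hV)

lemma germ_stalkMap (f : X ⟶ Y) (x : X) (U : Opens Y) (hx : f.base x ∈ U) :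
    germ Y.presheaf (f.base x) U hx ≫ stalkMap f x =
      f.c.app (op U) ≫ germ X.presheaf x ((Opens.map f.base).obj U) hx := rfl

lemma stalkMap_id (x : X) : stalkMap (𝟙 X) x = 𝟙 (stalk X.presheaf x) := by
  refine stalk_hom_ext fun U hx => ?_
  rw [germ_stalkMap]
  exact (Category.id_comp _).trans (Category.comp_id _).symm

lemma stalkMap_comp (f : X ⟶ Y) (g : Y ⟶ Z) (x : X) :
    stalkMap (f ≫ g) x = stalkMap g (f.base x) ≫ stalkMap f x := by
  exact stalk_hom_ext fun _ _ => rfl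

lemma stalkSpecializes_stalkMap (f : X ⟶ Y) {x y : X} (h : x ⤳ y) :
    stalkMap f y ≫ stalkSpecializes X.presheaf h =
      stalkSpecializes Y.presheaf (h.map f.base.hom.continuous) ≫ stalkMap f x :=
  stalk_hom_ext fun _ _ => rfl

/-- A morphism is local if it reflects the units of the stalks. -/
def IsLocalMorphism (f : X ⟶ Y) : Prop :=
  ∀ x : X, IsLocalHom (CommMonZ.Hom.hom (stalkMap f x))

end Map

open AlgebraicGeometry

/-- A monoidal space with zero: a topological space with a sheaf of monoids with zero. -/
structure MonoidalSpace extends PresheafedSpace.{u, u + 1, u} CommMonZ.{u} where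
  isSheaf : TopCat.Presheaf.IsSheaf (presheaf ⋙ forget CommMonZ.{u})

namespace MonoidalSpace

/-- A local morphism of monoidal spaces. -/
@[ext]
structure Hom (X Y : MonoidalSpace.{u}) where
  /-- The underlying morphism. -/
  toHom : X.toPresheafedSpace ⟶ Y.toPresheafedSpace
  isLocal : IsLocalMorphism toHom

/-- The category of monoidal spaces with zero and local morphisms. -/
instance : Category MonoidalSpace.{u} where
  Hom := Hom
  id X := ⟨𝟙 _, fun x => by rw [stalkMap_id]; exact ⟨fun _ h => h⟩⟩
  comp f g := ⟨f.toHom ≫ g.toHom, fun x => by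
    rw [stalkMap_comp]
    exact ⟨fun a h => (g.isLocal (f.toHom.base x)).map_nonunit a
      ((f.isLocal x).map_nonunit _ h)⟩⟩

end MonoidalSpace

/-! ## Spectra of monoids with zero -/

/-- The spectrum of a monoid with zero, as a monoidal space. -/
def specSpace (A : CommMonZ.{u}) : MonoidalSpace.{u} where
  carrier := TopCat.of (MSpec A)
  presheaf := structurePresheaf A
  isSheaf := TopCat.subpresheafToTypes.isSheaf (isLocallyFraction A)

section SpecMap

variable {A B C : Type u} [CommMonoidWithZero A] [CommMonoidWithZero B] [CommMonoidWithZero C]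

/-- The inverse image of a prime ideal. -/
def MSpec.comap (g : A →*₀ B) (q : MSpec B) : MSpec A where
  carrier := g ⁻¹' q.carrier
  zero_mem := by
    rw [Set.mem_preimage, map_zero]
    exact q.zero_mem
  mul_mem a h := by
    rw [Set.mem_preimage, map_mul]
    exact q.mul_mem _ h
  one_notMem := by
    rw [Set.mem_preimage, map_one]
    exact q.one_notMem
  mul_notMem h k := by
    rw [Set.mem_preimage, map_mul]
    exact q.mul_notMem h k

lemma MSpec.continuous_comap (g : A →*₀ B) : Continuous (MSpec.comap g) := by
  refine continuous_iff_isClosed.2 fun Z hZ => ?_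
  obtain ⟨I, rfl⟩ := (isClosed_iff_zeroLocus Z).1 hZ
  refine (isClosed_iff_zeroLocus _).2
    ⟨⟨{b | ∃ a ∈ I.carrier, ∃ c, g a * c = b}, ⟨0, I.zero_mem, 1, by simp⟩, ?_⟩, ?_⟩
  · rintro _ c ⟨a, ha, d, rfl⟩
    exact ⟨a, ha, d * c, (mul_assoc _ _ _).symm⟩
  · ext q
    constructor
    · exact fun h a ha => h ⟨a, ha, 1, mul_one _⟩
    · rintro h _ ⟨a, ha, c, rfl⟩
      exact q.mul_mem c (h ha)

/-- The homomorphism `A_{g⁻¹(q)} → B_q` sending `a / f` to `g(a) / g(f)`. -/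
noncomputable def locMap (g : A →*₀ B) (q : MSpec B) : LocAt (q.comap g) →*₀ LocAt q where
  toFun t := t.liftOn (fun a f => Localization.mk (g a) ⟨g f.1, f.2⟩) (by
    intro a b f h e
    obtain ⟨c, hc⟩ := Localization.r_iff_exists.1 e
    refine Localization.mk_eq_mk_iff.2 (Localization.r_iff_exists.2 ⟨⟨g c.1, c.2⟩, ?_⟩)
    simpa only [map_mul] using congrArg g hc)
  map_zero' := by
    rw [← Localization.mk_zero 1, Localization.liftOn_mk, map_zero]
    exact Localization.mk_zero _
  map_one' := by
    rw [← Localization.mk_one, Localization.liftOn_mk, ← Localization.mk_one]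
    exact Localization.mk_eq_mk_iff.2 (Localization.r_iff_exists.2 ⟨1, by simp⟩)
  map_mul' s t := Localization.induction_on₂ s t fun ⟨a, f⟩ ⟨b, h⟩ => by
    rw [Localization.mk_mul, Localization.liftOn_mk, Localization.liftOn_mk,
      Localization.liftOn_mk, Localization.mk_mul]
    exact Localization.mk_eq_mk_iff.2 (Localization.r_iff_exists.2 ⟨1, by simp⟩)

lemma locMap_mk (g : A →*₀ B) (q : MSpec B) (a : A) (f : (q.comap g).compl) :
    locMap g q (Localization.mk a f) = Localization.mk (g a) ⟨g f.1, f.2⟩ := rfl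

lemma locMap_id (q : MSpec A) (t : LocAt (q.comap (MonoidWithZeroHom.id A))) :
    locMap (MonoidWithZeroHom.id A) q t = (show LocAt q from t) := by
  induction t using Localization.induction_on with
  | H y => rfl

lemma isUnit_mk_iff (p : MSpec A) (a : A) (f : p.compl) :
    IsUnit (Localization.mk a f) ↔ a ∈ p.compl := by
  constructor
  · intro h
    obtain ⟨t, ht⟩ := h.exists_right_inv
    induction t using Localization.induction_on with
    | H y =>
      obtain ⟨b, k⟩ := y
      rw [Localization.mk_mul, ← Localization.mk_one, Localization.mk_eq_mk_iff,
        Localization.r_iff_exists] at ht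
      obtain ⟨c, hc⟩ := ht
      intro ha
      have h1 : c.1 * (f * k).1 ∈ p.compl := p.compl.mul_mem c.2 (f * k).2
      refine h1 ?_
      have h2 : c.1 * (f * k).1 = a * (c.1 * b) := by
        simpa [mul_left_comm, mul_comm, mul_assoc] using hc.symm
      rw [h2]
      exact p.mul_mem _ ha
  · intro ha
    refine IsUnit.of_mul_eq_one (Localization.mk f.1 ⟨a, ha⟩) ?_
    rw [Localization.mk_mul, ← Localization.mk_one]
    exact Localization.mk_eq_mk_iff.2
      (Localization.r_iff_exists.2 ⟨1, by simp [mul_comm]⟩)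

/-- The continuous map of spectra induced by a homomorphism. -/
def specBase (g : A →*₀ B) : TopCat.of (MSpec B) ⟶ TopCat.of (MSpec A) :=
  TopCat.ofHom ⟨MSpec.comap g, MSpec.continuous_comap g⟩

/-- The pull-back of sections: `s` is sent to `q ↦ g_q (s (g⁻¹(q)))`. -/
noncomputable def sectionMap (g : A →*₀ B) (U : (Opens (TopCat.of (MSpec A)))ᵒᵖ) :
    (sectionsInType A).obj U →*₀
      (sectionsInType B).obj (op ((Opens.map (specBase g)).obj U.unop)) where
  toFun s := ⟨fun q => locMap g q.1 (s.1 ⟨q.1.comap g, q.2⟩), fun q => by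
    obtain ⟨V, hV, i, a, f, h⟩ := s.2 ⟨q.1.comap g, q.2⟩
    refine ⟨(Opens.map (specBase g)).obj V, hV, (Opens.map (specBase g)).map i, g a, g f,
      fun p => ?_⟩
    obtain ⟨h1, h2⟩ := h ⟨p.1.comap g, p.2⟩
    exact ⟨h1, (congrArg (locMap g p.1) h2).trans (locMap_mk ..)⟩⟩
  map_zero' := Subtype.ext (funext fun _ => map_zero _)
  map_one' := Subtype.ext (funext fun _ => map_one _)
  map_mul' _ _ := Subtype.ext (funext fun _ => map_mul _ _ _)

end SpecMap

/-- The morphism of structure sheaves induced by a homomorphism. -/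
noncomputable def specSheafHom {A B : CommMonZ.{u}} (g : A ⟶ B) :
    structurePresheaf A ⟶
      (TopCat.Presheaf.pushforward _ (specBase (CommMonZ.Hom.hom g))).obj (structurePresheaf B) where
  app U := CommMonZ.ofHom (sectionMap (CommMonZ.Hom.hom g) U)
  naturality _ _ _ := rfl

/-- The morphism of spectra induced by a homomorphism. -/
noncomputable def specMapHom {A B : CommMonZ.{u}} (g : A ⟶ B) :
    (specSpace B).toPresheafedSpace ⟶ (specSpace A).toPresheafedSpace where
  base := specBase (CommMonZ.Hom.hom g)
  c := specSheafHom g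

/-- The value of a germ at `p` in the localization `A_p`. -/
noncomputable def stalkToLoc (A : CommMonZ.{u}) (p : MSpec A) :
    stalk (specSpace A).presheaf p ⟶ CommMonZ.of (LocAt p) :=
  stalkLift (specSpace A).presheaf p
    (fun U hU => CommMonZ.ofHom (A := (sectionsInType A).obj (op U))
      { toFun s := s.1 ⟨p, hU⟩
        map_zero' := rfl
        map_one' := rfl
        map_mul' _ _ := rfl })
    (fun _ _ _ _ _ => rfl)

/-- A germ is a unit as soon as its value is one. -/
lemma isUnit_of_isUnit_stalkToLoc (A : CommMonZ.{u}) (p : MSpec A)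
    (t : stalk (specSpace A).presheaf p) (h : IsUnit (CommMonZ.Hom.hom (stalkToLoc A p) t)) :
    IsUnit t := by
  obtain ⟨U, hU, s, rfl⟩ := exists_germ _ _ t
  change IsUnit (s.1 ⟨p, hU⟩) at h
  obtain ⟨V, hV, i, a, f, hs⟩ := s.2 ⟨p, hU⟩
  obtain ⟨hf, hp⟩ := hs ⟨p, hV⟩
  have hp' : s.1 ⟨p, hU⟩ = Localization.mk a ⟨f, hf⟩ := hp
  rw [hp', isUnit_mk_iff] at h
  let W : Opens (TopCat.of (MSpec A)) := V ⊓ basicOpen a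
  have hWU : W ≤ U := inf_le_left.trans i.le
  let r : (sectionsInType A).obj (op W) := ⟨fun q => Localization.mk f ⟨a, q.2.2⟩,
    fun q => ⟨W, q.2, 𝟙 _, f, a, fun q' => ⟨q'.2.2, rfl⟩⟩⟩
  have hW : p ∈ W := ⟨hV, h⟩
  have e := germ_res (specSpace A).presheaf p (homOfLE hWU).op hU hW
  rw [← e]
  change IsUnit (CommMonZ.Hom.hom (germ (specSpace A).presheaf p W hW) _)
  refine IsUnit.map _ (IsUnit.of_mul_eq_one r (Subtype.ext (funext fun q => ?_)))
  obtain ⟨h1, h2⟩ := hs ⟨q.1, q.2.1⟩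
  refine (congrArg (· * Localization.mk f ⟨a, q.2.2⟩) h2).trans ?_
  rw [Localization.mk_mul]
  refine Eq.trans ?_ Localization.mk_one
  exact Localization.mk_eq_mk_iff.2 (Localization.r_iff_exists.2 ⟨1, by simp [mul_comm]⟩)

lemma stalkToLoc_stalkMap {A B : CommMonZ.{u}} (g : A ⟶ B) (q : MSpec B)
    (t : stalk (specSpace A).presheaf (q.comap (CommMonZ.Hom.hom g))) :
    CommMonZ.Hom.hom (stalkToLoc B q) (CommMonZ.Hom.hom (stalkMap (specMapHom g) q) t) =
      locMap (CommMonZ.Hom.hom g) q (CommMonZ.Hom.hom (stalkToLoc A _) t) := by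
  obtain ⟨U, hU, s, rfl⟩ := exists_germ _ _ t
  rfl

lemma isUnit_of_isUnit_locMap {A B : CommMonZ.{u}} (g : A →*₀ B) (q : MSpec B)
    (t : LocAt (q.comap g)) (h : IsUnit (locMap g q t)) : IsUnit t := by
  induction t using Localization.induction_on with
  | H y =>
    rw [locMap_mk, isUnit_mk_iff] at h
    exact (isUnit_mk_iff _ _ _).2 h

lemma specMapHom_isLocal {A B : CommMonZ.{u}} (g : A ⟶ B) : IsLocalMorphism (specMapHom g) :=
  fun q => ⟨fun t ht => isUnit_of_isUnit_stalkToLoc _ _ _ (isUnit_of_isUnit_locMap _ q _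
    (stalkToLoc_stalkMap g q t ▸ ht.map (CommMonZ.Hom.hom (stalkToLoc B q))))⟩

/-- The functor `Spec`, from monoids with zero to monoidal spaces with zero. -/
noncomputable def specFunctor : CommMonZ.{u}ᵒᵖ ⥤ MonoidalSpace.{u} where
  obj A := specSpace A.unop
  map g := ⟨specMapHom g.unop, specMapHom_isLocal g.unop⟩
  map_id A := by
    refine MonoidalSpace.Hom.ext (PresheafedSpace.hext _ _ rfl (heq_of_eq ?_))
    refine NatTrans.ext (funext fun U => CommMonZ.hom_ext fun s => ?_)
    refine Subtype.ext (funext fun q => ?_)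
    exact locMap_id q.1 (s.1 q)
  map_comp f g := by
    refine MonoidalSpace.Hom.ext (PresheafedSpace.hext _ _ rfl (heq_of_eq ?_))
    refine NatTrans.ext (funext fun U => CommMonZ.hom_ext fun s => ?_)
    refine Subtype.ext (funext fun q => ?_)
    change locMap _ q.1 (s.1 ⟨_, q.2⟩) = locMap _ q.1 (locMap _ _ (s.1 ⟨_, q.2⟩))
    generalize s.1 ⟨_, q.2⟩ = t
    induction t using Localization.induction_on with
    | H y => rfl

/-- A geometric scheme over monoids with zero: a monoidal space with zero that has an open covering
by spectra of monoids with zero. -/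
def IsGeometric : ObjectProperty MonoidalSpace.{u} := fun X =>
  ∀ x : X.toPresheafedSpace, ∃ (U : Opens X.toPresheafedSpace) (_ : x ∈ U) (A : CommMonZ.{u}),
    Nonempty (X.toPresheafedSpace.restrict U.isOpenEmbedding ≅ (specSpace A).toPresheafedSpace)

/-- The category of geometric schemes over monoids with zero. -/
abbrev GeomScheme := IsGeometric.{u}.FullSubcategory

/-- The functor of points `A ↦ Hom(Spec A, X)` of a monoidal space. -/
noncomputable def spacePoints : MonoidalSpace.{u} ⥤ (CommMonZ.{u} ⥤ Type u) :=
  yoneda ⋙ (Functor.whiskeringLeft _ _ _).obj specFunctor.rightOp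

/-- The functor of points `R ↦ Hom(Spec R, X)` of a scheme, as a functor on rings. -/
noncomputable def schemePoints : Scheme.{u} ⥤ (CommRingCat.{u} ⥤ Type u) :=
  yoneda ⋙ (Functor.whiskeringLeft _ _ _).obj Scheme.Spec.rightOp

/-! ## Base extension to the integers -/

/-- The ring `ℤ[A] / (1 · 0_A)`, in which the zero of `A` is identified with the zero. -/
abbrev MRing (A : Type u) [CommMonoidWithZero A] : Type u :=
  MonoidAlgebra ℤ A ⧸ Ideal.span {MonoidAlgebra.single (0 : A) (1 : ℤ)}

section MRing

variable {A : Type u} [CommMonoidWithZero A]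

/-- The canonical homomorphism from `A` to `ℤ[A] / (1 · 0_A)`. -/
noncomputable def toMRing (A : Type u) [CommMonoidWithZero A] : A →*₀ MRing A where
  toFun a := Ideal.Quotient.mk _ (MonoidAlgebra.single a 1)
  map_zero' := Ideal.Quotient.eq_zero_iff_mem.2 (Ideal.subset_span rfl)
  map_one' := map_one _
  map_mul' a b := by
    rw [← map_mul, MonoidAlgebra.single_mul_single, one_mul]

/-- The universal property: a homomorphism from `A` to the multiplicative monoid of a ring `R`
extends to a homomorphism of rings. -/
noncomputable def mringLift {R : Type u} [CommRing R] (f : A →*₀ R) : MRing A →+* R :=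
  Ideal.Quotient.lift _ (MonoidAlgebra.liftNCRingHom (Int.castRingHom R) f.toMonoidHom
    (fun _ _ => Commute.all _ _)) (by
    intro a ha
    refine (RingHom.mem_ker (f := MonoidAlgebra.liftNCRingHom (Int.castRingHom R) f.toMonoidHom
      (fun _ _ => Commute.all _ _))).1 (Ideal.span_le.2 ?_ ha)
    rintro _ rfl
    simp [RingHom.mem_ker, MonoidAlgebra.liftNCRingHom])

@[simp]
lemma mringLift_toMRing {R : Type u} [CommRing R] (f : A →*₀ R) (a : A) :
    mringLift f (toMRing A a) = f a := by
  simp [mringLift, toMRing, MonoidAlgebra.liftNCRingHom]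

lemma mring_hom_ext {R : Type u} [CommRing R] {f g : MRing A →+* R}
    (h : ∀ a, f (toMRing A a) = g (toMRing A a)) : f = g := by
  refine Ideal.Quotient.ringHom_ext (MonoidAlgebra.ringHom_ext (fun n => ?_) h)
  exact RingHom.congr_fun (RingHom.ext_int
    ((f.comp (Ideal.Quotient.mk _)).comp MonoidAlgebra.singleOneRingHom)
    ((g.comp (Ideal.Quotient.mk _)).comp MonoidAlgebra.singleOneRingHom)) n

end MRing

/-- The homomorphism `ℤ[A] / (1 · 0_A) → ℤ[B] / (1 · 0_B)` induced by a homomorphism `A → B`. -/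
noncomputable def mringMap {A B : CommMonZ.{u}} (g : A ⟶ B) : MRing A →+* MRing B :=
  mringLift (R := MRing B) ((toMRing B).comp (CommMonZ.Hom.hom g))

lemma mringMap_toMRing {A B : CommMonZ.{u}} (g : A ⟶ B) (a : A) :
    mringMap g (toMRing A a) = toMRing B (CommMonZ.Hom.hom g a) :=
  mringLift_toMRing (R := MRing B) _ a

/-- The functor `A ↦ ℤ[A] / (1 · 0_A)`. -/
noncomputable def mringFunctor : CommMonZ.{u} ⥤ CommRingCat.{u} where
  obj A := CommRingCat.of (MRing A)
  map g := CommRingCat.ofHom (mringMap g)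
  map_id A := CommRingCat.hom_ext (mring_hom_ext (R := MRing A) fun a =>
    mringMap_toMRing (𝟙 A) a)
  map_comp {_ _ C} f g := CommRingCat.hom_ext (mring_hom_ext (R := MRing C) fun a =>
    (mringMap_toMRing (f ≫ g) a).trans ((congrArg (mringMap g) (mringMap_toMRing f a)).trans
      (mringMap_toMRing g _)).symm)

/-- The morphism from `ℤ[A] / (1 · 0_A)` to `R` attached to a homomorphism from `A` to the
multiplicative monoid of `R`. -/
noncomputable def monToRing {A : CommMonZ.{u}} {R : CommRingCat.{u}} (f : A ⟶ forgetAdd.obj R) :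
    mringFunctor.obj A ⟶ R :=
  CommRingCat.ofHom (R := MRing A) (S := R) (mringLift (R := R) (CommMonZ.Hom.hom f))

lemma monToRing_toMRing {A : CommMonZ.{u}} {R : CommRingCat.{u}} (f : A ⟶ forgetAdd.obj R) (a : A) :
    (monToRing f).hom (toMRing A a) = CommMonZ.Hom.hom f a :=
  mringLift_toMRing (R := R) _ a

lemma map_monToRing {A B : CommMonZ.{u}} {R : CommRingCat.{u}} (g : A ⟶ B)
    (f : B ⟶ forgetAdd.obj R) : mringFunctor.map g ≫ monToRing f = monToRing (g ≫ f) :=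
  CommRingCat.hom_ext (mring_hom_ext fun a => by
    refine Eq.trans ?_ (monToRing_toMRing _ a).symm
    refine (congrArg (monToRing f).hom (mringMap_toMRing g a)).trans ?_
    exact monToRing_toMRing _ _)

lemma monToRing_comp {A : CommMonZ.{u}} {R S : CommRingCat.{u}} (f : A ⟶ forgetAdd.obj R)
    (h : R ⟶ S) : monToRing f ≫ h = monToRing (f ≫ forgetAdd.map h) :=
  CommRingCat.hom_ext (mring_hom_ext fun a => by
    refine Eq.trans ?_ (monToRing_toMRing _ a).symm
    exact congrArg h.hom (monToRing_toMRing f a))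

/-- The points of a topological space, as a category: there is a (unique) morphism from `x` to `y`
if and only if `x` specializes to `y`. -/
structure PointCat (X : TopCat.{u}) : Type u where
  /-- The underlying point. -/
  pt : X

instance (X : TopCat.{u}) : Preorder (PointCat X) where
  le x y := x.pt ⤳ y.pt
  le_refl x := specializes_rfl
  le_trans _ _ _ h k := h.trans k

/-- The affine scheme `Spec (ℤ[A] / (1 · 0_A))`. -/
noncomputable def affineBaseExt (A : CommMonZ.{u}) : LocallyRingedSpace.{u} :=
  (Scheme.Spec.obj (op (mringFunctor.obj A))).toLocallyRingedSpace

/-- The morphism `Spec (ℤ[B] / (1 · 0_B)) → Spec (ℤ[A] / (1 · 0_A))` induced by a homomorphism. -/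
noncomputable def affineBaseExtMap {A B : CommMonZ.{u}} (g : A ⟶ B) :
    affineBaseExt B ⟶ affineBaseExt A :=
  Scheme.forgetToLocallyRingedSpace.map (Scheme.Spec.map (mringFunctor.map g).op)

lemma affineBaseExtMap_id (A : CommMonZ.{u}) : affineBaseExtMap (𝟙 A) = 𝟙 _ :=
  (mringFunctor.op ⋙ Scheme.Spec ⋙ Scheme.forgetToLocallyRingedSpace).map_id (op A)

lemma affineBaseExtMap_comp {A B C : CommMonZ.{u}} (f : A ⟶ B) (g : B ⟶ C) :
    affineBaseExtMap (f ≫ g) = affineBaseExtMap g ≫ affineBaseExtMap f :=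
  (mringFunctor.op ⋙ Scheme.Spec ⋙ Scheme.forgetToLocallyRingedSpace).map_comp g.op f.op

/-- The functor `x ↦ Spec (ℤ[O_{X, x}] / (1 · 0))` on the points of `X`. -/
noncomputable def stalkDiagram (X : PresheafedSpace.{u, u + 1, u} CommMonZ.{u}) :
    PointCat X.carrier ⥤ LocallyRingedSpace.{u} where
  obj x := affineBaseExt (stalk X.presheaf x.pt)
  map h := affineBaseExtMap (stalkSpecializes X.presheaf (leOfHom h))
  map_id x := by
    rw [← affineBaseExtMap_id]
    exact congrArg affineBaseExtMap (stalk_hom_ext fun _ _ => rfl)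
  map_comp h k := by
    rw [← affineBaseExtMap_comp]
    exact congrArg affineBaseExtMap (stalk_hom_ext fun _ _ => rfl)

/-- The morphism from `Spec (ℤ[O_{X, x}] / (1 · 0))` to the colimit attached to `Y` that is induced
by a morphism `f : X ⟶ Y`. -/
noncomputable def stalkDiagramMap {X Y : PresheafedSpace.{u, u + 1, u} CommMonZ.{u}} (f : X ⟶ Y)
    (x : PointCat X.carrier) :
    (stalkDiagram X).obj x ⟶ Limits.colimit (stalkDiagram Y) :=
  affineBaseExtMap (stalkMap f x.pt) ≫ Limits.colimit.ι (stalkDiagram Y) ⟨f.base x.pt⟩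

lemma stalkDiagramMap_naturality {X Y : PresheafedSpace.{u, u + 1, u} CommMonZ.{u}} (f : X ⟶ Y)
    {x y : PointCat X.carrier} (h : x ⟶ y) :
    (stalkDiagram X).map h ≫ stalkDiagramMap f y = stalkDiagramMap f x := by
  have hs : x.pt ⤳ y.pt := leOfHom h
  have hk : f.base x.pt ⤳ f.base y.pt := hs.map f.base.hom.continuous
  let k : (⟨f.base x.pt⟩ : PointCat Y.carrier) ⟶ ⟨f.base y.pt⟩ := homOfLE hk
  have w : affineBaseExtMap (stalkSpecializes Y.presheaf hk) ≫ _ = _ :=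
    Limits.colimit.w (stalkDiagram Y) k
  have e := congrArg affineBaseExtMap (stalkSpecializes_stalkMap f hs)
  rw [affineBaseExtMap_comp, affineBaseExtMap_comp] at e
  have e' := congrArg (· ≫ Limits.colimit.ι (stalkDiagram Y) ⟨f.base y.pt⟩) e
  exact (Category.assoc _ _ _).symm.trans (e'.trans ((Category.assoc _ _ _).trans
    (congrArg (affineBaseExtMap (stalkMap f x.pt) ≫ ·) w)))

/-- The morphism of base extensions induced by a morphism of monoidal spaces. -/
noncomputable def baseExtMap {X Y : PresheafedSpace.{u, u + 1, u} CommMonZ.{u}} (f : X ⟶ Y) :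
    Limits.colimit (stalkDiagram X) ⟶ Limits.colimit (stalkDiagram Y) :=
  Limits.colimit.desc (stalkDiagram X)
    { pt := Limits.colimit (stalkDiagram Y)
      ι :=
        { app := stalkDiagramMap f
          naturality := fun _ _ h =>
            (stalkDiagramMap_naturality f h).trans (Category.comp_id _).symm } }

lemma ι_baseExtMap {X Y : PresheafedSpace.{u, u + 1, u} CommMonZ.{u}} (f : X ⟶ Y)
    (x : PointCat X.carrier) :
    Limits.colimit.ι (stalkDiagram X) x ≫ baseExtMap f =
      affineBaseExtMap (stalkMap f x.pt) ≫ Limits.colimit.ι (stalkDiagram Y) ⟨f.base x.pt⟩ :=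
  Limits.colimit.ι_desc _ _

/-- The base extension `X ↦ X_ℤ`. It is the gluing of the affine schemes `Spec (ℤ[A] / (1 · 0_A))`,
for the open subspaces `Spec A` of `X`. As the spectrum of `A` is the spectrum of the stalk at its
closed point, this is the colimit of the `Spec (ℤ[O_{X, x}] / (1 · 0))` over all the points `x`,
which is taken in the category of locally ringed spaces. -/
noncomputable def baseExt : MonoidalSpace.{u} ⥤ LocallyRingedSpace.{u} where
  obj X := Limits.colimit (stalkDiagram X.toPresheafedSpace)
  map f := baseExtMap f.toHom
  map_id X := by
    refine Limits.colimit.hom_ext fun x => ?_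
    refine (ι_baseExtMap _ x).trans (Eq.trans ?_ (Category.comp_id _).symm)
    refine Eq.trans ?_ (Category.id_comp _)
    refine congrArg (· ≫ Limits.colimit.ι (stalkDiagram X.toPresheafedSpace) x) ?_
    exact (congrArg affineBaseExtMap (stalkMap_id x.pt)).trans (affineBaseExtMap_id _)
  map_comp {X Y Z} f g := by
    refine Limits.colimit.hom_ext fun x => ?_
    refine (ι_baseExtMap _ x).trans (Eq.symm ?_)
    refine (Category.assoc _ _ _).symm.trans ((congrArg (· ≫ baseExtMap g.toHom)
      (ι_baseExtMap f.toHom x)).trans ((Category.assoc _ _ _).trans ((congrArg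
      (affineBaseExtMap (stalkMap f.toHom x.pt) ≫ ·) (ι_baseExtMap g.toHom _)).trans
      ((Category.assoc _ _ _).symm.trans ?_))))
    refine congrArg (· ≫ Limits.colimit.ι (stalkDiagram Z.toPresheafedSpace)
      ⟨g.toHom.base (f.toHom.base x.pt)⟩) ?_
    exact ((congrArg affineBaseExtMap (stalkMap_comp f.toHom g.toHom x.pt)).trans
      (affineBaseExtMap_comp _ _)).symm

/-! ## Functors of points -/

/-- The spectrum of a ring, as a locally ringed space. -/
noncomputable abbrev specLRS : CommRingCat.{u}ᵒᵖ ⥤ LocallyRingedSpace.{u} :=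
  Scheme.Spec ⋙ Scheme.forgetToLocallyRingedSpace

section ClosedPoint

variable (A : CommMonZ.{u}) [Nontrivial A]

/-- The closed point of the spectrum of a non-trivial monoid: the ideal of all non-units. -/
def closedPt : MSpec A where
  carrier := {a | ¬ IsUnit a}
  zero_mem := not_isUnit_zero
  mul_mem _ h := fun k => h (isUnit_of_mul_isUnit_left k)
  one_notMem := fun h => h isUnit_one
  mul_notMem h k := fun e => e ((not_not.1 h).mul (not_not.1 k))

/-- Localizing at the closed point changes nothing. -/
noncomputable def locClosedPt : LocAt (closedPt A) →*₀ A :=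
  (Localization.monoidOf (closedPt A).compl).lift₀ (MonoidWithZeroHom.id A)
    (fun f => not_not.1 f.2)

lemma locClosedPt_mk (a : A) (f : (closedPt A).compl) :
    locClosedPt A (Localization.mk a f) * f.1 = a := by
  have h1 : ∀ b : A, locClosedPt A (Localization.mk b 1) = b := fun b =>
    (Localization.monoidOf (closedPt A).compl).lift_eq _ b
  conv_lhs => rw [← h1 f.1, ← map_mul, Localization.mk_mul]
  conv_rhs => rw [← h1 a]
  exact congrArg _ (Localization.mk_eq_mk_iff.2
    (Localization.r_iff_exists.2 ⟨1, by simp [mul_comm]⟩))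

/-- The canonical homomorphism from the stalk at the closed point of `Spec A` to `A`. -/
noncomputable def stalkClosedPt : stalk (specSpace A).presheaf (closedPt A) ⟶ A :=
  stalkToLoc A (closedPt A) ≫ CommMonZ.ofHom (locClosedPt A)

end ClosedPoint

/-- The spectrum of the zero ring is the empty scheme. -/
noncomputable def specLRSIsInitial (R : CommRingCat.{u}) [Subsingleton R] :
    Limits.IsInitial (specLRS.obj (op R)) := by
  have : IsEmpty (Scheme.Spec.obj (op R)) :=
    inferInstanceAs (IsEmpty (PrimeSpectrum R))
  let e : Scheme.Spec.obj (op R) ≅ (∅ : Scheme.{u}) :=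
    isInitialOfIsEmpty.uniqueUpToIso emptyIsInitial
  exact LocallyRingedSpace.emptyIsInitial.ofIso
    (Scheme.forgetToLocallyRingedSpace.mapIso e).symm

/-- The morphism from `Spec R`, for a non-zero ring `R`, to the base extension of the spectrum of
the multiplicative monoid of `R`. -/
noncomputable def specUnitAux (R : CommRingCat.{u}) [Nontrivial (forgetAdd.obj R)] :
    specLRS.obj (op R) ⟶ baseExt.obj (specSpace (forgetAdd.obj R)) :=
  specLRS.map (monToRing (stalkClosedPt (forgetAdd.obj R))).op ≫
    Limits.colimit.ι (stalkDiagram (specSpace (forgetAdd.obj R)).toPresheafedSpace)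
      ⟨closedPt (forgetAdd.obj R)⟩

open Classical in
/-- The canonical morphism from `Spec R` to the base extension of the spectrum of the
multiplicative monoid of `R`. If `R` is not the zero ring, then it is given by the homomorphism
`ℤ[O_x] / (1 · 0) → R`, where `x` is the closed point of the spectrum of the monoid. -/
noncomputable def specUnit (R : CommRingCat.{u}) :
    specLRS.obj (op R) ⟶ baseExt.obj (specSpace (forgetAdd.obj R)) :=
  if h : Nontrivial (forgetAdd.obj R) then specUnitAux R
  else (@specLRSIsInitial R (not_nontrivial_iff_subsingleton.1 h)).to _

/-- The closed point of a spectrum lies in no proper open subset. -/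
lemma eq_top_of_closedPt_mem (A : CommMonZ.{u}) [Nontrivial A] (U : Opens (MSpec A))
    (h : closedPt A ∈ U) (p : MSpec A) : p ∈ U := by
  obtain ⟨I, hI⟩ := (isClosed_iff_zeroLocus _).1 (isClosed_compl_iff.2 U.2)
  by_contra hp
  have hp' : p ∈ zeroLocus I := hI ▸ hp
  refine (hI ▸ (show closedPt A ∈ zeroLocus I from fun a ha hu => ?_) :
    closedPt A ∈ (U : Set (MSpec A))ᶜ) h
  obtain ⟨b, hb⟩ := hu.exists_right_inv
  exact p.one_notMem (hb ▸ p.mul_mem b (hp' ha))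

lemma stalkClosedPt_naturality {A B : CommMonZ.{u}} [Nontrivial A] [Nontrivial B] (g : A ⟶ B)
    (h : (specMapHom g).base (closedPt B) ⤳ closedPt A) :
    stalkSpecializes (specSpace A).presheaf h ≫ stalkMap (specMapHom g) (closedPt B) ≫
      stalkClosedPt B = stalkClosedPt A ≫ g := by
  refine stalk_hom_ext fun U hU => CommMonZ.hom_ext fun s => ?_
  change locClosedPt B (locMap (CommMonZ.Hom.hom g) (closedPt B)
    (s.1 ⟨(closedPt B).comap (CommMonZ.Hom.hom g), _⟩)) =
    CommMonZ.Hom.hom g (locClosedPt A (s.1 ⟨closedPt A, hU⟩))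
  obtain ⟨V, hV, i, a, f, hs⟩ := s.2 ⟨closedPt A, hU⟩
  obtain ⟨h1, h2⟩ := hs ⟨_, hV⟩
  obtain ⟨k1, k2⟩ := hs ⟨(closedPt B).comap (CommMonZ.Hom.hom g), eq_top_of_closedPt_mem A V hV _⟩
  refine (congrArg (fun t => locClosedPt B (locMap (CommMonZ.Hom.hom g) (closedPt B) t)) k2).trans
    (Eq.trans ?_ (congrArg (fun t => CommMonZ.Hom.hom g (locClosedPt A t)) h2).symm)
  rw [locMap_mk]
  have hf : IsUnit (CommMonZ.Hom.hom g f) := (not_not.1 h1).map _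
  refine hf.mul_right_cancel ?_
  rw [← map_mul]
  exact (locClosedPt_mk B _ ⟨_, k1⟩).trans
    (congrArg (CommMonZ.Hom.hom g) (locClosedPt_mk A a ⟨f, h1⟩)).symm

lemma spec_comp_eq {P Q Q' R S : CommRingCat.{u}} {Z : LocallyRingedSpace.{u}} {q : P ⟶ Q}
    {r : Q ⟶ Q'} {s : Q' ⟶ S} {t : P ⟶ R} {g : R ⟶ S} (e : q ≫ r ≫ s = t ≫ g)
    {i : specLRS.obj (op P) ⟶ Z} {j : specLRS.obj (op Q) ⟶ Z} (w : specLRS.map q.op ≫ i = j) :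
    specLRS.map g.op ≫ specLRS.map t.op ≫ i = specLRS.map s.op ≫ specLRS.map r.op ≫ j := by
  have e' := congrArg (fun r => specLRS.map r.op ≫ i) e
  simp only [op_comp, Functor.map_comp, Category.assoc] at e'
  rw [← w, e']

/-- The canonical morphism is natural in the ring. -/
lemma specUnit_naturality {R S : CommRingCat.{u}} (g : R ⟶ S) :
    specLRS.map g.op ≫ specUnit R =
      specUnit S ≫ baseExt.map (specFunctor.map (forgetAdd.map g).op) := by
  by_cases hS : Nontrivial (forgetAdd.obj S)
  · have hR : Nontrivial (forgetAdd.obj R) := by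
      by_contra hR
      have h01 : (0 : R) = 1 := @Subsingleton.elim _ (not_nontrivial_iff_subsingleton.1 hR) _ _
      have h01' := congrArg g.hom h01
      rw [map_zero, map_one] at h01'
      exact @zero_ne_one (forgetAdd.obj S) _ _ _ h01'
    have h : (specMapHom (forgetAdd.map g)).base (closedPt (forgetAdd.obj S)) ⤳
        closedPt (forgetAdd.obj R) :=
      specializes_iff_forall_open.2 fun U hU hc => eq_top_of_closedPt_mem _ ⟨U, hU⟩ hc _
    have e := congrArg monToRing (stalkClosedPt_naturality (forgetAdd.map g) h)
    have e1 := (map_monToRing _ _).trans (e.trans (monToRing_comp _ _).symm)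
    rw [← map_monToRing] at e1
    let k : (⟨(specMapHom (forgetAdd.map g)).base (closedPt (forgetAdd.obj S))⟩ :
        PointCat (specSpace (forgetAdd.obj R)).carrier) ⟶ ⟨closedPt (forgetAdd.obj R)⟩ :=
      homOfLE h
    have w : affineBaseExtMap (stalkSpecializes (specSpace (forgetAdd.obj R)).presheaf h) ≫ _ = _ :=
      Limits.colimit.w (stalkDiagram (specSpace (forgetAdd.obj R)).toPresheafedSpace) k
    have uR : specUnit R = specUnitAux R := dif_pos hR
    have uS : specUnit S = specUnitAux S := dif_pos hS
    rw [uR, uS]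
    refine (spec_comp_eq e1 w).trans ?_
    refine (congrArg (_ ≫ ·) (ι_baseExtMap (specMapHom (forgetAdd.map g))
      ⟨closedPt (forgetAdd.obj S)⟩).symm).trans ?_
    exact (Category.assoc _ _ _).symm
  · have : Subsingleton S := not_nontrivial_iff_subsingleton.1 hS
    exact (specLRSIsInitial S).hom_ext _ _

/-- The Zariski topology on the category of affine schemes. -/
noncomputable def zariskiAff : GrothendieckTopology CommRingCat.{u}ᵒᵖ :=
  Scheme.Spec.inducedTopology Scheme.zariskiTopology

instance : Scheme.Spec.IsCoverDense Scheme.zariskiTopology.{u} where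
  is_cover X := by
    refine Scheme.zariskiTopology.superset_covering ?_
      X.affineOpenCover.openCover.mem_grothendieckTopology
    refine (Sieve.generate_le_iff _ _).2 ?_
    rintro _ _ ⟨i⟩
    exact ⟨⟨op (X.affineOpenCover.X i), 𝟙 _, X.affineOpenCover.f i, Category.id_comp _⟩⟩

/-- A sieve is a covering if and only if its image generates a Zariski covering. -/
lemma mem_zariskiAff_iff {R : CommRingCat.{u}ᵒᵖ} (S : Sieve R) :
    S ∈ zariskiAff R ↔ S.functorPushforward Scheme.Spec ∈ Scheme.zariskiTopology (Scheme.Spec.obj R) :=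
  Functor.mem_inducedTopology_iff_of_isCoverDense _ _ _

/-- The presheaf `R ↦ F(R)` on affine schemes, where a ring `R` is considered as a monoid. -/
def multPresheaf : (CommMonZ.{u} ⥤ Type u) ⥤ ((CommRingCat.{u}ᵒᵖ)ᵒᵖ ⥤ Type (u + 1)) :=
  (Functor.whiskeringRight _ _ _).obj uliftFunctor.{u + 1, u} ⋙
    (Functor.whiskeringLeft _ _ _).obj (unopUnop CommRingCat.{u} ⋙ forgetAdd)

/-- The base extension `F ↦ F_ℤ` of functors on monoids with zero: `F_ℤ` is the functor on rings
that is the Zariski sheaf associated with `R ↦ F(R)`. -/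
noncomputable def functorBaseExt : (CommMonZ.{u} ⥤ Type u) ⥤ (CommRingCat.{u} ⥤ Type (u + 1)) :=
  multPresheaf ⋙ sheafification zariskiAff.{u} (Type (u + 1)) ⋙
    (Functor.whiskeringLeft _ _ _).obj (opOp CommRingCat.{u})

/-- The functor of points of a scheme, as a presheaf on affine schemes. -/
noncomputable def affPresheaf : Scheme.{u} ⥤ ((CommRingCat.{u}ᵒᵖ)ᵒᵖ ⥤ Type (u + 1)) :=
  yoneda ⋙ (Functor.whiskeringLeft _ _ _).obj Scheme.Spec.op ⋙
    (Functor.whiskeringRight _ _ _).obj uliftFunctor.{u + 1, u}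

/-- The functor of points of a scheme is a Zariski sheaf. -/
lemma affPresheaf_isSheaf (S : Scheme.{u}) : Presheaf.IsSheaf zariskiAff (affPresheaf.obj S) := by
  refine (isSheaf_iff_isSheaf_of_type _ _).2 ?_
  refine Presieve.isSheaf_comp_uliftFunctor _ ?_
  have h : Presieve.IsSheaf Scheme.zariskiTopology (yoneda.obj S) :=
    GrothendieckTopology.Subcanonical.isSheaf_of_isRepresentable _
  have : Scheme.Spec.IsContinuous zariskiAff.{u} Scheme.zariskiTopology.{u} :=
    inferInstanceAs (Scheme.Spec.IsContinuous
      (Scheme.Spec.inducedTopology Scheme.zariskiTopology.{u}) Scheme.zariskiTopology.{u})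
  exact Functor.op_comp_isSheaf_of_types Scheme.Spec zariskiAff Scheme.zariskiTopology
    ⟨_, (isSheaf_iff_isSheaf_of_type _ _).2 h⟩

/-! ## Generalized torified schemes -/

/-- The map `X(R) → S(R)`, for a ring `R`, that is induced by a morphism `e : X_ℤ → S`. It sends
`f : Spec R → X` (where `R` is considered as a monoid) to the composition of `Spec R → (Spec R)_ℤ`
with `f_ℤ` and with `e`. -/
noncomputable def evPoint {X : MonoidalSpace.{u}} {S : Scheme.{u}}
    (e : baseExt.obj X ⟶ S.toLocallyRingedSpace) (R : CommRingCat.{u})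
    (f : (spacePoints.obj X).obj (forgetAdd.obj R)) : (schemePoints.obj S).obj R :=
  Scheme.fullyFaithfulForgetToLocallyRingedSpace.preimage
    (X := Scheme.Spec.obj (op R)) (Y := S) (specUnit R ≫ baseExt.map f ≫ e)

lemma evPoint_toLRSHom {X : MonoidalSpace.{u}} {S : Scheme.{u}}
    (e : baseExt.obj X ⟶ S.toLocallyRingedSpace) (R : CommRingCat.{u})
    (f : (spacePoints.obj X).obj (forgetAdd.obj R)) :
    Scheme.forgetToLocallyRingedSpace.map (X := Scheme.Spec.obj (op R)) (Y := S) (evPoint e R f) =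
      specUnit R ≫ baseExt.map f ≫ e :=
  Scheme.fullyFaithfulForgetToLocallyRingedSpace.map_preimage _

lemma evPoint_naturality {X : MonoidalSpace.{u}} {S : Scheme.{u}}
    (e : baseExt.obj X ⟶ S.toLocallyRingedSpace) {R R' : CommRingCat.{u}} (g : R ⟶ R')
    (f : (spacePoints.obj X).obj (forgetAdd.obj R)) :
    evPoint e R' ((spacePoints.obj X).map (forgetAdd.map g) f) =
      (schemePoints.obj S).map g (evPoint e R f) := by
  refine Scheme.forgetToLocallyRingedSpace.map_injective ((evPoint_toLRSHom _ _ _).trans ?_)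
  refine Eq.trans ?_ (Scheme.forgetToLocallyRingedSpace.map_comp (Scheme.Spec.map g.op) _).symm
  refine Eq.trans ?_ (congrArg (_ ≫ ·) (evPoint_toLRSHom e R f).symm)
  have h := specUnit_naturality g
  refine Eq.trans ?_ ((congrArg (· ≫ baseExt.map f ≫ e) h).symm.trans (Category.assoc _ _ _))
  refine (congrArg (fun m => specUnit R' ≫ m ≫ e)
    (baseExt.map_comp (specFunctor.map (forgetAdd.map g).op) f)).trans ?_
  exact (congrArg (specUnit R' ≫ ·) (Category.assoc _ _ _)).trans (Category.assoc _ _ _).symm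

lemma evPoint_map {X Y : MonoidalSpace.{u}} {S T : Scheme.{u}}
    {d : baseExt.obj Y ⟶ T.toLocallyRingedSpace} {e : baseExt.obj X ⟶ S.toLocallyRingedSpace}
    {p : Y ⟶ X} {q : T ⟶ S}
    (w : baseExt.map p ≫ e = d ≫ Scheme.forgetToLocallyRingedSpace.map q) (R : CommRingCat.{u})
    (f : (spacePoints.obj Y).obj (forgetAdd.obj R)) :
    evPoint e R ((spacePoints.map p).app _ f) = (schemePoints.map q).app R (evPoint d R f) := by
  refine Scheme.forgetToLocallyRingedSpace.map_injective ((evPoint_toLRSHom _ _ _).trans ?_)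
  refine Eq.trans ?_ (Scheme.forgetToLocallyRingedSpace.map_comp (evPoint d R f) q).symm
  refine Eq.trans ?_ (congrArg (· ≫ _) (evPoint_toLRSHom d R f).symm)
  refine (congrArg (fun m => specUnit R ≫ m ≫ e) (baseExt.map_comp f p)).trans ?_
  refine (congrArg (specUnit R ≫ ·) ((Category.assoc _ _ _).trans
    (congrArg (baseExt.map f ≫ ·) w))).trans ?_
  exact ((Category.assoc _ _ _).trans (congrArg (specUnit R ≫ ·) (Category.assoc _ _ _))).symm

/-- The natural transformation of presheaves on affine schemes that is induced by `e : X_ℤ → S`. -/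
noncomputable def evPre {X : MonoidalSpace.{u}} {S : Scheme.{u}}
    (e : baseExt.obj X ⟶ S.toLocallyRingedSpace) :
    multPresheaf.obj (spacePoints.obj X) ⟶ affPresheaf.obj S where
  app R := ↾fun f => ULift.up (evPoint e R.unop.unop f.down)
  naturality _ _ g := by
    ext f
    exact congrArg ULift.up (evPoint_naturality e g.unop.unop f.down)

/-- The natural transformation `X(-)_ℤ → S(-)` of functors on rings that is induced by a morphism
`e : X_ℤ → S`. -/
noncomputable def evTransform {X : MonoidalSpace.{u}} {S : Scheme.{u}}
    (e : baseExt.obj X ⟶ S.toLocallyRingedSpace) :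
    functorBaseExt.obj (spacePoints.obj X) ⟶ schemePoints.obj S ⋙ uliftFunctor.{u + 1, u} :=
  Functor.whiskerLeft (opOp CommRingCat.{u})
    (sheafifyLift zariskiAff (evPre e) (affPresheaf_isSheaf S))

lemma evTransform_map {X Y : MonoidalSpace.{u}} {S T : Scheme.{u}}
    {d : baseExt.obj Y ⟶ T.toLocallyRingedSpace} {e : baseExt.obj X ⟶ S.toLocallyRingedSpace}
    {p : Y ⟶ X} {q : T ⟶ S}
    (w : baseExt.map p ≫ e = d ≫ Scheme.forgetToLocallyRingedSpace.map q) :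
    functorBaseExt.map (spacePoints.map p) ≫ evTransform e =
      evTransform d ≫ Functor.whiskerRight (schemePoints.map q) uliftFunctor.{u + 1, u} := by
  have h : multPresheaf.map (spacePoints.map p) ≫ evPre e = evPre d ≫ affPresheaf.map q := by
    ext R f
    exact congrArg ULift.up (evPoint_map w R.unop.unop f.down)
  have h2 : sheafifyMap zariskiAff (multPresheaf.map (spacePoints.map p)) ≫
      sheafifyLift zariskiAff (evPre e) (affPresheaf_isSheaf S) =
      sheafifyLift zariskiAff (evPre d) (affPresheaf_isSheaf T) ≫ affPresheaf.map q := by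
    refine sheafify_hom_ext _ _ _ (affPresheaf_isSheaf S) ?_
    rw [sheafifyMap_sheafifyLift, toSheafify_sheafifyLift, h, ← Category.assoc,
      toSheafify_sheafifyLift]
  exact congrArg (Functor.whiskerLeft (opOp CommRingCat.{u})) h2

/-- The map on `k`-valued points induced by a morphism of locally ringed spaces. -/
noncomputable def fieldPointsMap {X Y : LocallyRingedSpace.{u}} (e : X ⟶ Y) (k : Type u) [Field k] :
    (specLRS.obj (op (CommRingCat.of k)) ⟶ X) → (specLRS.obj (op (CommRingCat.of k)) ⟶ Y) :=
  fun p => p ≫ e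

/-- A generalized torified scheme: a geometric scheme over monoids with zero `space`, a scheme
`scheme` and a morphism from the base extension of `space` to `scheme` that is a bijection on
`k`-valued points for all fields `k`. -/
structure GenTorified : Type (u + 1) where
  /-- The geometric scheme over monoids with zero. -/
  space : GeomScheme.{u}
  /-- The scheme. -/
  scheme : Scheme.{u}
  /-- The morphism from the base extension. -/
  e : baseExt.obj space.obj ⟶ scheme.toLocallyRingedSpace
  bijective : ∀ (k : Type u) [Field k], Function.Bijective (fieldPointsMap e k)

namespace GenTorified

/-- A morphism of generalized torified schemes: a pair of morphisms that are compatible with the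
morphisms from the base extensions. -/
@[ext]
structure Hom (X Y : GenTorified.{u}) where
  /-- The morphism of geometric schemes over monoids with zero. -/
  space : X.space ⟶ Y.space
  /-- The morphism of schemes. -/
  scheme : X.scheme ⟶ Y.scheme
  comm : baseExt.map space.hom ≫ Y.e = X.e ≫ Scheme.forgetToLocallyRingedSpace.map scheme

noncomputable instance : Category GenTorified.{u} where
  Hom := Hom
  id X :=
    { space := 𝟙 _
      scheme := 𝟙 _
      comm := by
        refine (congrArg (· ≫ X.e) (baseExt.map_id X.space.obj)).trans ?_
        exact (Category.id_comp _).trans (Category.comp_id _).symm }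
  comp {X Y Z} f g :=
    { space := f.space ≫ g.space
      scheme := f.scheme ≫ g.scheme
      comm := by
        refine (congrArg (· ≫ Z.e) (baseExt.map_comp f.space.hom g.space.hom)).trans ?_
        refine (Category.assoc _ _ _).trans ((congrArg (_ ≫ ·) g.comm).trans ?_)
        exact (Category.assoc _ _ _).symm.trans ((congrArg (· ≫ _) f.comm).trans
          (Category.assoc _ _ _)) }

end GenTorified

/-! ## Functors on monoids with zero -/

/-- The functor `Spec A : B ↦ Hom(A, B)`. -/
abbrev affineFunctor (A : CommMonZ.{u}) : CommMonZ.{u} ⥤ Type u := coyoneda.obj (op A)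

/-- The condition that `ρ(I) B = B`. -/
def GeneratesUnit {A B : CommMonZ.{u}} (I : MIdeal A) (ρ : A ⟶ B) : Prop :=
  ∀ c : B, ∃ i ∈ I.carrier, ∃ b : B, CommMonZ.Hom.hom ρ i * b = c

/-- A subfunctor `Y` of `X` is open if for all morphisms `φ : Spec A → X` there is an ideal `I` of
`A` such that a homomorphism `ρ : A → B` is sent to `Y(B)` if and only if `ρ(I) B = B`. -/
def IsOpenSubfunctor {X : CommMonZ.{u} ⥤ Type u} (Y : Subfunctor X) : Prop :=
  ∀ (A : CommMonZ.{u}) (φ : affineFunctor A ⟶ X), ∃ I : MIdeal A,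
    ∀ (B : CommMonZ.{u}) (ρ : A ⟶ B), φ.app B ρ ∈ Y.obj B ↔ GeneratesUnit I ρ

lemma IsOpenSubfunctor.preimage {X Y : CommMonZ.{u} ⥤ Type u} {V : Subfunctor Y}
    (hV : IsOpenSubfunctor V) (φ : X ⟶ Y) : IsOpenSubfunctor (V.preimage φ) :=
  fun A ψ => hV A (ψ ≫ φ)

/-- A monoid is a group with zero if it is the union of a group and of a zero. -/
def IsGroupZ (H : CommMonZ.{u}) : Prop := Nontrivial H ∧ ∀ h : H, h ≠ 0 → IsUnit h

/-- An open cover of `X`: a non-empty collection of open subfunctors that is jointly surjective on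
the points with values in a group with zero. -/
def IsOpenCover {X : CommMonZ.{u} ⥤ Type u} (𝒰 : Set (Subfunctor X)) : Prop :=
  𝒰.Nonempty ∧ (∀ U ∈ 𝒰, IsOpenSubfunctor U) ∧
    ∀ H : CommMonZ.{u}, IsGroupZ H → ∀ x : X.obj H, ∃ U ∈ 𝒰, x ∈ U.obj H

/-- A functor is a scheme over monoids with zero if it has an open cover by functors that are
isomorphic to some `Spec A`. -/
def IsMScheme (X : CommMonZ.{u} ⥤ Type u) : Prop :=
  ∃ 𝒰 : Set (Subfunctor X), IsOpenCover 𝒰 ∧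
    ∀ U ∈ 𝒰, ∃ A : CommMonZ.{u}, Nonempty (U.toFunctor ≅ affineFunctor A)

/-- The monoid `{0, 1}`. -/
abbrev monF1 : CommMonZ.{u} := CommMonZ.of (WithZero PUnit.{u + 1})

/-- The sections on a functor `U`: the natural transformations from `U` to the affine line, which
is the functor `A ↦ A`. -/
abbrev Sections (U : CommMonZ.{u} ⥤ Type u) : Type (u + 1) := U ⟶ forget CommMonZ.{u}

/-- The germ at `x` of the section `s` on `U` is invertible in the stalk (the colimit of the
sections over all open neighbourhoods of `x`). The points of a functor `X` are the elements of
`X({0, 1})`. -/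
def IsUnitAt {X : CommMonZ.{u} ⥤ Type u} {U : Subfunctor X} (s : Sections U.toFunctor)
    (x : X.obj monF1.{u}) : Prop :=
  ∃ (W : Subfunctor X) (_ : IsOpenSubfunctor W) (_ : x ∈ W.obj monF1) (i : W ≤ U)
    (t : Sections W.toFunctor),
    ∀ (A : CommMonZ.{u}) (y : W.toFunctor.obj A),
      ((Subfunctor.homOfLe i ≫ s).app A y : A) * (t.app A y : A) = 1

/-- A natural transformation `φ : X → Y` is local if for all points `x` of `X` and all germs `f` at
`φ(x)` such that the pull-back of `f` to the stalk at `x` is invertible, `f` is invertible. -/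
def IsLocalTransform {X Y : CommMonZ.{u} ⥤ Type u} (φ : X ⟶ Y) : Prop :=
  ∀ (x : X.obj monF1.{u}) (V : Subfunctor Y), IsOpenSubfunctor V →
    φ.app monF1 x ∈ V.obj monF1 → ∀ f : Sections V.toFunctor,
      IsUnitAt (U := V.preimage φ) (V.fromPreimage φ ≫ f) x → IsUnitAt f (φ.app monF1 x)

lemma isLocalTransform_id (X : CommMonZ.{u} ⥤ Type u) : IsLocalTransform (𝟙 X) :=
  fun _ _ _ _ _ h => h

lemma isLocalTransform_comp {X Y Z : CommMonZ.{u} ⥤ Type u} {φ : X ⟶ Y} {ψ : Y ⟶ Z}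
    (hφ : IsLocalTransform φ) (hψ : IsLocalTransform ψ) : IsLocalTransform (φ ≫ ψ) :=
  fun x V hV hx f h => hψ (φ.app monF1 x) V hV hx f
    (hφ x (V.preimage ψ) (hV.preimage ψ) hx (V.fromPreimage ψ ≫ f) h)

/-! ## Schemes over the field with one element as triples of functors -/

/-- A triple that consists of a functor `F` on monoids with zero, of a functor `G` on rings and of
a natural transformation from the base extension of `F` to `G`. -/
structure Triple : Type (u + 2) where
  /-- The functor on monoids with zero. -/
  F : CommMonZ.{u} ⥤ Type u
  /-- The functor on rings. -/
  G : CommRingCat.{u} ⥤ Type u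
  /-- The evaluation. -/
  ev : functorBaseExt.obj F ⟶ G ⋙ uliftFunctor.{u + 1, u}

namespace Triple

/-- A morphism of triples: a pair of natural transformations that are compatible with the
evaluations. -/
@[ext]
structure Hom (X Y : Triple.{u}) where
  /-- The transformation of functors on monoids with zero. -/
  F : X.F ⟶ Y.F
  /-- The transformation of functors on rings. -/
  G : X.G ⟶ Y.G
  comm : functorBaseExt.map F ≫ Y.ev = X.ev ≫ Functor.whiskerRight G uliftFunctor.{u + 1, u}

noncomputable instance : Category Triple.{u} where
  Hom := Hom
  id X :=
    { F := 𝟙 _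
      G := 𝟙 _
      comm := by
        refine (congrArg (· ≫ X.ev) (functorBaseExt.map_id X.F)).trans ?_
        exact (Category.id_comp _).trans (Category.comp_id _).symm }
  comp {X Y Z} f g :=
    { F := f.F ≫ g.F
      G := f.G ≫ g.G
      comm := by
        refine (congrArg (· ≫ Z.ev) (functorBaseExt.map_comp f.F g.F)).trans ?_
        refine (Category.assoc _ _ _).trans ((congrArg (_ ≫ ·) g.comm).trans ?_)
        exact (Category.assoc _ _ _).symm.trans ((congrArg (· ≫ _) f.comm).trans
          (Category.assoc _ _ _)) }

end Triple

/-- A CC-scheme: a triple `(F, G, ev)` in which `F` is a scheme over monoids with zero, `G` is (the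
functor of points of) a scheme and `ev` is a bijection on `k`-valued points for all fields `k`. -/
structure CCScheme : Type (u + 2) extends Triple.{u} where
  isMScheme : IsMScheme F
  isScheme : ∃ S : Scheme.{u}, Nonempty (G ≅ schemePoints.obj S)
  bijective : ∀ (k : Type u) [Field k], Function.Bijective (ev.app (CommRingCat.of k))

namespace CCScheme

/-- A morphism of CC-schemes: a morphism of triples whose first component is a morphism of schemes
over monoids with zero, that is, a local natural transformation. -/
@[ext]
structure Hom (X Y : CCScheme.{u}) where
  /-- The underlying morphism of triples. -/
  toTriple : X.toTriple ⟶ Y.toTriple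
  isLocal : IsLocalTransform toTriple.F

noncomputable instance : Category CCScheme.{u} where
  Hom := Hom
  id X := ⟨𝟙 X.toTriple, isLocalTransform_id _⟩
  comp f g := ⟨f.toTriple ≫ g.toTriple, isLocalTransform_comp f.isLocal g.isLocal⟩

/-- The functor that forgets the conditions. -/
noncomputable def forget : CCScheme.{u} ⥤ Triple.{u} where
  obj X := X.toTriple
  map f := f.toTriple

end CCScheme

/-- The functor that sends a generalized torified scheme `(X, S, e)` to the triple that consists of
the functors of points of `X` and of `S` and of the natural transformation induced by `e`. -/
noncomputable def torifiedToTriple : GenTorified.{u} ⥤ Triple.{u} where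
  obj X := ⟨spacePoints.obj X.space.obj, schemePoints.obj X.scheme, evTransform X.e⟩
  map f := ⟨spacePoints.map f.space.hom, schemePoints.map f.scheme, evTransform_map f.comm⟩
  map_id X := Triple.Hom.ext (spacePoints.map_id X.space.obj) (schemePoints.map_id X.scheme)
  map_comp f g := Triple.Hom.ext (spacePoints.map_comp f.space.hom g.space.hom)
    (schemePoints.map_comp f.scheme g.scheme)

end FOne

/-! The prime ideals of a monoid `A` are the homomorphisms `A → {0,1}` (`chi`), and a non-trivial
monoid has a largest prime ideal, its closed point; an open set that contains the closed point is
the whole spectrum. An element `g` of `F(A)` therefore gives a map `p ↦ F(chi p)(g)` from `Spec A`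
to the points of `F`. Open subfunctors are determined by their points (`IsOpenSubfunctor.mem_iff`)
and correspond to the open sets of a topology on `F({0,1})`. The locus where a section is a unit is
open and is detected on points, so every natural transformation is local (`isLocalTransform`), and
the locality required of morphisms of CC-schemes is automatic.

Spaces and functors are compared by a `Realization`: points of `G` give points of `Y`, sections on
`Y` have values at elements of `G`, and a germ is a unit if its value at the point is one. If `Y`
has exactly the points, open sets and sections of `G`, then a transformation from `G` to a functor
realized by another space comes with exactly one compatible morphism out of `Y`
(`Realization.exists_compat`, `Realization.Compat.unique`). Exact realizations are `Spec B` for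
`Hom(B, -)`, a geometric scheme for its functor of points, and `functorSpace F` for `F`. The first
two make `Spec`, and the functor of points on geometric schemes, fully faithful. By
`Represents.isOpenImm`, affine open subfunctors correspond to open immersions of spectra. Hence
functors of points of geometric schemes are `M_0`-schemes, and an `M_0`-scheme `F` is the functor of
points of the geometric scheme `functorSpace F` (`IsMScheme.nonempty_iso`).

The base extension is the colimit of the spectra of `ℤ[O_x]/(1·0)`. A morphism `Spec A → X` with `A`
non-trivial factors through the spectrum of the stalk at the image of the closed point. By the
adjunction between `A ↦ ℤ[A]/(1·0)` and the passage to multiplicative monoids, morphisms `X_ℤ → S`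
are thus the natural families of maps `X(R) → S(R)`, that is, the transformations from the
sheafification (`IsGeometric.exists_evTransform_eq`, `IsGeometric.evTransform_injective`). The
colimit is a scheme because the points with a smallest affine neighbourhood are final among all
points, and over them the transition maps are localizations at one element, hence open immersions.

The spectrum of a field has one point and only trivial coverings, so `X(k)`, `X_ℤ(k)` and the value
of the sheafified functor at `k` agree, and the two bijectivity conditions are equivalent
(`IsGeometric.evTransform_bijective_iff`). Together with the full faithfulness of functors of points
of schemes this yields a fully faithful and essentially surjective functor. -/

namespace FOne

/-! ## Prime ideals and characters -/

section Characters

variable {A B C : CommMonZ.{u}}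

instance : Nontrivial monF1.{u} := inferInstanceAs (Nontrivial (WithZero PUnit.{u + 1}))

lemma monF1_eq_zero_or_one (a : monF1.{u}) : a = 0 ∨ a = 1 := by
  rcases a with _ | ⟨⟨⟩⟩
  · exact Or.inl rfl
  · exact Or.inr rfl

lemma isUnit_monF1_iff {a : monF1.{u}} : IsUnit a ↔ a = 1 := by
  constructor
  · intro h
    rcases monF1_eq_zero_or_one a with rfl | h'
    · exact (not_isUnit_zero h).elim
    · exact h'
  · rintro rfl
    exact isUnit_one

lemma isGroupZ_monF1 : IsGroupZ monF1.{u} :=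
  ⟨inferInstance, fun h h0 => isUnit_monF1_iff.2 ((monF1_eq_zero_or_one h).resolve_left h0)⟩

lemma MSpec.nontrivial (p : MSpec A) : Nontrivial A :=
  ⟨0, 1, fun h => p.one_notMem (h ▸ p.zero_mem)⟩

lemma MSpec.not_isUnit {p : MSpec A} {a : A} (h : a ∈ p.carrier) : ¬ IsUnit a := fun ⟨v, hv⟩ =>
  p.one_notMem (by
    have := p.mul_mem (↑v⁻¹ : A) h
    rwa [← hv, Units.mul_inv] at this)

lemma MSpec.subset_closedPt [Nontrivial A] (p : MSpec A) : p.carrier ⊆ (closedPt A).carrier :=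
  fun _ h => MSpec.not_isUnit h

lemma exists_basicOpen_le (U : Opens (MSpec A)) {p : MSpec A} (hp : p ∈ U) :
    ∃ f : A, f ∉ p.carrier ∧ ∀ q : MSpec A, f ∉ q.carrier → q ∈ U := by
  obtain ⟨I, hI⟩ := (isClosed_iff_zeroLocus _).1 (isClosed_compl_iff.2 U.2)
  have h : p ∉ zeroLocus I := hI ▸ fun h => h hp
  obtain ⟨f, hf, hfp⟩ := Set.not_subset.1 h
  refine ⟨f, hfp, fun q hq => ?_⟩
  by_contra hqU
  have : q ∈ zeroLocus I := hI ▸ hqU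
  exact hq (this hf)

/-- Open sets are stable under generization, because they are unions of the sets `basicOpen f`. -/
lemma MSpec.mem_of_subset (U : Opens (MSpec A)) {p q : MSpec A} (hp : p ∈ U)
    (h : q.carrier ⊆ p.carrier) : q ∈ U := by
  obtain ⟨f, hf, hU⟩ := exists_basicOpen_le U hp
  exact hU q fun hq => hf (h hq)

open Classical in
/-- The homomorphism to `{0, 1}` whose kernel is a given prime ideal. -/
noncomputable def chi (p : MSpec A) : A ⟶ monF1.{u} :=
  CommMonZ.ofHom (A := A) (B := WithZero PUnit.{u + 1})
    { toFun a := if a ∈ p.carrier then 0 else 1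
      map_zero' := if_pos p.zero_mem
      map_one' := if_neg p.one_notMem
      map_mul' a b := by
        by_cases ha : a ∈ p.carrier
        · rw [if_pos ha, if_pos (p.mul_mem b ha), zero_mul]
        · by_cases hb : b ∈ p.carrier
          · rw [if_pos hb, if_pos (mul_comm a b ▸ p.mul_mem a hb), mul_zero]
          · rw [if_neg ha, if_neg hb, if_neg (p.mul_notMem ha hb), one_mul] }

open Classical in
lemma chi_eq_one_iff {p : MSpec A} {a : A} : CommMonZ.Hom.hom (chi p) a = 1 ↔ a ∉ p.carrier := by
  change (if a ∈ p.carrier then (0 : WithZero PUnit.{u + 1}) else 1) = 1 ↔ _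
  split_ifs with h <;> simp [h]

lemma chi_isUnit_iff {p : MSpec A} {a : A} :
    IsUnit (CommMonZ.Hom.hom (chi p) a) ↔ a ∉ p.carrier :=
  isUnit_monF1_iff.trans chi_eq_one_iff

lemma monF1_hom_ext {f g : A ⟶ monF1.{u}}
    (h : ∀ a, CommMonZ.Hom.hom f a = 1 ↔ CommMonZ.Hom.hom g a = 1) : f = g := by
  refine CommMonZ.hom_ext fun a => ?_
  change CommMonZ.Hom.hom f a = CommMonZ.Hom.hom g a
  rcases monF1_eq_zero_or_one (CommMonZ.Hom.hom f a) with h0 | h1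
  · rcases monF1_eq_zero_or_one (CommMonZ.Hom.hom g a) with k0 | k1
    · exact h0.trans k0.symm
    · exact ((h a).2 k1).trans k1.symm
  · exact h1.trans ((h a).1 h1).symm

lemma comp_chi (ρ : A ⟶ B) (q : MSpec B) : ρ ≫ chi q = chi (q.comap (CommMonZ.Hom.hom ρ)) :=
  monF1_hom_ext fun _ => chi_eq_one_iff.trans (chi_eq_one_iff (p := q.comap _)).symm

lemma mem_closedPt_monF1 {a : monF1.{u}} : a ∈ (closedPt monF1.{u}).carrier ↔ a ≠ 1 :=
  not_congr isUnit_monF1_iff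

lemma MSpec.monF1_eq (p : MSpec monF1.{u}) : p = closedPt monF1 := by
  ext a
  rw [mem_closedPt_monF1]
  rcases monF1_eq_zero_or_one a with rfl | rfl
  · exact ⟨fun _ => zero_ne_one, fun _ => p.zero_mem⟩
  · exact ⟨fun h => (p.one_notMem h).elim, fun h => (h rfl).elim⟩

lemma chi_mem_closedPt {p : MSpec A} {a : A} :
    CommMonZ.Hom.hom (chi p) a ∈ (closedPt monF1.{u}).carrier ↔ a ∈ p.carrier := by
  change ¬ IsUnit _ ↔ _
  rw [chi_isUnit_iff, not_not]

lemma chi_monF1 (p : MSpec monF1.{u}) : chi p = 𝟙 _ := by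
  refine monF1_hom_ext fun a => ?_
  rw [chi_eq_one_iff, p.monF1_eq, mem_closedPt_monF1, not_not]
  rfl

lemma comap_chi (p : MSpec A) : (closedPt monF1.{u}).comap (CommMonZ.Hom.hom (chi p)) = p := by
  ext a
  exact chi_mem_closedPt

/-- Together with `comap_chi` this makes `chi` a bijection from the prime ideals of `A` to the
homomorphisms `A → {0,1}`. -/
lemma chi_comap (φ : A ⟶ monF1.{u}) : chi ((closedPt monF1).comap (CommMonZ.Hom.hom φ)) = φ := by
  rw [← comp_chi, chi_monF1, Category.comp_id]

lemma MSpec.comap_comp (φ : A ⟶ B) (ψ : B ⟶ C) (q : MSpec C) :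
    q.comap (CommMonZ.Hom.hom (φ ≫ ψ)) =
      (q.comap (CommMonZ.Hom.hom ψ)).comap (CommMonZ.Hom.hom φ) := rfl

/-- Every prime ideal of `B` is contained in the closed point, so the image of the closed point
decides whether the whole of `Spec B` lands in `U`. -/
lemma closedPt_comap_mem [Nontrivial B] (φ : A ⟶ B) (U : Opens (MSpec A))
    (h : (closedPt B).comap (CommMonZ.Hom.hom φ) ∈ U) (q : MSpec B) :
    q.comap (CommMonZ.Hom.hom φ) ∈ U :=
  MSpec.mem_of_subset U h (Set.preimage_mono q.subset_closedPt)

/-- No sums are involved: `ρ(I)B` is the union of the sets `ρ(i)B`, so it is `B` as soon as one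
`ρ(i)` is a unit. It suffices to test on the prime ideal of all non-units. If `0 = 1` in `B`, there
is no prime ideal and both sides hold. -/
lemma generatesUnit_iff {I : MIdeal A} {ρ : A ⟶ B} : GeneratesUnit I ρ ↔
    ∀ q : MSpec B, ∃ i ∈ I.carrier, CommMonZ.Hom.hom ρ i ∉ q.carrier := by
  constructor
  · intro h q
    obtain ⟨i, hi, b, hb⟩ := h 1
    exact ⟨i, hi, fun hq => q.one_notMem (hb ▸ q.mul_mem b hq)⟩
  · intro h c
    by_cases hB : Nontrivial B
    · obtain ⟨i, hi, hu⟩ := h (closedPt B)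
      obtain ⟨b, hb⟩ := (not_not.1 hu).exists_right_inv
      exact ⟨i, hi, b * c, by rw [← mul_assoc, hb, one_mul]⟩
    · have := not_nontrivial_iff_subsingleton.1 hB
      exact ⟨0, I.zero_mem, 0, Subsingleton.elim _ _⟩

lemma generatesUnit_chi_iff {I : MIdeal A} {p : MSpec A} : GeneratesUnit I (chi p) ↔
    ∃ i ∈ I.carrier, i ∉ p.carrier := by
  rw [generatesUnit_iff]
  constructor
  · intro h
    obtain ⟨i, hi, hip⟩ := h (closedPt _)
    exact ⟨i, hi, fun hp => hip (chi_mem_closedPt.2 hp)⟩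
  · rintro ⟨i, hi, hip⟩ q
    refine ⟨i, hi, ?_⟩
    rw [q.monF1_eq]
    exact fun hq => hip (chi_mem_closedPt.1 hq)

end Characters

/-! ## Localizations -/

section Localization

variable {A B : CommMonZ.{u}} (S : Submonoid A)

/-- The localization of a monoid with zero at a submonoid. -/
abbrev locObj : CommMonZ.{u} := CommMonZ.of (Localization S)

/-- The canonical homomorphism to the localization. -/
def locHom : A ⟶ locObj S :=
  CommMonZ.ofHom (A := A) (B := Localization S)
    { toFun a := Localization.mk a 1
      map_zero' := Localization.mk_zero 1
      map_one' := Localization.mk_one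
      map_mul' a b := by rw [Localization.mk_mul, one_mul] }

lemma locHom_apply (a : A) : CommMonZ.Hom.hom (locHom S) a = Localization.mk a 1 := rfl

lemma mk_mul_locHom (a : A) (f : S) :
    (Localization.mk a f * CommMonZ.Hom.hom (locHom S) f : locObj S) =
      CommMonZ.Hom.hom (locHom S) a := by
  rw [locHom_apply, locHom_apply, Localization.mk_mul]
  exact Localization.mk_eq_mk_iff.2 (Localization.r_iff_exists.2 ⟨1, by simp [mul_comm]⟩)

lemma locHom_isUnit (f : S) : IsUnit (CommMonZ.Hom.hom (locHom S) f) := by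
  refine IsUnit.of_mul_eq_one (Localization.mk 1 f) ?_
  rw [mul_comm]
  exact (mk_mul_locHom S 1 f).trans (map_one _)

variable {S}

lemma eq_mk_of_mul_locHom {t : locObj S} {a : A} {f : S}
    (h : t * CommMonZ.Hom.hom (locHom S) f = CommMonZ.Hom.hom (locHom S) a) :
    t = Localization.mk a f :=
  (locHom_isUnit S f).mul_right_cancel (h.trans (mk_mul_locHom S a f).symm)

/-- The universal property of the localization. -/
noncomputable def locLift (g : A ⟶ B) (hg : ∀ f : S, IsUnit (CommMonZ.Hom.hom g f)) :
    locObj S ⟶ B :=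
  CommMonZ.ofHom (A := Localization S) (B := B)
    ((Localization.monoidOf S).lift₀ (CommMonZ.Hom.hom g) hg)

lemma locHom_locLift (g : A ⟶ B) (hg : ∀ f : S, IsUnit (CommMonZ.Hom.hom g f)) :
    locHom S ≫ locLift g hg = g :=
  CommMonZ.hom_ext fun a => (Localization.monoidOf S).lift_eq hg a

lemma locObj_hom_ext {f g : locObj S ⟶ B} (h : locHom S ≫ f = locHom S ≫ g) : f = g := by
  refine CommMonZ.hom_ext fun t => ?_
  induction t using Localization.induction_on with
  | H y =>
    have h' : ∀ a, CommMonZ.Hom.hom f (CommMonZ.Hom.hom (locHom S) a) =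
      CommMonZ.Hom.hom g (CommMonZ.Hom.hom (locHom S) a) :=
      fun a => congrArg (fun k => CommMonZ.Hom.hom k a) h
    refine ((locHom_isUnit S y.2).map (CommMonZ.Hom.hom f)).mul_right_cancel ?_
    conv_rhs => rw [h']
    change CommMonZ.Hom.hom f _ * _ = CommMonZ.Hom.hom g _ * _
    rw [← map_mul, ← map_mul]
    exact (congrArg _ (mk_mul_locHom S y.1 y.2)).trans
      ((h' _).trans (congrArg _ (mk_mul_locHom S y.1 y.2)).symm)

/-- The canonical homomorphism to the localization at a prime ideal. -/
abbrev locP (p : MSpec A) : A ⟶ locObj p.compl := locHom p.compl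

lemma locP_isUnit_iff {p : MSpec A} {a : A} :
    IsUnit (CommMonZ.Hom.hom (locP p) a) ↔ a ∉ p.carrier :=
  isUnit_mk_iff p a 1

instance (p : MSpec A) : Nontrivial (locObj p.compl) := by
  refine ⟨0, 1, fun h => ?_⟩
  have : IsUnit (CommMonZ.Hom.hom (locP p) 0) := by
    rw [map_zero, h]
    exact isUnit_one
  exact locP_isUnit_iff.1 this p.zero_mem

lemma comap_locP_closedPt (p : MSpec A) :
    (closedPt (locObj p.compl)).comap (CommMonZ.Hom.hom (locP p)) = p := by
  ext a
  change ¬ IsUnit _ ↔ _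
  rw [locP_isUnit_iff, not_not]

/-- The closed point of `B_p` lies over `p`, so `Spec B_p` lands in every open neighbourhood of `p`.
-/
lemma comap_locP_mem {U : Opens (MSpec A)} {p : MSpec A} (hp : p ∈ U)
    (q : MSpec (locObj p.compl)) : q.comap (CommMonZ.Hom.hom (locP p)) ∈ U :=
  closedPt_comap_mem _ U ((comap_locP_closedPt p).symm ▸ hp) q

/-- The canonical homomorphism to the localization at the powers of an element. -/
abbrev locAway (h : A) : A ⟶ locObj (Submonoid.powers h) := locHom (Submonoid.powers h)

lemma locAway_isUnit (h : A) : IsUnit (CommMonZ.Hom.hom (locAway h) h) :=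
  locHom_isUnit _ ⟨h, Submonoid.mem_powers h⟩

lemma isUnit_powers {h : A} {g : A ⟶ B} (hg : IsUnit (CommMonZ.Hom.hom g h))
    (f : Submonoid.powers h) : IsUnit (CommMonZ.Hom.hom g f) := by
  obtain ⟨n, hn⟩ := f.2
  rw [← hn, map_pow]
  exact hg.pow n

lemma comap_locAway_notMem (h : A) (q : MSpec (locObj (Submonoid.powers h))) :
    h ∉ (q.comap (CommMonZ.Hom.hom (locAway h))).carrier :=
  fun hq => MSpec.not_isUnit (p := q) hq (locAway_isUnit h)

lemma exists_locAway_frac (h : A) (t : locObj (Submonoid.powers h)) : ∃ (a : A) (n : ℕ),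
    t * CommMonZ.Hom.hom (locAway h) (h ^ n) = CommMonZ.Hom.hom (locAway h) a := by
  induction t using Localization.induction_on with
  | H y =>
    obtain ⟨n, hn⟩ := y.2.2
    refine ⟨y.1, n, ?_⟩
    rw [show h ^ n = y.2.1 from hn]
    exact mk_mul_locHom _ y.1 y.2

end Localization

/-! ## Subfunctors attached to sets of points -/

section Land

variable (G : CommMonZ.{u} ⥤ Type u)

lemma map_chi_map {A B : CommMonZ.{u}} (ρ : A ⟶ B) (g : G.obj A) (q : MSpec B) :
    G.map (chi q) (G.map ρ g) = G.map (chi (q.comap (CommMonZ.Hom.hom ρ))) g := by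
  rw [← comp_chi, G.map_comp]
  rfl

/-- The subfunctor of all elements whose points lie in a given set. -/
def land (V : Set (G.obj monF1.{u})) : Subfunctor G where
  obj A := {g | ∀ p : MSpec A, G.map (chi p) g ∈ V}
  map ρ g hg q := by
    rw [map_chi_map]
    exact hg _

variable {G}

lemma mem_land {V : Set (G.obj monF1.{u})} {A : CommMonZ.{u}} {g : G.obj A} :
    g ∈ (land G V).obj A ↔ ∀ p : MSpec A, G.map (chi p) g ∈ V := Iff.rfl

/-- The monoid `{0,1}` has a single prime ideal, whose character is the identity, so a point of `G`
has only itself as a point. -/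
lemma mem_land_monF1 {V : Set (G.obj monF1.{u})} {x : G.obj monF1.{u}} :
    x ∈ (land G V).obj monF1 ↔ x ∈ V := by
  have h : ∀ p : MSpec monF1.{u}, G.map (chi p) x = x := fun p => by
    rw [chi_monF1, G.map_id]
    rfl
  exact ⟨fun hx => h (closedPt _) ▸ hx (closedPt _), fun hx p => (h p).symm ▸ hx⟩

lemma mem_land_of_closedPt {V : Set (G.obj monF1.{u})} {A : CommMonZ.{u}} [Nontrivial A]
    {g : G.obj A} (hV : IsOpen {p : MSpec A | G.map (chi p) g ∈ V})
    (h : G.map (chi (closedPt A)) g ∈ V) : g ∈ (land G V).obj A :=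
  fun p => MSpec.mem_of_subset ⟨_, hV⟩ h p.subset_closedPt

/-- By naturality `φ` is determined by the element `φ(𝟙 A)`. The ideal that cuts out the complement
of the open set of primes at which this element has its point in `V` satisfies the definition. -/
lemma isOpenSubfunctor_land {V : Set (G.obj monF1.{u})}
    (hV : ∀ (A : CommMonZ.{u}) (g : G.obj A), IsOpen {p : MSpec A | G.map (chi p) g ∈ V}) :
    IsOpenSubfunctor (land G V) := by
  intro A φ
  obtain ⟨I, hI⟩ := (isClosed_iff_zeroLocus _).1
    (isClosed_compl_iff.2 (hV A (φ.app A (𝟙 A))))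
  have key : ∀ p : MSpec A, G.map (chi p) (φ.app A (𝟙 A)) ∈ V ↔ ∃ i ∈ I.carrier, i ∉ p.carrier := by
    intro p
    have : p ∈ zeroLocus I ↔ ¬ G.map (chi p) (φ.app A (𝟙 A)) ∈ V := by rw [hI]; rfl
    rw [← not_iff_not, ← this]
    simp [zeroLocus, Set.subset_def]
  refine ⟨I, fun B ρ => ?_⟩
  rw [generatesUnit_iff, mem_land]
  have hρ : φ.app B ρ = G.map ρ (φ.app A (𝟙 A)) := by
    have := NatTrans.naturality_apply φ ρ (𝟙 A)
    refine Eq.trans ?_ this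
    exact congrArg (φ.app B) (Category.id_comp ρ).symm
  rw [hρ]
  refine forall_congr' fun q => ?_
  rw [map_chi_map, key]
  rfl

/-- The natural transformation from an affine functor attached to an element. -/
def ofElem {A : CommMonZ.{u}} (g : G.obj A) : affineFunctor A ⟶ G := coyonedaEquiv.symm g

lemma ofElem_app {A B : CommMonZ.{u}} (g : G.obj A) (ρ : A ⟶ B) :
    (ofElem g).app B ρ = G.map ρ g := rfl

/-- Take the ideal `I` attached to `g` by openness. Membership of `g` says that no prime of `A`
contains `I`, while membership of the point of `g` at `p` says that `p` does not contain `I`. So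
open subfunctors are determined by their points. -/
lemma IsOpenSubfunctor.mem_iff {U : Subfunctor G} (hU : IsOpenSubfunctor U) {A : CommMonZ.{u}}
    (g : G.obj A) : g ∈ U.obj A ↔ ∀ p : MSpec A, G.map (chi p) g ∈ U.obj monF1 := by
  obtain ⟨I, hI⟩ := hU A (ofElem g)
  have h1 := hI A (𝟙 A)
  rw [ofElem_app, G.map_id] at h1
  refine h1.trans (generatesUnit_iff.trans (forall_congr' fun p => ?_))
  have h2 := hI monF1 (chi p)
  rw [ofElem_app] at h2
  rw [h2, generatesUnit_chi_iff]
  rfl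

/-- The complement is `V(I)`, for the ideal `I` attached to `g`. -/
lemma IsOpenSubfunctor.isOpen {U : Subfunctor G} (hU : IsOpenSubfunctor U) {A : CommMonZ.{u}}
    (g : G.obj A) : IsOpen {p : MSpec A | G.map (chi p) g ∈ U.obj monF1} := by
  obtain ⟨I, hI⟩ := hU A (ofElem g)
  rw [← isClosed_compl_iff, isClosed_iff_zeroLocus]
  refine ⟨I, ?_⟩
  ext p
  have h2 := hI monF1 (chi p)
  rw [ofElem_app] at h2
  rw [Set.mem_compl_iff, Set.mem_ofPred_eq, h2, generatesUnit_chi_iff]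
  simp [zeroLocus, Set.subset_def]

end Land

/-! ## Sections of functors -/

section Sections

variable {U : CommMonZ.{u} ⥤ Type u}

/-- The value of a section. -/
abbrev Sections.val (s : Sections U) {A : CommMonZ.{u}} (g : U.obj A) : A := s.app A g

lemma Sections.map_val (s : Sections U) {A B : CommMonZ.{u}} (ρ : A ⟶ B) (g : U.obj A) :
    s.val (U.map ρ g) = CommMonZ.Hom.hom ρ (s.val g) :=
  NatTrans.naturality_apply s ρ g

lemma Sections.ext {s t : Sections U} (h : ∀ (A : CommMonZ.{u}) (g : U.obj A), s.val g = t.val g) :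
    s = t := by
  ext A g
  exact h A g

/-- A section is given by its values. -/
def Sections.mk (v : ∀ {A : CommMonZ.{u}}, U.obj A → A)
    (h : ∀ {A B : CommMonZ.{u}} (ρ : A ⟶ B) (g : U.obj A),
      v (U.map ρ g) = CommMonZ.Hom.hom ρ (v g)) : Sections U where
  app A := ↾ fun g => (v g : A)
  naturality A B ρ := by
    ext g
    exact h ρ g

instance : CommMonoidWithZero (Sections U) where
  mul s t := Sections.mk (fun g => s.val g * t.val g) (fun ρ g => by
    rw [s.map_val, t.map_val, map_mul])
  one := Sections.mk (fun _ => 1) (fun ρ _ => (map_one (CommMonZ.Hom.hom ρ)).symm)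
  zero := Sections.mk (fun _ => 0) (fun ρ _ => (map_zero (CommMonZ.Hom.hom ρ)).symm)
  mul_assoc _ _ _ := Sections.ext fun _ _ => mul_assoc _ _ _
  one_mul _ := Sections.ext fun _ _ => one_mul _
  mul_one _ := Sections.ext fun _ _ => mul_one _
  mul_comm _ _ := Sections.ext fun _ _ => mul_comm _ _
  zero_mul _ := Sections.ext fun _ _ => zero_mul _
  mul_zero _ := Sections.ext fun _ _ => mul_zero _

variable {V : Subfunctor U}

/-- The value of a section on a subfunctor. -/
def Sections.on (s : Sections V.toFunctor) {A : CommMonZ.{u}} (g : U.obj A) (h : g ∈ V.obj A) : A :=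
  s.val (A := A) ⟨g, h⟩

lemma Sections.map_on (s : Sections V.toFunctor) {A B : CommMonZ.{u}} (ρ : A ⟶ B) (g : U.obj A)
    (h : g ∈ V.obj A) :
    CommMonZ.Hom.hom ρ (s.on g h) = s.on (U.map ρ g) (V.map ρ h) :=
  (s.map_val ρ (⟨g, h⟩ : V.toFunctor.obj A)).symm

lemma Sections.on_congr (s : Sections V.toFunctor) {A : CommMonZ.{u}} {g g' : U.obj A} (e : g = g')
    (h : g ∈ V.obj A) : s.on g h = s.on g' (e ▸ h) := by
  subst e
  rfl

lemma Sections.ext_on {s t : Sections V.toFunctor}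
    (h : ∀ (A : CommMonZ.{u}) (g : U.obj A) (hg : g ∈ V.obj A), s.on g hg = t.on g hg) : s = t :=
  Sections.ext fun A g => h A g.1 g.2

lemma Sections.mul_on (s t : Sections V.toFunctor) {A : CommMonZ.{u}} (g : U.obj A)
    (h : g ∈ V.obj A) : (s * t).on g h = s.on g h * t.on g h := rfl

/-- A section on a subfunctor is given by its values. -/
def Sections.mkOn (V : Subfunctor U) (v : ∀ {A : CommMonZ.{u}} (g : U.obj A), g ∈ V.obj A → A)
    (h : ∀ {A B : CommMonZ.{u}} (ρ : A ⟶ B) (g : U.obj A) (hg : g ∈ V.obj A),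
      v (U.map ρ g) (V.map ρ hg) = CommMonZ.Hom.hom ρ (v g hg)) : Sections V.toFunctor :=
  Sections.mk (fun g => v g.1 g.2) fun ρ g => h ρ g.1 g.2

/-- The restriction of a section. -/
def Sections.restrict {W : Subfunctor U} (s : Sections V.toFunctor) (i : W ≤ V) :
    Sections W.toFunctor := Subfunctor.homOfLe i ≫ s

end Sections

/-! ## Natural transformations are local -/

section Local

variable {X Y : CommMonZ.{u} ⥤ Type u}

lemma chi_eq_locAway_comp {A : CommMonZ.{u}} {h : A} {p : MSpec A} (hp : h ∉ p.carrier) :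
    locAway h ≫ locLift (chi p) (isUnit_powers (chi_isUnit_iff.2 hp)) = chi p :=
  locHom_locLift _ _

/-- Near `p`, on some `basicOpen h`, the element `g` has all its points in `U`, so `s` has a value
in `A_h`. Write it as `a / h ^ n`. As `chi q` sends `h` to `1`, the value of `s` at the point of `g`
at `q` is `chi q` of `a`, which is a unit exactly on `basicOpen a`. -/
lemma isOpen_isUnit_val {U : Subfunctor X} (hU : IsOpenSubfunctor U) (s : Sections U.toFunctor)
    {A : CommMonZ.{u}} (g : X.obj A) :
    IsOpen {p : MSpec A | ∃ h, IsUnit (s.on (X.map (chi p) g) h)} := by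
  refine isOpen_iff_forall_mem_open.2 ?_
  rintro p ⟨hp, hu⟩
  obtain ⟨h, hh, hD⟩ := exists_basicOpen_le ⟨_, hU.isOpen g⟩ hp
  have hg : X.map (locAway h) g ∈ U.obj (locObj (Submonoid.powers h)) := by
    refine (hU.mem_iff _).2 fun q => ?_
    rw [map_chi_map]
    exact hD _ (comap_locAway_notMem h q)
  obtain ⟨a, n, ha⟩ := exists_locAway_frac h (s.on _ hg)
  have key : ∀ q : MSpec A, h ∉ q.carrier → ∃ hq, s.on (X.map (chi q) g) hq =
      CommMonZ.Hom.hom (chi q) a := by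
    intro q hq
    refine ⟨hD q hq, ?_⟩
    let ψ := locLift (chi q) (isUnit_powers (chi_isUnit_iff.2 hq))
    have h1 : locAway h ≫ ψ = chi q := chi_eq_locAway_comp hq
    have h2 : X.map (chi q) g = X.map ψ (X.map (locAway h) g) := by
      rw [← h1, X.map_comp]
      rfl
    have h3 := congrArg (CommMonZ.Hom.hom ψ) ha
    rw [map_mul] at h3
    have h4 : ∀ b, CommMonZ.Hom.hom ψ (CommMonZ.Hom.hom (locAway h) b) =
      CommMonZ.Hom.hom (chi q) b := fun b => congrArg (fun k => CommMonZ.Hom.hom k b) h1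
    rw [h4, h4, map_pow, chi_eq_one_iff.2 hq, one_pow, mul_one] at h3
    rw [← h3, s.map_on]
    exact s.on_congr h2 _
  refine ⟨(basicOpen h : Set (MSpec A)) ∩ (basicOpen a : Set (MSpec A)), ?_,
    (basicOpen h).2.inter (basicOpen a).2, hh, ?_⟩
  · rintro q ⟨hq, hqa⟩
    obtain ⟨hq', e⟩ := key q hq
    exact ⟨hq', e ▸ chi_isUnit_iff.2 hqa⟩
  · obtain ⟨hq', e⟩ := key p hh
    exact chi_isUnit_iff.1 (e ▸ hu)

/-- The non-units form a prime ideal unless `0 = 1`, in which case every element is a unit. -/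
lemma isUnit_of_forall_notMem {A : CommMonZ.{u}} {a : A} (h : ∀ p : MSpec A, a ∉ p.carrier) :
    IsUnit a := by
  by_cases hA : Nontrivial A
  · exact not_not.1 (h (closedPt A))
  · have := not_nontrivial_iff_subsingleton.1 hA
    exact Subsingleton.elim a 1 ▸ isUnit_one

/-- A section of which all the values are units is invertible. -/
lemma Sections.exists_mul_eq_one {U : CommMonZ.{u} ⥤ Type u} (s : Sections U)
    (h : ∀ (A : CommMonZ.{u}) (g : U.obj A), IsUnit (s.val g)) : ∃ t : Sections U, s * t = 1 := by
  refine ⟨Sections.mk (fun {A} g => ((h A g).unit⁻¹ : Aˣ)) fun {A B} ρ g => ?_,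
    Sections.ext fun A g => (h A g).mul_val_inv⟩
  -- Inverses are unique and preserved by homomorphisms, so the pointwise inverse is natural.
  refine (h B (U.map ρ g)).mul_left_cancel ?_
  rw [(h B (U.map ρ g)).mul_val_inv, s.map_val, ← map_mul, (h A g).mul_val_inv, map_one]

/-- The locus where a section is a unit. -/
lemma exists_restrict_isUnit {U : Subfunctor X} (hU : IsOpenSubfunctor U)
    (s : Sections U.toFunctor) : ∃ (V : Set (X.obj monF1.{u})) (i : land X V ≤ U),
      (∀ (A : CommMonZ.{u}) (g : X.obj A), IsOpen {p : MSpec A | X.map (chi p) g ∈ V}) ∧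
      (∀ x, x ∈ V ↔ ∃ h, IsUnit (s.on x h)) ∧
      ∃ t : Sections (land X V).toFunctor, s.restrict i * t = 1 := by
  refine ⟨{x | ∃ h, IsUnit (s.on x h)},
    fun A g hg => (hU.mem_iff g).2 fun p => (hg p).1, fun A g => isOpen_isUnit_val hU s g,
    fun x => Iff.rfl, Sections.exists_mul_eq_one _ fun A g => isUnit_of_forall_notMem fun p => ?_⟩
  obtain ⟨h, hu⟩ := g.2 p
  rw [← chi_isUnit_iff, ← Sections.map_val]
  exact hu

/-- The unit locus of `s` is an open neighbourhood of `x` on which `s` has an inverse. Thus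
invertibility of a germ at `x` is decided by its value in `{0,1}`. -/
lemma isUnitAt_of_isUnit {U : Subfunctor X} (hU : IsOpenSubfunctor U) (s : Sections U.toFunctor)
    {x : X.obj monF1.{u}} (hx : x ∈ U.obj monF1) (h : IsUnit (s.on x hx)) : IsUnitAt s x := by
  obtain ⟨V, i, hV, hV', t, ht⟩ := exists_restrict_isUnit hU s
  exact ⟨land X V, isOpenSubfunctor_land hV, mem_land_monF1.2 ((hV' x).2 ⟨hx, h⟩), i, t,
    fun A y => congrArg (fun r => Sections.val r y) ht⟩

/-- All natural transformations are local. -/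
lemma isLocalTransform (φ : X ⟶ Y) : IsLocalTransform φ := by
  rintro x V hV hx f ⟨W, hW, hxW, i, t, ht⟩
  -- An inverse of the pulled back section near `x` makes its value at `x` a unit, and this value is
  -- the value of `f` at the image of `x`.
  exact isUnitAt_of_isUnit hV f hx (IsUnit.of_mul_eq_one _ (ht monF1 ⟨x, hxW⟩))

end Local

end FOne

namespace FOne

open AlgebraicGeometry

/-! ## Morphisms of monoidal spaces -/

namespace MonoidalSpace

variable {X Y Z : MonoidalSpace.{u}}

/-- The sections of the structure sheaf. -/
abbrev Sec (X : MonoidalSpace.{u}) (U : Opens X.carrier) : CommMonZ.{u} := X.presheaf.obj (op U)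

/-- The restriction of sections. -/
def res (X : MonoidalSpace.{u}) {U V : Opens X.carrier} (h : V ≤ U) : X.Sec U →*₀ X.Sec V :=
  CommMonZ.Hom.hom (X.presheaf.map (homOfLE h).op)

lemma res_self {U : Opens X.carrier} (s : X.Sec U) : X.res le_rfl s = s := FOne.res_self _ _ _ s

lemma res_res {U V W : Opens X.carrier} (h : V ≤ U) (k : W ≤ V) (s : X.Sec U) :
    X.res k (X.res h s) = X.res (k.trans h) s := by
  change CommMonZ.Hom.hom (X.presheaf.map _ ≫ X.presheaf.map _) s = _
  rw [← X.presheaf.map_comp]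
  rfl

lemma eq_of_locally_eq {ι : Type*} (U : ι → Opens X.carrier) (V : Opens X.carrier)
    (hU : ∀ i, U i ≤ V) (hV : ∀ x ∈ V, ∃ i, x ∈ U i) {s t : X.Sec V}
    (h : ∀ i, X.res (hU i) s = X.res (hU i) t) : s = t :=
  TopCat.Sheaf.eq_of_locally_eq' (⟨_, X.isSheaf⟩ : TopCat.Sheaf (Type u) X.carrier) U V
    (fun i => homOfLE (hU i)) (fun x hx => Opens.mem_iSup.2 (hV x hx)) s t h

lemma exists_glue {ι : Type*} (U : ι → Opens X.carrier) (V : Opens X.carrier)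
    (hU : ∀ i, U i ≤ V) (hV : ∀ x ∈ V, ∃ i, x ∈ U i) (s : ∀ i, X.Sec (U i))
    (h : ∀ i j, X.res (inf_le_left : U i ⊓ U j ≤ U i) (s i) =
      X.res (inf_le_right : U i ⊓ U j ≤ U j) (s j)) :
    ∃ t : X.Sec V, ∀ i, X.res (hU i) t = s i := by
  have hs : TopCat.Presheaf.IsCompatible (X.presheaf ⋙ forget CommMonZ) U s := fun i j => h i j
  exact (TopCat.Sheaf.existsUnique_gluing' (⟨_, X.isSheaf⟩ : TopCat.Sheaf (Type u) X.carrier) U V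
    (fun i => homOfLE (hU i)) (fun x hx => Opens.mem_iSup.2 (hV x hx)) s hs).exists

/-- The inverse image of an open set. -/
abbrev preim (f : X ⟶ Y) (V : Opens Y.carrier) : Opens X.carrier := (Opens.map f.toHom.base).obj V

/-- The pull-back of sections. -/
def pb (f : X ⟶ Y) (V : Opens Y.carrier) : Y.Sec V →*₀ X.Sec (preim f V) :=
  CommMonZ.Hom.hom (f.toHom.c.app (op V))

lemma pb_res (f : X ⟶ Y) {U V : Opens Y.carrier} (h : V ≤ U) (s : Y.Sec U) :
    pb f V (Y.res h s) = X.res (show preim f V ≤ preim f U from fun _ hx => h hx) (pb f U s) :=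
  congrArg (fun k => CommMonZ.Hom.hom k s) (f.toHom.c.naturality (homOfLE h).op)

/-- The restriction map in `hs` reconciles the sections over `preim f V` and `preim g V`, which are
equal sets but not definitionally so. -/
lemma hom_ext_of {f g : X ⟶ Y} (hb : ∀ x : X.carrier, f.toHom.base x = g.toHom.base x)
    (hs : ∀ (V : Opens Y.carrier) (s : Y.Sec V), pb f V s =
      X.res (show preim f V ≤ preim g V from fun x (hx : f.toHom.base x ∈ V) =>
        show g.toHom.base x ∈ V from hb x ▸ hx) (pb g V s)) : f = g := by
  obtain ⟨⟨b, c⟩, hf⟩ := f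
  obtain ⟨⟨b', c'⟩, hg⟩ := g
  obtain rfl : b = b' := TopCat.hom_ext (ContinuousMap.ext hb)
  obtain rfl : c = c' := by
    refine NatTrans.ext (funext fun V => CommMonZ.hom_ext fun s => ?_)
    exact (hs V.unop s).trans (res_self _)
  rfl

/-- The germ of a section. -/
noncomputable def germAt (X : MonoidalSpace.{u}) {x : X.carrier} {U : Opens X.carrier}
    (hx : x ∈ U) : X.Sec U →*₀ stalk X.presheaf x :=
  CommMonZ.Hom.hom (germ X.presheaf x U hx)

lemma germAt_res {x : X.carrier} {U V : Opens X.carrier} (h : V ≤ U) (hx : x ∈ V) (s : X.Sec U) :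
    X.germAt hx (X.res h s) = X.germAt (h hx) s :=
  congrArg (fun k => CommMonZ.Hom.hom k s) (germ_res X.presheaf x (homOfLE h).op (h hx) hx)

lemma exists_res_eq {x : X.carrier} {U V : Opens X.carrier} (hU : x ∈ U) (hV : x ∈ V)
    {s : X.Sec U} {t : X.Sec V} (h : X.germAt hU s = X.germAt hV t) :
    ∃ (W : Opens X.carrier) (_ : x ∈ W) (i : W ≤ U) (j : W ≤ V), X.res i s = X.res j t := by
  obtain ⟨W, i, j, e⟩ := Quotient.exact h
  exact ⟨(OrderDual.ofDual W).1, (OrderDual.ofDual W).2, i, j, e⟩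

lemma exists_isUnit_res {x : X.carrier} {U : Opens X.carrier} (hx : x ∈ U) {s : X.Sec U}
    (h : IsUnit (X.germAt hx s)) :
    ∃ (W : Opens X.carrier) (_ : x ∈ W) (i : W ≤ U) (t : X.Sec W), X.res i s * t = 1 := by
  obtain ⟨t, ht⟩ := h.exists_right_inv
  obtain ⟨V, hV, t, rfl⟩ := exists_germ _ _ t
  have hx' : x ∈ U ⊓ V := ⟨hx, hV⟩
  have h1 : X.germAt hx' (X.res inf_le_left s * X.res inf_le_right t) = X.germAt hx' 1 := by
    rw [map_mul, map_one, germAt_res, germAt_res]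
    exact ht
  obtain ⟨W, hW, i, j, e⟩ := exists_res_eq _ _ h1
  refine ⟨W, hW, i.trans inf_le_left, X.res (i.trans inf_le_right) t, ?_⟩
  rw [map_mul, map_one, res_res, res_res] at e
  exact e

lemma isUnit_germAt_congr {x y : X.carrier} (e : x = y) {U : Opens X.carrier} {hx : x ∈ U}
    {s : X.Sec U} (h : IsUnit (X.germAt hx s)) : IsUnit (X.germAt (e ▸ hx : y ∈ U) s) := by
  subst e
  exact h

lemma isUnit_germAt {x : X.carrier} {U W : Opens X.carrier} (hx : x ∈ U) {s : X.Sec U}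
    (hW : x ∈ W) (i : W ≤ U) {t : X.Sec W} (h : X.res i s * t = 1) : IsUnit (X.germAt hx s) := by
  rw [← germAt_res i hW]
  exact (IsUnit.of_mul_eq_one _ h).map _

end MonoidalSpace

open MonoidalSpace

/-! ## Sections over spectra -/

section SpecSections

variable {B : CommMonZ.{u}} {U : Opens (TopCat.of (MSpec B))}

open Classical in
/-- The value of a section along a homomorphism. -/
noncomputable def secEval (σ : (specSpace B).Sec U) {A : CommMonZ.{u}} (φ : B ⟶ A)
    (h : ∀ q : MSpec A, q.comap (CommMonZ.Hom.hom φ) ∈ U) : A :=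
  if _hA : Nontrivial A then
    locClosedPt A (locMap (CommMonZ.Hom.hom φ) (closedPt A) (σ.1 ⟨_, h (closedPt A)⟩))
  else 0

variable {A A' : CommMonZ.{u}}

lemma secEval_of_nontrivial [h' : Nontrivial A] (σ : (specSpace B).Sec U) (φ : B ⟶ A)
    (h : ∀ q : MSpec A, q.comap (CommMonZ.Hom.hom φ) ∈ U) :
    secEval σ φ h =
      locClosedPt A (locMap (CommMonZ.Hom.hom φ) (closedPt A) (σ.1 ⟨_, h (closedPt A)⟩)) :=
  dif_pos h'

lemma secEval_congr (σ : (specSpace B).Sec U) {φ ψ : B ⟶ A} (e : φ = ψ)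
    (h : ∀ q : MSpec A, q.comap (CommMonZ.Hom.hom φ) ∈ U) :
    secEval σ φ h = secEval σ ψ (e ▸ h) := by
  subst e
  rfl

/-- The fraction `a / f` only has to represent `σ` at the primes that come from `A`; the value along
`φ` is read off at the closed point of `A`. Denominators are cleared, so that no inverse of `φ(f)`
has to be named. -/
lemma secEval_mul_eq (σ : (specSpace B).Sec U) (φ : B ⟶ A)
    (h : ∀ q : MSpec A, q.comap (CommMonZ.Hom.hom φ) ∈ U) {a f : B}
    (hs : ∀ p : U, (∃ q : MSpec A, q.comap (CommMonZ.Hom.hom φ) = p) →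
      ∃ hf : f ∈ p.1.compl, σ.1 p = Localization.mk a ⟨f, hf⟩) :
    secEval σ φ h * CommMonZ.Hom.hom φ f = CommMonZ.Hom.hom φ a := by
  by_cases hA : Nontrivial A
  · obtain ⟨hf, e⟩ := hs ⟨_, h (closedPt A)⟩ ⟨closedPt A, rfl⟩
    rw [secEval, dif_pos hA, e, locMap_mk]
    exact locClosedPt_mk A _ ⟨_, hf⟩
  · have := not_nontrivial_iff_subsingleton.1 hA
    exact Subsingleton.elim _ _

/-- Locally, a section is a fraction. -/
lemma exists_frac (σ : (specSpace B).Sec U) {p : MSpec B} (hp : p ∈ U) :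
    ∃ (V : Opens (MSpec B)) (_ : p ∈ V) (_ : V ≤ U) (a f : B), f ∉ p.carrier ∧
      ∀ q : U, q.1 ∈ V → ∃ hf : f ∈ q.1.compl, σ.1 q = Localization.mk a ⟨f, hf⟩ := by
  obtain ⟨V, hV, i, a, f, hs⟩ := σ.2 ⟨p, hp⟩
  exact ⟨V, hV, i.le, a, f, (hs ⟨p, hV⟩).1, fun q hq => hs ⟨q.1, hq⟩⟩

/-- A fraction that represents `σ` near the image of the closed point represents it on the whole
image of `Spec A`. Therefore the same `a` and `f` serve for `φ` and for all `φ ≫ ρ`, which is what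
naturality of the values needs. -/
lemma exists_secEval_mul_eq [Nontrivial A] (σ : (specSpace B).Sec U) (φ : B ⟶ A)
    (h : ∀ q : MSpec A, q.comap (CommMonZ.Hom.hom φ) ∈ U) :
    ∃ a f : B, IsUnit (CommMonZ.Hom.hom φ f) ∧ ∀ (A' : CommMonZ.{u}) (ρ : A ⟶ A')
      (h' : ∀ q : MSpec A', q.comap (CommMonZ.Hom.hom (φ ≫ ρ)) ∈ U),
      secEval σ (φ ≫ ρ) h' * CommMonZ.Hom.hom ρ (CommMonZ.Hom.hom φ f) =
        CommMonZ.Hom.hom ρ (CommMonZ.Hom.hom φ a) := by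
  obtain ⟨V, hV, i, a, f, hf, hs⟩ := exists_frac σ (h (closedPt A))
  refine ⟨a, f, not_not.1 hf, fun A' ρ h' => secEval_mul_eq σ (φ ≫ ρ) h' fun p hp => hs p ?_⟩
  obtain ⟨q, hq⟩ := hp
  rw [← hq, MSpec.comap_comp]
  exact closedPt_comap_mem φ V hV _

lemma secEval_comp (σ : (specSpace B).Sec U) (φ : B ⟶ A) (ρ : A ⟶ A')
    (h : ∀ q : MSpec A, q.comap (CommMonZ.Hom.hom φ) ∈ U)
    (h' : ∀ q : MSpec A', q.comap (CommMonZ.Hom.hom (φ ≫ ρ)) ∈ U) :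
    secEval σ (φ ≫ ρ) h' = CommMonZ.Hom.hom ρ (secEval σ φ h) := by
  by_cases hA : Nontrivial A
  · obtain ⟨a, f, hf, hs⟩ := exists_secEval_mul_eq σ φ h
    refine (hf.map (CommMonZ.Hom.hom ρ)).mul_right_cancel ?_
    rw [hs A' ρ h', ← map_mul]
    exact congrArg _ (hs A (𝟙 A) h).symm
  -- A homomorphism out of a monoid with `0 = 1` forces `0 = 1` in its target.
  · have hA' : Subsingleton A' := by
      rw [← not_nontrivial_iff_subsingleton]
      intro hA'
      exact hA ⟨0, 1, fun e => zero_ne_one (α := A') (by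
        rw [← map_zero (CommMonZ.Hom.hom ρ), e, map_one])⟩
    exact Subsingleton.elim _ _

lemma secEval_one (φ : B ⟶ A) (h : ∀ q : MSpec A, q.comap (CommMonZ.Hom.hom φ) ∈ U) :
    secEval (1 : (specSpace B).Sec U) φ h = 1 := by
  by_cases hA : Nontrivial A
  · rw [secEval, dif_pos hA]
    exact (congrArg _ (map_one (locMap (CommMonZ.Hom.hom φ) (closedPt A)))).trans (map_one _)
  · have := not_nontrivial_iff_subsingleton.1 hA
    exact Subsingleton.elim _ _

lemma secEval_zero (φ : B ⟶ A) (h : ∀ q : MSpec A, q.comap (CommMonZ.Hom.hom φ) ∈ U) :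
    secEval (0 : (specSpace B).Sec U) φ h = 0 := by
  by_cases hA : Nontrivial A
  · rw [secEval, dif_pos hA]
    exact (congrArg _ (map_zero (locMap (CommMonZ.Hom.hom φ) (closedPt A)))).trans (map_zero _)
  · have := not_nontrivial_iff_subsingleton.1 hA
    exact Subsingleton.elim _ _

lemma secEval_mul (σ τ : (specSpace B).Sec U) (φ : B ⟶ A)
    (h : ∀ q : MSpec A, q.comap (CommMonZ.Hom.hom φ) ∈ U) :
    secEval (σ * τ) φ h = secEval σ φ h * secEval τ φ h := by
  by_cases hA : Nontrivial A
  · rw [secEval, dif_pos hA, secEval, dif_pos hA, secEval, dif_pos hA]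
    exact (congrArg _ (map_mul (locMap (CommMonZ.Hom.hom φ) (closedPt A)) _ _)).trans (map_mul _ _ _)
  · have := not_nontrivial_iff_subsingleton.1 hA
    exact Subsingleton.elim _ _

/-- The components of a section, as a family of elements of the localizations, are its values along
the homomorphisms `B → B_p`. Hence a section is determined by its values. -/
lemma secEval_locP (σ : (specSpace B).Sec U) {p : MSpec B} (hp : p ∈ U) :
    secEval σ (locP p) (comap_locP_mem hp) = σ.1 ⟨p, hp⟩ := by
  obtain ⟨V, hV, i, a, f, hf, hs⟩ := exists_frac σ hp
  obtain ⟨hf', e⟩ := hs ⟨p, hp⟩ hV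
  rw [e]
  refine eq_mk_of_mul_locHom (f := ⟨f, hf'⟩) (secEval_mul_eq σ _ _ ?_)
  rintro q ⟨q', hq⟩
  refine hs q ?_
  rw [← hq]
  exact comap_locP_mem hV _

lemma sec_ext {σ τ : (specSpace B).Sec U}
    (h : ∀ (A : CommMonZ.{u}) (φ : B ⟶ A) (hφ : ∀ q : MSpec A, q.comap (CommMonZ.Hom.hom φ) ∈ U),
      secEval σ φ hφ = secEval τ φ hφ) : σ = τ :=
  Subtype.ext (funext fun p => by
    have := h _ (locP p.1) (comap_locP_mem p.2)
    rwa [secEval_locP, secEval_locP] at this)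

/-- A natural family of values comes from a section. -/
lemma exists_sec (ν : ∀ {A : CommMonZ.{u}} (φ : B ⟶ A),
      (∀ q : MSpec A, q.comap (CommMonZ.Hom.hom φ) ∈ U) → A)
    (hν : ∀ {A A' : CommMonZ.{u}} (φ : B ⟶ A) (ρ : A ⟶ A') (h) (h'),
      ν (φ ≫ ρ) h' = CommMonZ.Hom.hom ρ (ν φ h)) :
    ∃ σ : (specSpace B).Sec U, ∀ (A : CommMonZ.{u}) (φ : B ⟶ A) (h), secEval σ φ h = ν φ h := by
  have hν' : ∀ {A : CommMonZ.{u}} {φ ψ : B ⟶ A} (e : φ = ψ) (h), ν φ h = ν ψ (e ▸ h) := by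
    rintro A φ _ rfl h
    rfl
  -- The component at `p` has to be the value along `B → B_p`. On a set `basicOpen h` inside `U` all
  -- these components come, by naturality, from the single value along `B → B_h`, which is a
  -- fraction `a / h ^ n`; so the family is locally a fraction.
  let σ : (specSpace B).Sec U := ⟨fun p => ν (locP p.1) (comap_locP_mem p.2), fun p => by
    obtain ⟨h, hh, hD⟩ := exists_basicOpen_le U p.2
    obtain ⟨a, n, ha⟩ := exists_locAway_frac h
      (ν (locAway h) fun q => hD _ (comap_locAway_notMem h q))
    refine ⟨basicOpen h, hh, homOfLE fun q hq => hD q hq, a, h ^ n, fun q => ?_⟩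
    have hq : h ∈ q.1.compl := q.2
    refine ⟨q.1.compl.pow_mem hq n, ?_⟩
    let ψ : locObj (Submonoid.powers h) ⟶ locObj q.1.compl :=
      locLift (locP q.1) (isUnit_powers (locP_isUnit_iff.2 hq))
    have h1 : locAway h ≫ ψ = locP q.1 := locHom_locLift _ _
    refine eq_mk_of_mul_locHom (f := ⟨h ^ n, q.1.compl.pow_mem hq n⟩) ?_
    have h3 := congrArg (CommMonZ.Hom.hom ψ) ha
    have h4 : ∀ b, CommMonZ.Hom.hom ψ (CommMonZ.Hom.hom (locAway h) b) =
      CommMonZ.Hom.hom (locP q.1) b := fun b => congrArg (fun k => CommMonZ.Hom.hom k b) h1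
    rw [map_mul, h4, h4] at h3
    refine Eq.trans (congrArg (· * _) ?_) h3
    refine Eq.trans (hν' h1.symm _) ?_
    exact hν _ _ _ _⟩
  refine ⟨σ, fun A φ h => ?_⟩
  by_cases hA : Nontrivial A
  -- A homomorphism `φ` factors through the localization at the inverse image of the closed point,
  -- where the value is known by construction.
  · let p := (closedPt A).comap (CommMonZ.Hom.hom φ)
    let ψ : locObj p.compl ⟶ A := locLift φ fun f => not_not.1 f.2
    have h1 : locP p ≫ ψ = φ := locHom_locLift _ _
    have hp : p ∈ U := h (closedPt A)
    have h2 : secEval σ (locP p) (comap_locP_mem hp) = ν (locP p) (comap_locP_mem hp) :=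
      secEval_locP σ hp
    have h3 := congrArg (CommMonZ.Hom.hom ψ) h2
    rw [← secEval_comp σ (locP p) ψ _ (by rw [h1]; exact h),
      ← hν (locP p) ψ _ (by rw [h1]; exact h), hν' h1] at h3
    rw [← h3]
    congr 1
    exact h1.symm
  · have := not_nontrivial_iff_subsingleton.1 hA
    exact Subsingleton.elim _ _

/-- The global section attached to an element. -/
def globalSec (b : B) : (specSpace B).Sec U :=
  ⟨fun _ => Localization.mk b 1, fun p => ⟨U, p.2, 𝟙 _, b, 1, fun q => ⟨q.1.compl.one_mem, rfl⟩⟩⟩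

lemma secEval_globalSec (b : B) (φ : B ⟶ A)
    (h : ∀ q : MSpec A, q.comap (CommMonZ.Hom.hom φ) ∈ U) :
    secEval (globalSec (U := U) b) φ h = CommMonZ.Hom.hom φ b := by
  have := secEval_mul_eq (globalSec (U := U) b) φ h (a := b) (f := 1)
    fun q _ => ⟨q.1.compl.one_mem, rfl⟩
  rwa [map_one, mul_one] at this

/-- The homomorphism from a monoid to the sections over an open subset of its spectrum. -/
def globalSecHom (U : Opens (TopCat.of (MSpec B))) : B →*₀ (specSpace B).Sec U where
  toFun := globalSec
  map_zero' := sec_ext fun C φ h => by rw [secEval_globalSec, secEval_zero, map_zero]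
  map_one' := sec_ext fun C φ h => by rw [secEval_globalSec, secEval_one, map_one]
  map_mul' a b := sec_ext fun C φ h => by
    rw [secEval_mul, secEval_globalSec, secEval_globalSec, secEval_globalSec, map_mul]

end SpecSections

/-! ### Functoriality of spectra. -/

section SpecMap

variable {A B C : CommMonZ.{u}}

/-- The morphism of spectra attached to a homomorphism. -/
noncomputable def specMap (φ : A ⟶ B) : specSpace B ⟶ specSpace A := specFunctor.map φ.op

lemma specMap_id : specMap (𝟙 A) = 𝟙 _ := specFunctor.map_id (op A)

lemma specMap_comp (φ : A ⟶ B) (ψ : B ⟶ C) : specMap (φ ≫ ψ) = specMap ψ ≫ specMap φ :=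
  specFunctor.map_comp ψ.op φ.op

end SpecMap

end FOne

namespace FOne

open AlgebraicGeometry MonoidalSpace

/-! ## Realizations of functors -/

/-- A monoidal space `Y` realizes a functor `G` if the points of `G` give points of `Y` and if the
sections on `Y` can be evaluated at the elements of `G`. -/
structure Realization (Y : MonoidalSpace.{u}) (G : CommMonZ.{u} ⥤ Type u) where
  /-- The point of `Y` attached to a point of `G`. -/
  pt : G.obj monF1.{u} → Y.carrier
  continuous : ∀ {A : CommMonZ.{u}} (g : G.obj A),
    Continuous fun p : MSpec A => pt (G.map (chi p) g)
  /-- The evaluation of sections. -/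
  ev : ∀ V : Opens Y.carrier, Y.Sec V →*₀ Sections (land G (pt ⁻¹' (V : Set Y.carrier))).toFunctor
  ev_res : ∀ {V W : Opens Y.carrier} (i : W ≤ V) (s : Y.Sec V) {A : CommMonZ.{u}} (g : G.obj A)
    (h : g ∈ (land G (pt ⁻¹' (W : Set Y.carrier))).obj A),
    (ev W (Y.res i s)).on g h = (ev V s).on g fun p => i (h p)
  isUnit_germ : ∀ (x : G.obj monF1.{u}) (V : Opens Y.carrier) (hx : pt x ∈ V) (s : Y.Sec V),
    IsUnit ((ev V s).on x (mem_land_monF1.2 hx)) → IsUnit (Y.germAt hx s)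

namespace Realization

variable {X Y Z : MonoidalSpace.{u}} {G H K : CommMonZ.{u} ⥤ Type u}

/-- A realization is exact if the points, the open sets and the sections of the space are those of
the functor. -/
structure IsExact (R : Realization Y G) : Prop where
  bijective : Function.Bijective R.pt
  isOpen : ∀ W : Set Y.carrier, (∀ (A : CommMonZ.{u}) (g : G.obj A),
    IsOpen {p : MSpec A | R.pt (G.map (chi p) g) ∈ W}) → IsOpen W
  ev_bijective : ∀ V, Function.Bijective (R.ev V)

/-- The converse of `isUnit_germ`: an inverse on a neighbourhood can be evaluated at the point.
Together they show that the unit germs are exactly those with a unit value. -/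
lemma isUnit_ev (R : Realization Y G) {x : G.obj monF1.{u}} {V : Opens Y.carrier} (hx : R.pt x ∈ V)
    {s : Y.Sec V} (h : IsUnit (Y.germAt hx s)) :
    IsUnit ((R.ev V s).on x (mem_land_monF1.2 hx)) := by
  obtain ⟨W, hW, i, t, ht⟩ := exists_isUnit_res _ h
  rw [← R.ev_res i s x (mem_land_monF1.2 hW)]
  refine IsUnit.of_mul_eq_one ((R.ev W t).on x (mem_land_monF1.2 hW)) ?_
  rw [← Sections.mul_on, ← map_mul, ht, map_one]
  rfl

/-- A morphism of spaces that is compatible with a transformation of functors. -/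
structure Compat (R : Realization X H) (S : Realization Y G) (θ : H ⟶ G) (f : X ⟶ Y) : Prop where
  pt : ∀ x, f.toHom.base (R.pt x) = S.pt (θ.app _ x)
  ev : ∀ (V : Opens Y.carrier) (s : Y.Sec V) (A : CommMonZ.{u}) (h : H.obj A) (h1) (h2),
    (R.ev (preim f V) (pb f V s)).on h h1 = (S.ev V s).on (θ.app A h) h2

variable {R : Realization X H} {S : Realization Y G} {T : Realization Z K} {θ : H ⟶ G}

lemma Compat.comp {η : G ⟶ K} {f : X ⟶ Y} {g : Y ⟶ Z} (hf : Compat R S θ f)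
    (hg : Compat S T η g) : Compat R T (θ ≫ η) (f ≫ g) where
  pt x := (congrArg g.toHom.base (hf.pt x)).trans (hg.pt _)
  ev V s A h h1 h2 := by
    have h3 : θ.app A h ∈ (land G (S.pt ⁻¹' (preim g V : Set Y.carrier))).obj A := fun p => by
      change g.toHom.base (S.pt _) ∈ V
      rw [hg.pt]
      have := h2 p
      change T.pt (K.map (chi p) (η.app _ (θ.app _ h))) ∈ V at this
      rwa [← NatTrans.naturality_apply] at this
    exact (hf.ev (preim g V) (pb g V s) A h h1 h3).trans (hg.ev V s A _ h3 h2)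

lemma Compat.mem_land {f : X ⟶ Y} (hf : Compat R S θ f) {V : Opens Y.carrier} {A : CommMonZ.{u}}
    {h : H.obj A} : h ∈ (land H (R.pt ⁻¹' (preim f V : Set X.carrier))).obj A ↔
      θ.app A h ∈ (land G (S.pt ⁻¹' (V : Set Y.carrier))).obj A := by
  refine forall_congr' fun p => ?_
  change f.toHom.base (R.pt _) ∈ V ↔ S.pt _ ∈ V
  rw [hf.pt, NatTrans.naturality_apply]

/-- In an exact realization every point of `X` comes from `H`, and sections on `X` are determined by
their values at the elements of `H`. Compatibility prescribes both the images of points and the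
values of the pulled back sections. -/
lemma Compat.unique (hR : R.IsExact) {f g : X ⟶ Y} (hf : Compat R S θ f) (hg : Compat R S θ g) :
    f = g := by
  have hb : ∀ x, f.toHom.base x = g.toHom.base x := fun x => by
    obtain ⟨x, rfl⟩ := hR.bijective.2 x
    rw [hf.pt, hg.pt]
  refine hom_ext_of hb fun V s => (hR.ev_bijective _).1 (Sections.ext_on fun A h hh => ?_)
  refine (hf.ev V s A h hh (hf.mem_land.1 hh)).trans ?_
  refine Eq.trans ?_ (R.ev_res _ (pb g V s) h hh).symm
  exact (hg.ev V s A h _ _).symm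

/-- A transformation of functors gives a morphism from an exact realization. -/
theorem exists_compat (hR : R.IsExact) (S : Realization Y G) (θ : H ⟶ G) :
    ∃ f : X ⟶ Y, Compat R S θ f := by
  choose q hq using hR.bijective.2
  have hq' : ∀ x, q (R.pt x) = x := fun x => hR.bijective.1 (hq _)
  -- The map on points is forced: a point of `X` is a point of `H`, and `θ` sends it to a point of
  -- `G`.
  let b : X.carrier → Y.carrier := fun x => S.pt (θ.app _ (q x))
  have hb : ∀ x, b (R.pt x) = S.pt (θ.app _ x) := fun x => by
    change S.pt (θ.app _ (q (R.pt x))) = _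
    rw [hq']
  have hbg : ∀ {A : CommMonZ.{u}} (g : H.obj A) (p : MSpec A),
      b (R.pt (H.map (chi p) g)) = S.pt (G.map (chi p) (θ.app A g)) := fun g p => by
    rw [hb, NatTrans.naturality_apply]
  have hc : Continuous b := continuous_def.2 fun V hV => hR.isOpen _ fun A g => by
    have := hV.preimage (S.continuous (θ.app A g))
    convert this using 1
    ext p
    change b _ ∈ V ↔ S.pt _ ∈ V
    rw [hbg]
  let bb : X.carrier ⟶ Y.carrier := TopCat.ofHom ⟨b, hc⟩
  have hl : ∀ {V : Opens Y.carrier} {A : CommMonZ.{u}} {h : H.obj A},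
      h ∈ (land H (R.pt ⁻¹' ((Opens.map bb).obj V : Set X.carrier))).obj A →
        θ.app A h ∈ (land G (S.pt ⁻¹' (V : Set Y.carrier))).obj A := fun {V A h} hh p => by
    have : b _ ∈ V := hh p
    rwa [hbg] at this
  -- The values of `s` at the elements `θ(h)` are natural in `h`; by exactness they are the values
  -- of a section on `X`, the pull-back of `s`.
  have hs : ∀ (V : Opens Y.carrier) (s : Y.Sec V), ∃ t : X.Sec ((Opens.map bb).obj V),
      ∀ (A : CommMonZ.{u}) (h : H.obj A) (hh), (R.ev _ t).on h hh =
        (S.ev V s).on (θ.app A h) (hl hh) := fun V s => by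
    obtain ⟨t, ht⟩ := (hR.ev_bijective ((Opens.map bb).obj V)).2
      (Sections.mkOn _ (fun {A} h hh => (S.ev V s).on (θ.app A h) (hl hh)) fun ρ h hh => by
        rw [Sections.map_on]
        exact Sections.on_congr _ (NatTrans.naturality_apply θ ρ h) _)
    exact ⟨t, fun A h hh => by rw [ht]; rfl⟩
  choose c hc' using hs
  have hext : ∀ {V : Opens X.carrier} {s t : X.Sec V}, (∀ (A : CommMonZ.{u}) (h : H.obj A) (hh),
      (R.ev V s).on h hh = (R.ev V t).on h hh) → s = t := fun h =>
    (hR.ev_bijective _).1 (Sections.ext_on h)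
  let cc : ∀ V : Opens Y.carrier, Y.Sec V →*₀ X.Sec ((Opens.map bb).obj V) := fun V =>
    { toFun := c V
      map_zero' := hext fun A h hh => by rw [hc', map_zero, map_zero]; rfl
      map_one' := hext fun A h hh => by rw [hc', map_one, map_one]; rfl
      map_mul' := fun s t => hext fun A h hh => by
        rw [hc', map_mul, map_mul, Sections.mul_on, Sections.mul_on, hc', hc'] }
  let f : X.toPresheafedSpace ⟶ Y.toPresheafedSpace :=
    { base := bb
      c :=
        { app := fun V => CommMonZ.ofHom (cc V.unop)
          naturality := fun V W i => CommMonZ.hom_ext fun s => hext fun A h hh => by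
            refine (hc' W.unop (Y.res i.unop.le s) A h hh).trans ?_
            refine (S.ev_res i.unop.le s _ _).trans ?_
            refine Eq.trans ?_ (R.ev_res (show (Opens.map bb).obj W.unop ≤
              (Opens.map bb).obj V.unop from fun _ hx => i.unop.le hx) (c V.unop s) h hh).symm
            exact (hc' V.unop s A h _).symm } }
  refine ⟨⟨f, fun x => ⟨fun t ht => ?_⟩⟩, ⟨hb, fun V s A h h1 h2 => hc' V s A h h1⟩⟩
  obtain ⟨x, rfl⟩ := hR.bijective.2 x
  obtain ⟨V, hV, s, rfl⟩ := exists_germ _ _ t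
  change IsUnit (X.germAt (U := (Opens.map bb).obj V) hV (c V s)) at ht
  have hx : S.pt (θ.app _ x) ∈ V := hb x ▸ hV
  -- Locality: the pulled back germ at `x` and the germ at the image of `x` have the same value in
  -- `{0,1}`, and this value detects units on both sides.
  have hu : IsUnit ((S.ev V s).on (θ.app _ x) (mem_land_monF1.2 hx)) := by
    rw [← hc' V s _ x (mem_land_monF1.2 hV)]
    exact R.isUnit_ev _ ht
  exact isUnit_germAt_congr (hb x).symm (S.isUnit_germ _ V hx s hu)

end Realization

/-! ## The realization of an affine functor -/

section SpecReal

variable (B : CommMonZ.{u})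

/-- The prime ideal attached to a point of an affine functor. -/
def affPt (x : (affineFunctor B).obj monF1.{u}) : (specSpace B).carrier :=
  (closedPt monF1.{u}).comap (CommMonZ.Hom.hom (show B ⟶ monF1 from x))

lemma affPt_map {A : CommMonZ.{u}} (φ : B ⟶ A) (p : MSpec A) :
    affPt B ((affineFunctor B).map (chi p) φ) = p.comap (CommMonZ.Hom.hom φ) := by
  change (closedPt monF1.{u}).comap (CommMonZ.Hom.hom (φ ≫ chi p)) = _
  rw [MSpec.comap_comp, comap_chi]

variable {B} in
lemma mem_land_affPt {A : CommMonZ.{u}} {φ : B ⟶ A} {U : Opens (specSpace B).carrier} :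
    φ ∈ (land (affineFunctor B) (affPt B ⁻¹' (U : Set (specSpace B).carrier))).obj A ↔
      ∀ q : MSpec A, q.comap (CommMonZ.Hom.hom φ) ∈ U := by
  refine forall_congr' fun q => ?_
  rw [Set.mem_preimage, affPt_map]
  rfl

lemma affPt_bijective : Function.Bijective (affPt B) := by
  refine ⟨fun x y h => ?_, fun p => ⟨chi p, comap_chi p⟩⟩
  exact (chi_comap (show B ⟶ monF1 from x)).symm.trans
    ((congrArg chi h).trans (chi_comap (show B ⟶ monF1 from y)))

/-- The spectrum of a monoid realizes the affine functor. -/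
noncomputable def specReal : Realization (specSpace B) (affineFunctor B) where
  pt := affPt B
  continuous φ :=
    (continuous_congr fun p => affPt_map B φ p).2 (MSpec.continuous_comap (CommMonZ.Hom.hom φ))
  ev V :=
    { toFun := fun σ => Sections.mkOn _ (fun φ h => secEval σ φ (mem_land_affPt.1 h))
        fun ρ φ h => secEval_comp σ φ ρ _ _
      map_zero' := Sections.ext_on fun A φ h => secEval_zero φ (mem_land_affPt.1 h)
      map_one' := Sections.ext_on fun A φ h => secEval_one φ (mem_land_affPt.1 h)
      map_mul' := fun σ τ => Sections.ext_on fun A φ h => secEval_mul σ τ φ (mem_land_affPt.1 h) }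
  ev_res i σ A φ h := rfl
  isUnit_germ x V hx σ h := by
    refine isUnit_of_isUnit_stalkToLoc _ _ _ ?_
    change IsUnit (σ.1 ⟨_, hx⟩)
    rw [← secEval_locP σ hx]
    refine isUnit_of_forall_notMem fun p hp => ?_
    have hc : chi (affPt B x) = x := chi_comap _
    -- The homomorphism `ψ` from the localization to `{0,1}` reflects units. To see this for the
    -- value of `σ`, write it as `a / f`: its image under `ψ` is the image of `a` under the
    -- character, which is a unit only if `a` lies outside the prime ideal.
    let ψ : locObj (affPt B x).compl ⟶ monF1 :=
      locLift (chi (affPt B x)) fun f => chi_isUnit_iff.2 f.2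
    have h1 : locP (affPt B x) ≫ ψ = x := (locHom_locLift _ _).trans hc
    have h2 : IsUnit (CommMonZ.Hom.hom ψ (secEval σ (locP (affPt B x)) (comap_locP_mem hx))) := by
      rw [← secEval_comp σ (locP _) ψ _ (by rw [h1]; exact mem_land_affPt.1 (mem_land_monF1.2 hx)),
        secEval_congr σ h1]
      exact h
    refine MSpec.not_isUnit (p := p) hp ?_
    obtain ⟨W, hW, i, a, f, hf, hs⟩ := exists_frac σ hx
    obtain ⟨hf', e⟩ := hs ⟨_, hx⟩ hW
    rw [secEval_locP σ hx, e] at h2 ⊢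
    rw [isUnit_mk_iff]
    have h3 := congrArg (CommMonZ.Hom.hom ψ) (mk_mul_locHom (affPt B x).compl a ⟨f, hf'⟩)
    have h4 : ∀ b, CommMonZ.Hom.hom ψ (CommMonZ.Hom.hom (locP (affPt B x)) b) =
      CommMonZ.Hom.hom (chi (affPt B x)) b := fun b =>
        congrArg (fun k => CommMonZ.Hom.hom k b) (locHom_locLift _ _)
    rw [map_mul, h4, h4, chi_eq_one_iff.2 hf', mul_one] at h3
    rw [h3] at h2
    exact chi_isUnit_iff.1 h2

/-- Open sets are tested on the universal element `𝟙 B`, whose map on primes is the identity. For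
sections, exactness is `sec_ext` and `exists_sec`. -/
lemma specReal_isExact : (specReal B).IsExact where
  bijective := affPt_bijective B
  isOpen W hW := by
    have e : {p : MSpec B | affPt B ((affineFunctor B).map (chi p) (𝟙 B)) ∈ W} = W :=
      Set.ext fun p => by
        rw [Set.mem_ofPred_eq, affPt_map]
        rfl
    exact e ▸ hW B (𝟙 B)
  ev_bijective V := by
    refine ⟨fun σ τ h => sec_ext fun A φ hφ => ?_, fun ν => ?_⟩
    · exact congrArg (fun s => Sections.on (U := affineFunctor B) s φ (mem_land_affPt.2 hφ)) h
    · obtain ⟨σ, hσ⟩ := exists_sec (U := V)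
        (fun {A} φ h => Sections.on (U := affineFunctor B) ν φ (mem_land_affPt.2 h))
        (fun φ ρ h h' => (ν.map_on ρ φ _).symm)
      exact ⟨σ, Sections.ext_on fun A φ h => hσ A φ (mem_land_affPt.1 h)⟩

end SpecReal

/-! ## The realization of the functor of points of a space -/

section SpaceReal

variable (X : MonoidalSpace.{u})

/-- The image of the closed point. -/
def spacePt (f : (spacePoints.obj X).obj monF1.{u}) : X.carrier :=
  (show (specSpace monF1 ⟶ X) from f).toHom.base (closedPt monF1.{u})

lemma spacePt_map {A : CommMonZ.{u}} (f : specSpace A ⟶ X) (p : MSpec A) :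
    spacePt X ((spacePoints.obj X).map (chi p) f) = f.toHom.base p := by
  change f.toHom.base ((closedPt monF1).comap (CommMonZ.Hom.hom (chi p))) = _
  rw [comap_chi]

variable {X} in
lemma mem_land_spacePt {A : CommMonZ.{u}} {f : specSpace A ⟶ X} {U : Opens X.carrier} :
    f ∈ (land (spacePoints.obj X) (spacePt X ⁻¹' (U : Set X.carrier))).obj A ↔
      ∀ q : MSpec A, f.toHom.base q ∈ U := by
  refine forall_congr' fun q => ?_
  rw [Set.mem_preimage, spacePt_map]
  rfl

variable {X} in
/-- The value of a section along a morphism from a spectrum. -/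
noncomputable def pull {V : Opens X.carrier} {A : CommMonZ.{u}} (f : specSpace A ⟶ X)
    (h : ∀ q : MSpec A, f.toHom.base q ∈ V) (s : X.Sec V) : A :=
  secEval (pb f V s) (𝟙 A) h

variable {X} in
lemma pull_comp {V : Opens X.carrier} {A B : CommMonZ.{u}} (f : specSpace A ⟶ X) (ρ : A ⟶ B)
    (h : ∀ q : MSpec A, f.toHom.base q ∈ V)
    (h' : ∀ q : MSpec B, (specMap ρ ≫ f).toHom.base q ∈ V) (s : X.Sec V) :
    pull (specMap ρ ≫ f) h' s = CommMonZ.Hom.hom ρ (pull f h s) := by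
  refine Eq.trans ?_ (secEval_comp (pb f V s) (𝟙 A) ρ h h')
  by_cases hB : Nontrivial B
  · refine (secEval_of_nontrivial _ _ _).trans (Eq.trans ?_ (secEval_of_nontrivial _ _ _).symm)
    exact congrArg (locClosedPt B) (locMap_id (closedPt B) _)
  · have := not_nontrivial_iff_subsingleton.1 hB
    exact Subsingleton.elim _ _

/-- A space realizes its functor of points. -/
noncomputable def spaceReal : Realization X (spacePoints.obj X) where
  pt := spacePt X
  continuous {A} f := (continuous_congr fun p => spacePt_map X f p).2
    (show (specSpace A ⟶ X) from f).toHom.base.hom.continuous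
  ev V :=
    { toFun := fun s => Sections.mkOn _ (fun f h => pull f (mem_land_spacePt.1 h) s)
        fun ρ f h => pull_comp (show (specSpace _ ⟶ X) from f) ρ _ _ s
      map_zero' := Sections.ext_on fun A f h => by
        refine Eq.trans ?_ (secEval_zero (U := preim f V) (𝟙 A) (mem_land_spacePt.1 h))
        exact congrArg (fun s => secEval s (𝟙 A) (mem_land_spacePt.1 h)) (map_zero (pb f V))
      map_one' := Sections.ext_on fun A f h => by
        refine Eq.trans ?_ (secEval_one (U := preim f V) (𝟙 A) (mem_land_spacePt.1 h))
        exact congrArg (fun s => secEval s (𝟙 A) (mem_land_spacePt.1 h)) (map_one (pb f V))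
      map_mul' := fun s t => Sections.ext_on fun A f h => by
        refine Eq.trans ?_ (secEval_mul (U := preim f V) _ _ (𝟙 A) (mem_land_spacePt.1 h))
        exact congrArg (fun s => secEval s (𝟙 A) (mem_land_spacePt.1 h)) (map_mul (pb f V) s t) }
  ev_res i s A f h := by
    refine (congrArg (fun t => secEval t (𝟙 A) (mem_land_spacePt.1 h))
      (pb_res (show (specSpace A ⟶ X) from f) i s)).trans ?_
    exact (specReal A).ev_res (A := A) _ _ (𝟙 A) (mem_land_affPt.2 (mem_land_spacePt.1 h))
  isUnit_germ f V hx s h := by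
    -- Here the locality of `f` enters: the germ at the image of the closed point is a unit as soon
    -- as its pull-back to the stalk of `Spec {0,1}` is one, and that is checked in the realization
    -- of an affine functor.
    refine ((show (specSpace monF1 ⟶ X) from f).isLocal (closedPt monF1)).map_nonunit _ ?_
    have := (specReal monF1).isUnit_germ (𝟙 _) (preim f V) hx (pb f V s) h
    exact this

variable {X} {Y : MonoidalSpace.{u}}

lemma compat_spaceReal (f : X ⟶ Y) :
    Realization.Compat (spaceReal X) (spaceReal Y) (spacePoints.map f) f where
  pt _ := rfl
  ev _ _ _ _ _ _ := rfl

/-- The transformation from an affine functor attached to a morphism from a spectrum. -/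
noncomputable abbrev ofSpec {A : CommMonZ.{u}} (f : specSpace A ⟶ X) : affineFunctor A ⟶ spacePoints.obj X :=
  ofElem (G := spacePoints.obj X) f

lemma compat_ofSpec {A : CommMonZ.{u}} (f : specSpace A ⟶ X) :
    Realization.Compat (specReal A) (spaceReal X) (ofSpec f) f where
  pt x := rfl
  ev V s B ρ h1 h2 := by
    by_cases hB : Nontrivial B
    · refine (secEval_of_nontrivial (U := preim f V) (A := B) (pb f V s) ρ
        (mem_land_affPt.1 h1)).trans (Eq.trans ?_ (secEval_of_nontrivial _ _
          (mem_land_spacePt.1 h2)).symm)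
      exact (congrArg (locClosedPt B) (locMap_id (closedPt B) _)).symm
    · have := not_nontrivial_iff_subsingleton.1 hB
      exact Subsingleton.elim _ _

lemma pull_mul {V : Opens X.carrier} {A : CommMonZ.{u}} (f : specSpace A ⟶ X)
    (h : ∀ q : MSpec A, f.toHom.base q ∈ V) (s t : X.Sec V) :
    pull f h (s * t) = pull f h s * pull f h t := by
  have := map_mul ((spaceReal X).ev V) s t
  exact congrArg (fun r => Sections.on (U := spacePoints.obj X) r f (mem_land_spacePt.2 h)) this

lemma pull_one {V : Opens X.carrier} {A : CommMonZ.{u}} (f : specSpace A ⟶ X)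
    (h : ∀ q : MSpec A, f.toHom.base q ∈ V) : pull f h 1 = 1 := by
  have := map_one ((spaceReal X).ev V)
  exact congrArg (fun r => Sections.on (U := spacePoints.obj X) r f (mem_land_spacePt.2 h)) this

lemma pull_zero {V : Opens X.carrier} {A : CommMonZ.{u}} (f : specSpace A ⟶ X)
    (h : ∀ q : MSpec A, f.toHom.base q ∈ V) : pull f h 0 = 0 := by
  have := map_zero ((spaceReal X).ev V)
  exact congrArg (fun r => Sections.on (U := spacePoints.obj X) r f (mem_land_spacePt.2 h)) this

lemma pull_res {V W : Opens X.carrier} (i : W ≤ V) {A : CommMonZ.{u}} (f : specSpace A ⟶ X)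
    (h : ∀ q : MSpec A, f.toHom.base q ∈ W) (s : X.Sec V) :
    pull f h (X.res i s) = pull f (fun q => i (h q)) s :=
  (spaceReal X).ev_res i s (A := A) f (mem_land_spacePt.2 h)

/-- A morphism from the spectrum of a non-trivial monoid lands in any open set that contains the
image of the closed point. In particular it lands in a single chart, which makes many statements
about geometric schemes affine. -/
lemma forall_mem_of_closedPt {V : Opens X.carrier} {A : CommMonZ.{u}} [Nontrivial A]
    (f : specSpace A ⟶ X) (h : f.toHom.base (closedPt A) ∈ V) (q : MSpec A) :
    f.toHom.base q ∈ V :=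
  MSpec.mem_of_subset (preim f V) h q.subset_closedPt

end SpaceReal

/-! ## Morphisms of spectra -/

section SpecHom

variable {A B : CommMonZ.{u}}

lemma locMap_locMap {C : CommMonZ.{u}} (φ : B ⟶ A) (ρ : A ⟶ C) (q : MSpec C)
    (t : LocAt (q.comap (CommMonZ.Hom.hom (φ ≫ ρ)))) :
    locMap (CommMonZ.Hom.hom ρ) q (locMap (CommMonZ.Hom.hom φ)
      (q.comap (CommMonZ.Hom.hom ρ)) t) = locMap (CommMonZ.Hom.hom (φ ≫ ρ)) q t := by
  induction t using Localization.induction_on with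
  | H y => rfl

lemma compat_specMap (φ : B ⟶ A) :
    Realization.Compat (specReal A) (specReal B) (ofElem (G := affineFunctor B) φ)
      (specMap φ) where
  pt x := rfl
  ev V s C ρ h1 h2 := by
    by_cases hC : Nontrivial C
    · refine (secEval_of_nontrivial (A := C) (B := A) _ ρ (mem_land_affPt.1 h1)).trans
        (Eq.trans ?_ (secEval_of_nontrivial (A := C) (B := B) s (φ ≫ ρ)
          (mem_land_affPt.1 h2)).symm)
      exact congrArg (locClosedPt C) (locMap_locMap φ ρ (closedPt C) _)
    · have := not_nontrivial_iff_subsingleton.1 hC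
      exact Subsingleton.elim _ _

/-- The homomorphism attached to a morphism of spectra. -/
noncomputable def globalHom (f : specSpace A ⟶ specSpace B) : B ⟶ A :=
  CommMonZ.ofHom (A := B) (B := A)
    { toFun := fun b => pull f (V := ⊤) (fun _ => trivial) (globalSec b)
      map_zero' := (congrArg (pull f _) (map_zero (globalSecHom ⊤))).trans (pull_zero f _)
      map_one' := (congrArg (pull f _) (map_one (globalSecHom ⊤))).trans (pull_one f _)
      map_mul' := fun a b =>
        (congrArg (pull f _) (map_mul (globalSecHom ⊤) a b)).trans (pull_mul f _ _ _) }

lemma pull_globalSec (f : specSpace A ⟶ specSpace B) {V : Opens (specSpace B).carrier}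
    (h : ∀ q : MSpec A, f.toHom.base q ∈ V) (b : B) :
    pull f h (globalSec b) = CommMonZ.Hom.hom (globalHom f) b :=
  pull_res (le_top : V ≤ ⊤) f h (globalSec b)

lemma globalHom_comp {C : CommMonZ.{u}} (f : specSpace A ⟶ specSpace B) (ρ : A ⟶ C) :
    globalHom (specMap ρ ≫ f) = globalHom f ≫ ρ :=
  CommMonZ.hom_ext fun b =>
    pull_comp (V := ⊤) f ρ (fun _ => trivial) (fun _ => trivial) (globalSec b)

/-- A prime of `B` is the set of those `b` whose germ there is not a unit. Units of germs are
detected by values in `{0,1}`, and the value of `b` along `specMap (chi q) ≫ f` is `chi q` of the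
image of `b` in `A`. -/
lemma comap_globalHom (f : specSpace A ⟶ specSpace B) (q : MSpec A) :
    q.comap (CommMonZ.Hom.hom (globalHom f)) = f.toHom.base q := by
  ext b
  have h3 : ∀ g : specSpace monF1 ⟶ specSpace B, IsUnit (CommMonZ.Hom.hom (globalHom g) b) ↔
      b ∉ (MSpec.carrier (g.toHom.base (closedPt monF1))) := by
    intro g
    constructor
    · intro h
      have := (spaceReal (specSpace B)).isUnit_germ g ⊤ trivial (globalSec b) h
      have := this.map (CommMonZ.Hom.hom (stalkToLoc B _))
      exact locP_isUnit_iff.1 this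
    · intro h
      refine (spaceReal (specSpace B)).isUnit_ev (x := g) (V := ⊤) trivial (s := globalSec b) ?_
      exact isUnit_of_isUnit_stalkToLoc _ _ _ (locP_isUnit_iff.2 h)
  have h1 := h3 (specMap (chi q) ≫ f)
  have h2 : (specMap (chi q) ≫ f).toHom.base (closedPt monF1) = f.toHom.base q :=
    spacePt_map _ f q
  rw [globalHom_comp] at h1
  refine not_iff_not.1 (chi_isUnit_iff.symm.trans (h1.trans ?_))
  exact iff_of_eq (congrArg (fun p : MSpec B => b ∉ p.carrier) h2)

/-- Near the image of the closed point `σ` is a fraction `a / b` of global sections. Since `Spec A`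
lands there, the pull-back of `σ` is determined by the pull-backs of `a` and `b`. -/
lemma pull_spec [Nontrivial A] (f : specSpace A ⟶ specSpace B) {V : Opens (specSpace B).carrier}
    (h : ∀ q : MSpec A, f.toHom.base q ∈ V) (σ : (specSpace B).Sec V) :
    pull f h σ = secEval σ (globalHom f) fun q => (comap_globalHom f q).symm ▸ h q := by
  obtain ⟨W, hW, i, a, b, hb, hs⟩ := exists_frac σ (h (closedPt A))
  have hfW : ∀ q : MSpec A, f.toHom.base q ∈ W := forall_mem_of_closedPt f hW
  have h1 : (specSpace B).res i σ * globalSec b = globalSec a := by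
    refine Subtype.ext (funext fun p => ?_)
    obtain ⟨hp, e⟩ := hs ⟨p.1, i p.2⟩ p.2
    change σ.1 ⟨p.1, i p.2⟩ * _ = _
    rw [e]
    exact mk_mul_locHom p.1.compl a ⟨b, hp⟩
  have h2 := congrArg (pull f hfW) h1
  rw [pull_mul f hfW, pull_res i f hfW, pull_globalSec f hfW, pull_globalSec f hfW] at h2
  have hu : IsUnit (CommMonZ.Hom.hom (globalHom f) b) := by
    rw [← comap_globalHom] at hb
    exact not_not.1 hb
  refine hu.mul_right_cancel (h2.trans (secEval_mul_eq σ _ _ ?_).symm)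
  rintro p ⟨q, hq⟩
  refine hs p ?_
  rw [← hq, comap_globalHom]
  exact hfW q

/-- The functor `Spec` is full. -/
lemma specMap_globalHom (f : specSpace A ⟶ specSpace B) :
    specMap (globalHom f) = f := by
  -- Both morphisms are compatible with the transformation attached to `globalHom f`, and the source
  -- is an exact realization.
  refine (compat_specMap (globalHom f)).unique (specReal_isExact A) ⟨fun x => ?_, ?_⟩
  · exact (comap_globalHom f _).symm
  · intro V s C ρ h1 h2
    refine ((compat_ofSpec f).ev V s C ρ h1 ((compat_ofSpec f).mem_land.1 h1)).trans ?_
    by_cases hC : Nontrivial C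
    · refine (pull_spec (specMap ρ ≫ f)
        (mem_land_spacePt.1 ((compat_ofSpec f).mem_land.1 h1)) s).trans ?_
      exact secEval_congr _ (globalHom_comp f ρ) _
    · have := not_nontrivial_iff_subsingleton.1 hC
      exact Subsingleton.elim _ _

/-- The functor `Spec` is faithful. -/
lemma globalHom_specMap (φ : B ⟶ A) : globalHom (specMap φ) = φ := by
  refine CommMonZ.hom_ext fun b => ?_
  have h := (compat_specMap φ).ev ⊤ (globalSec b) A (𝟙 A) (fun _ => trivial) (fun _ => trivial)
  refine h.trans ((secEval_globalSec (U := ⊤) b (φ ≫ 𝟙 A) (fun _ => trivial)).trans ?_)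
  rw [Category.comp_id]

end SpecHom

end FOne

namespace FOne

open AlgebraicGeometry MonoidalSpace

/-! ## Open immersions -/

section OpenImmersion

variable {X Y : MonoidalSpace.{u}}

/-- A morphism of monoidal spaces is an open immersion if it is so for the presheafed spaces. -/
def IsOpenImm (f : X ⟶ Y) : Prop := PresheafedSpace.IsOpenImmersion f.toHom

/-- The image of an open immersion. -/
def IsOpenImm.range {f : X ⟶ Y} (hf : IsOpenImm f) : Opens Y.carrier :=
  ⟨Set.range f.toHom.base, hf.base_open.isOpen_range⟩

lemma isIso_of_bijective {A B : CommMonZ.{u}} (φ : A ⟶ B)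
    (h : Function.Bijective (CommMonZ.Hom.hom φ)) : IsIso φ := by
  let e : B ≃* A := (MulEquiv.ofBijective (CommMonZ.Hom.hom φ) h).symm
  refine ⟨CommMonZ.ofHom (A := B) (B := A)
    { toFun := e, map_zero' := ?_, map_one' := map_one e, map_mul' := map_mul e }, ?_, ?_⟩
  · exact (MulEquiv.symm_apply_eq _).2 (map_zero (CommMonZ.Hom.hom φ)).symm
  · exact CommMonZ.hom_ext fun a => e.apply_symm_apply a
  · exact CommMonZ.hom_ext fun a => e.symm_apply_apply a

lemma bijective_of_isIso {A B : CommMonZ.{u}} (φ : A ⟶ B) [IsIso φ] :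
    Function.Bijective (CommMonZ.Hom.hom φ) :=
  ConcreteCategory.bijective_of_isIso φ

lemma opens_eq_image {f : X ⟶ Y} (hf : Topology.IsOpenEmbedding f.toHom.base)
    {V : Opens Y.carrier} (hV : ∀ y ∈ V, y ∈ Set.range f.toHom.base) :
    V = hf.functor.obj (preim f V) := by
  ext y
  refine ⟨fun hy => ?_, ?_⟩
  · obtain ⟨x, rfl⟩ := hV y hy
    exact ⟨x, hy, rfl⟩
  · rintro ⟨x, hx, rfl⟩
    exact hx

lemma IsOpenImm.bijective {f : X ⟶ Y} (hf : IsOpenImm f) {V : Opens Y.carrier}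
    (hV : ∀ y ∈ V, y ∈ Set.range f.toHom.base) : Function.Bijective (pb f V) := by
  have := hf
  have := PresheafedSpace.IsOpenImmersion.c_iso' (H := hf) f.toHom (preim f V)
    (opens_eq_image hf.base_open hV)
  exact bijective_of_isIso (f.toHom.c.app (op V))

lemma isOpenImm_of_bijective {f : X ⟶ Y} (hf : Topology.IsOpenEmbedding f.toHom.base)
    (h : ∀ V : Opens Y.carrier, (∀ y ∈ V, y ∈ Set.range f.toHom.base) →
      Function.Bijective (pb f V)) : IsOpenImm f where
  base_open := hf
  c_iso U := isIso_of_bijective _ (h _ (by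
    rintro _ ⟨x, _, rfl⟩
    exact ⟨x, rfl⟩))

lemma IsOpenImm.comp {Z : MonoidalSpace.{u}} {f : X ⟶ Y} {g : Y ⟶ Z} (hf : IsOpenImm f)
    (hg : IsOpenImm g) : IsOpenImm (f ≫ g) := by
  have := hf
  have := hg
  exact PresheafedSpace.IsOpenImmersion.comp (H := hf) f.toHom g.toHom (hg := hg)

end OpenImmersion

/-! ### Stalk maps of open immersions. -/

section Presheafed

variable {X Y Z : PresheafedSpace.{u, u + 1, u} CommMonZ.{u}}

lemma stalkMap_surjective (f : X ⟶ Y) [H : PresheafedSpace.IsOpenImmersion f] (x : X) :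
    Function.Surjective (CommMonZ.Hom.hom (stalkMap f x)) := by
  intro t
  obtain ⟨V, hV, s, rfl⟩ := exists_germ _ _ t
  obtain ⟨s', hs'⟩ := (bijective_of_isIso (f.c.app (op (H.base_open.functor.obj V)))).2
    (CommMonZ.Hom.hom (X.presheaf.map (homOfLE (by
      rintro y ⟨z, hz, e⟩
      exact H.base_open.injective e ▸ hz)).op) s)
  have hx : f.base x ∈ H.base_open.functor.obj V := ⟨x, hV, rfl⟩
  refine ⟨CommMonZ.Hom.hom (germ Y.presheaf (f.base x) _ hx) s', ?_⟩
  refine (congrArg (CommMonZ.Hom.hom (germ X.presheaf x _ hx)) hs').trans ?_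
  exact congrArg (fun k => CommMonZ.Hom.hom k s) (germ_res X.presheaf x _ hV hx)

lemma stalkMap_injective (f : X ⟶ Y) [H : PresheafedSpace.IsOpenImmersion f] (x : X) :
    Function.Injective (CommMonZ.Hom.hom (stalkMap f x)) := by
  intro t t' e
  obtain ⟨V, hV, s, rfl⟩ := exists_germ _ _ t
  obtain ⟨V', hV', s', rfl⟩ := exists_germ _ _ t'
  obtain ⟨W, i, j, e⟩ := Quotient.exact e
  let U : Opens Y := H.base_open.functor.obj (OrderDual.ofDual W).1
  have hU : f.base x ∈ U := ⟨x, (OrderDual.ofDual W).2, rfl⟩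
  have hi : U ≤ V := by
    rintro _ ⟨y, hy, rfl⟩
    exact i hy
  have hj : U ≤ V' := by
    rintro _ ⟨y, hy, rfl⟩
    exact j hy
  have hk : (Opens.map f.base).obj U ≤ (OrderDual.ofDual W).1 := by
    rintro y ⟨z, hz, e⟩
    exact H.base_open.injective e ▸ hz
  rw [← germ_res Y.presheaf (f.base x) (homOfLE hi).op hV hU,
    ← germ_res Y.presheaf (f.base x) (homOfLE hj).op hV' hU]
  refine congrArg (CommMonZ.Hom.hom (germ Y.presheaf (f.base x) U hU)) ?_
  refine (bijective_of_isIso (f.c.app (op U))).1 ?_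
  refine (congrArg (fun k => CommMonZ.Hom.hom k s) (f.c.naturality (homOfLE hi).op)).trans
    (Eq.trans ?_ (congrArg (fun k => CommMonZ.Hom.hom k s') (f.c.naturality (homOfLE hj).op)).symm)
  have e2 := congrArg (CommMonZ.Hom.hom (X.presheaf.map (homOfLE hk).op)) e
  refine Eq.trans ?_ (e2.trans ?_)
  · exact congrArg (fun k => CommMonZ.Hom.hom k (CommMonZ.Hom.hom (f.c.app (op V)) s))
      (X.presheaf.map_comp (homOfLE (show (OrderDual.ofDual W).1 ≤ _ from i)).op (homOfLE hk).op)
  · exact congrArg (fun k => CommMonZ.Hom.hom k (CommMonZ.Hom.hom (f.c.app (op V')) s'))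
      (X.presheaf.map_comp (homOfLE (show (OrderDual.ofDual W).1 ≤ _ from j)).op
        (homOfLE hk).op).symm

lemma isUnit_of_map_of_bijective {A B : CommMonZ.{u}} {φ : A →*₀ B} (h : Function.Bijective φ)
    {a : A} (ha : IsUnit (φ a)) : IsUnit a := by
  obtain ⟨b, hb⟩ := ha.exists_right_inv
  obtain ⟨c, rfl⟩ := h.2 b
  exact IsUnit.of_mul_eq_one c (h.1 (by rw [map_mul, hb, map_one]))

lemma isLocalMorphism_of_isOpenImmersion (f : X ⟶ Y) [PresheafedSpace.IsOpenImmersion f] :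
    IsLocalMorphism f :=
  fun x => ⟨fun _ ha => isUnit_of_map_of_bijective ⟨stalkMap_injective f x, stalkMap_surjective f x⟩ ha⟩

/-- A germ `t` on `Y` is the pull-back of a germ on `Z`. If the pull-back of `t` to `X` is a unit,
then so is the germ on `Z`, by the locality of the composite, and hence so is `t`. This makes lifts
along open immersions local. -/
lemma IsLocalMorphism.of_comp {f : X ⟶ Y} {g : Y ⟶ Z} (h : IsLocalMorphism (f ≫ g))
    (hg : ∀ y, Function.Surjective (CommMonZ.Hom.hom (stalkMap g y))) : IsLocalMorphism f := by
  refine fun x => ⟨fun t ht => ?_⟩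
  obtain ⟨t, rfl⟩ := hg _ t
  refine IsUnit.map _ ((h x).map_nonunit t ?_)
  rw [stalkMap_comp]
  exact ht

end Presheafed

/-! ### Charts of monoidal spaces. -/

section Charts

variable {X Y : MonoidalSpace.{u}}

lemma IsOpenImm.injective {f : X ⟶ Y} (hf : IsOpenImm f) : Function.Injective f.toHom.base :=
  hf.base_open.injective

/-- Morphisms into the image of an open immersion lift. -/
lemma IsOpenImm.exists_lift {Z : MonoidalSpace.{u}} {i : X ⟶ Z} (hi : IsOpenImm i) (f : Y ⟶ Z)
    (h : ∀ y, f.toHom.base y ∈ Set.range i.toHom.base) : ∃ l : Y ⟶ X, l ≫ i = f := by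
  have := hi
  have hr : Set.range f.toHom.base ⊆ Set.range i.toHom.base := Set.range_subset_iff.2 h
  have e := PresheafedSpace.IsOpenImmersion.lift_fac (hf := hi) i.toHom f.toHom hr
  refine ⟨⟨PresheafedSpace.IsOpenImmersion.lift (hf := hi) i.toHom f.toHom hr, ?_⟩,
    MonoidalSpace.Hom.ext e⟩
  exact IsLocalMorphism.of_comp (g := i.toHom) (e.symm ▸ f.isLocal)
    fun y => @stalkMap_surjective _ _ i.toHom hi y

lemma IsOpenImm.cancel {Z : MonoidalSpace.{u}} {i : X ⟶ Z} (hi : IsOpenImm i) {f g : Y ⟶ X}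
    (h : f ≫ i = g ≫ i) : f = g := by
  have := @PresheafedSpace.IsOpenImmersion.mono _ _ _ _ i.toHom hi
  exact MonoidalSpace.Hom.ext ((cancel_mono i.toHom).1 (congrArg MonoidalSpace.Hom.toHom h))

/-- Morphisms from a spectrum into a chart are given by homomorphisms. -/
lemma IsOpenImm.exists_specMap {A B : CommMonZ.{u}} {i : specSpace B ⟶ X} (hi : IsOpenImm i)
    (f : specSpace A ⟶ X) (h : ∀ q : MSpec A, f.toHom.base q ∈ Set.range i.toHom.base) :
    ∃ φ : B ⟶ A, specMap φ ≫ i = f := by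
  obtain ⟨l, hl⟩ := hi.exists_lift f h
  exact ⟨globalHom l, by rw [specMap_globalHom, hl]⟩

lemma IsOpenImm.specMap_injective {A B : CommMonZ.{u}} {i : specSpace B ⟶ X} (hi : IsOpenImm i)
    {φ ψ : B ⟶ A} (h : specMap φ ≫ i = specMap ψ ≫ i) : φ = ψ := by
  rw [← globalHom_specMap φ, hi.cancel h, globalHom_specMap]

lemma IsGeometric.exists_chart (hX : IsGeometric X) (x : X.carrier) :
    ∃ (B : CommMonZ.{u}) (i : specSpace B ⟶ X), IsOpenImm i ∧ x ∈ Set.range i.toHom.base := by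
  obtain ⟨U, hx, B, ⟨e⟩⟩ := hX x
  let i : (specSpace B).toPresheafedSpace ⟶ X.toPresheafedSpace :=
    e.inv ≫ X.toPresheafedSpace.ofRestrict U.isOpenEmbedding
  have hi : PresheafedSpace.IsOpenImmersion i := inferInstance
  refine ⟨B, ⟨i, isLocalMorphism_of_isOpenImmersion i⟩, hi, e.hom.base ⟨x, hx⟩, ?_⟩
  change (X.toPresheafedSpace.ofRestrict U.isOpenEmbedding).base (e.inv.base (e.hom.base ⟨x, hx⟩)) = x
  have h : e.inv.base (e.hom.base ⟨x, hx⟩) = ⟨x, hx⟩ :=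
    congrArg (fun k => k.base ⟨x, hx⟩) e.hom_inv_id
  rw [h]
  rfl

lemma isGeometric_of_charts (h : ∀ x : X.carrier, ∃ (B : CommMonZ.{u}) (i : specSpace B ⟶ X),
    IsOpenImm i ∧ x ∈ Set.range i.toHom.base) : IsGeometric X := by
  intro x
  obtain ⟨B, i, hi, hx⟩ := h x
  have := hi
  refine ⟨hi.range, hx, B, ⟨(@PresheafedSpace.IsOpenImmersion.isoOfRangeEq _ _ _ _ _
    i.toHom hi (X.toPresheafedSpace.ofRestrict hi.range.isOpenEmbedding) _ ?_).symm⟩⟩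
  exact (Subtype.range_coe (s := Set.range i.toHom.base)).symm

/-- Spectra of trivial monoids have no points. -/
lemma isEmpty_mspec (A : CommMonZ.{u}) (hA : ¬ Nontrivial A) : IsEmpty (MSpec A) :=
  ⟨fun p => hA p.nontrivial⟩

lemma subsingleton_sec (A : CommMonZ.{u}) (hA : ¬ Nontrivial A)
    (U : Opens (specSpace A).carrier) : Subsingleton ((specSpace A).Sec U) :=
  ⟨fun _ _ => Subtype.ext (funext fun p => (hA p.1.nontrivial).elim)⟩

/-- There is exactly one morphism from the spectrum of a trivial monoid. -/
lemma unique_of_trivial (A : CommMonZ.{u}) (hA : ¬ Nontrivial A) (X : MonoidalSpace.{u}) :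
    Nonempty (Unique (specSpace A ⟶ X)) := by
  have := isEmpty_mspec A hA
  have hs := subsingleton_sec A hA
  let b : (specSpace A).carrier ⟶ X.carrier :=
    TopCat.ofHom ⟨fun p : MSpec A => isEmptyElim p, continuous_of_const fun p : MSpec A => isEmptyElim p⟩
  let f : (specSpace A).toPresheafedSpace ⟶ X.toPresheafedSpace :=
    { base := b
      c :=
        { app := fun U => CommMonZ.ofHom
            (B := (specSpace A).Sec ((Opens.map b).obj U.unop))
            { toFun := fun _ => 1
              map_zero' := (hs _).elim _ _
              map_one' := rfl
              map_mul' := fun _ _ => (hs _).elim _ _ }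
          naturality := fun U V i => CommMonZ.hom_ext fun s => (hs _).elim _ _ } }
  refine ⟨⟨⟨f, fun p : MSpec A => isEmptyElim p⟩⟩, fun g => ?_⟩
  exact hom_ext_of (fun p : MSpec A => isEmptyElim p) fun V s => (hs _).elim _ _

end Charts

end FOne

namespace FOne

open AlgebraicGeometry MonoidalSpace

/-! ## The functor of points of a geometric scheme -/

lemma ofElem_comp {F G : CommMonZ.{u} ⥤ Type u} {A : CommMonZ.{u}} (g : F.obj A) (θ : F ⟶ G) :
    ofElem g ≫ θ = ofElem (θ.app A g) := by
  ext B ρ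
  exact NatTrans.naturality_apply θ ρ g

section Geometric

variable {X Y : MonoidalSpace.{u}}

lemma spacePt_chart {B : CommMonZ.{u}} (i : specSpace B ⟶ X) (p : MSpec B) :
    spacePt X (specMap (chi p) ≫ i) = i.toHom.base p := spacePt_map X i p

/-- The value of a section at a morphism that factors through a chart. -/
lemma pull_specMap_comp {V : Opens X.carrier} {A B : CommMonZ.{u}} (i : specSpace B ⟶ X)
    (φ : B ⟶ A) (h : ∀ q : MSpec A, (specMap φ ≫ i).toHom.base q ∈ V)
    (h' : ∀ q : MSpec A, q.comap (CommMonZ.Hom.hom φ) ∈ preim i V) (s : X.Sec V) :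
    secEval (U := preim i V) (pb i V s) φ h' = pull (specMap φ ≫ i) h s :=
  (compat_ofSpec i).ev V s A φ (mem_land_affPt.2 h') (mem_land_spacePt.2 h)

/-- Over the image of a chart, sections are sections on an open subset of `Spec B`, which are
determined by their values along homomorphisms `φ`; these are values along the morphisms `specMap φ
≫ i`. -/
lemma IsOpenImm.sec_ext {B : CommMonZ.{u}} {i : specSpace B ⟶ X} (hi : IsOpenImm i)
    {V : Opens X.carrier} (hV : ∀ y ∈ V, y ∈ Set.range i.toHom.base) {s t : X.Sec V}
    (h : ∀ (A : CommMonZ.{u}) (f : specSpace A ⟶ X) (hf : ∀ q : MSpec A, f.toHom.base q ∈ V),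
      pull f hf s = pull f hf t) : s = t := by
  refine (hi.bijective hV).1 (FOne.sec_ext (U := preim i V) fun A φ hφ => ?_)
  rw [pull_specMap_comp i φ hφ hφ, pull_specMap_comp i φ hφ hφ]
  exact h A _ _

lemma IsOpenImm.exists_sec {B : CommMonZ.{u}} {i : specSpace B ⟶ X} (hi : IsOpenImm i)
    {V : Opens X.carrier} (hV : ∀ y ∈ V, y ∈ Set.range i.toHom.base)
    (ν : ∀ {A : CommMonZ.{u}} (f : specSpace A ⟶ X), (∀ q : MSpec A, f.toHom.base q ∈ V) → A)
    (hν : ∀ {A A' : CommMonZ.{u}} (f : specSpace A ⟶ X) (ρ : A ⟶ A') (h) (h'),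
      ν (specMap ρ ≫ f) h' = CommMonZ.Hom.hom ρ (ν f h)) :
    ∃ s : X.Sec V, ∀ (A : CommMonZ.{u}) (f : specSpace A ⟶ X) (h), pull f h s = ν f h := by
  obtain ⟨σ, hσ⟩ := FOne.exists_sec (U := preim i V)
    (fun {A} φ (h : ∀ q : MSpec A, q.comap (CommMonZ.Hom.hom φ) ∈ preim i V) =>
      ν (specMap φ ≫ i) h) (fun φ ρ h h' => by
        have e : specMap (φ ≫ ρ) ≫ i = specMap ρ ≫ specMap φ ≫ i := by
          rw [specMap_comp, Category.assoc]
        have : ∀ {C : CommMonZ.{u}} {f g : specSpace C ⟶ X} (e : f = g)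
            (h : ∀ q : MSpec C, f.toHom.base q ∈ V), ν f h = ν g (e ▸ h) := by
          rintro C f _ rfl h
          rfl
        exact (this e _).trans (hν _ _ _ _))
  obtain ⟨s, rfl⟩ := (hi.bijective hV).2 σ
  refine ⟨s, fun A f h => ?_⟩
  obtain ⟨φ, rfl⟩ := hi.exists_specMap f fun q => hV _ (h q)
  rw [← pull_specMap_comp i φ h h]
  exact hσ A φ h

variable (hX : IsGeometric X)
include hX

lemma IsGeometric.sec_ext {V : Opens X.carrier} {s t : X.Sec V}
    (h : ∀ (A : CommMonZ.{u}) (f : specSpace A ⟶ X) (hf : ∀ q : MSpec A, f.toHom.base q ∈ V),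
      pull f hf s = pull f hf t) : s = t := by
  choose B i hi hx using hX.exists_chart
  refine eq_of_locally_eq (fun x => V ⊓ (hi x).range) V (fun _ => inf_le_left)
    (fun x hxV => ⟨x, hxV, hx x⟩) fun x => (hi x).sec_ext (V := V ⊓ (hi x).range) (fun y hy => hy.2) fun A f hf => ?_
  rw [pull_res, pull_res]
  exact h A f _

/-- On each chart the family of values comes from a section; these sections glue because sections
are determined by their values. -/
lemma IsGeometric.exists_sec {V : Opens X.carrier}
    (ν : ∀ {A : CommMonZ.{u}} (f : specSpace A ⟶ X), (∀ q : MSpec A, f.toHom.base q ∈ V) → A)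
    (hν : ∀ {A A' : CommMonZ.{u}} (f : specSpace A ⟶ X) (ρ : A ⟶ A') (h) (h'),
      ν (specMap ρ ≫ f) h' = CommMonZ.Hom.hom ρ (ν f h)) :
    ∃ s : X.Sec V, ∀ (A : CommMonZ.{u}) (f : specSpace A ⟶ X) (h), pull f h s = ν f h := by
  choose B i hi hx using hX.exists_chart
  have h1 := fun x => (hi x).exists_sec (V := V ⊓ (hi x).range) (fun y hy => hy.2)
    (fun {A} f h => ν f fun q => (h q).1) (fun f ρ h h' => hν f ρ _ _)
  choose s hs using h1
  obtain ⟨t, ht⟩ := exists_glue (fun x => V ⊓ (hi x).range) V (fun _ => inf_le_left)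
    (fun x hxV => ⟨x, hxV, hx x⟩) s fun x y => hX.sec_ext fun A f hf => by
      rw [pull_res, pull_res, hs, hs]
  refine ⟨t, fun A f h => ?_⟩
  by_cases hA : Nontrivial A
  -- The morphism `f` lands in the chart around the image of the closed point, where `t` restricts
  -- to a section with known values.
  · let x := f.toHom.base (closedPt A)
    have hfx : ∀ q : MSpec A, f.toHom.base q ∈ V ⊓ (hi x).range :=
      forall_mem_of_closedPt f ⟨h _, hx x⟩
    rw [← pull_res (inf_le_left : V ⊓ (hi x).range ≤ V) f hfx, ht, hs]
  · have := not_nontrivial_iff_subsingleton.1 hA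
    exact Subsingleton.elim _ _

/-- A geometric scheme is determined by its functor of points. -/
theorem IsGeometric.spaceReal_isExact : (spaceReal X).IsExact where
  bijective := by
    constructor
    · intro f g h
      obtain ⟨B, i, hi, hx⟩ := hX.exists_chart (spacePt X f)
      -- Two morphisms from `Spec {0,1}` with the same image both factor through one chart, where
      -- they are characters with the same kernel.
      have hm : ∀ f' : specSpace monF1.{u} ⟶ X, spacePt X f' ∈ Set.range i.toHom.base →
          ∃ φ, specMap φ ≫ i = f' := fun f' h' =>
        hi.exists_specMap f' (forall_mem_of_closedPt (V := hi.range) f' h')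
      obtain ⟨φ, rfl⟩ := hm f hx
      obtain ⟨ψ, rfl⟩ := hm g ((show spacePt X _ = spacePt X g from h) ▸ hx)
      have e := hi.injective h
      have e' : (closedPt monF1).comap (CommMonZ.Hom.hom φ) =
        (closedPt monF1).comap (CommMonZ.Hom.hom ψ) := e
      rw [← chi_comap φ, e', chi_comap]
    · intro x
      obtain ⟨B, i, hi, p, rfl⟩ := hX.exists_chart x
      exact ⟨_, spacePt_chart i p⟩
  isOpen W hW := by
    refine isOpen_iff_forall_mem_open.2 fun x hx => ?_
    obtain ⟨B, i, hi, p, rfl⟩ := hX.exists_chart x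
    -- The hypothesis on `W` is applied to the chart itself, regarded as a `B`-valued element; the
    -- chart is an open map.
    have h1 : IsOpen {p : MSpec B | i.toHom.base p ∈ W} := by
      convert hW B i using 1
      ext q
      change _ ↔ spacePt X _ ∈ W
      rw [spacePt_map]
      rfl
    refine ⟨_, ?_, hi.base_open.isOpenMap _ h1, ⟨p, hx, rfl⟩⟩
    rintro _ ⟨q, hq, rfl⟩
    exact hq
  ev_bijective V := by
    refine ⟨fun s t h => hX.sec_ext fun A f hf => ?_, fun ν => ?_⟩
    · exact congrArg (fun r => Sections.on (U := spacePoints.obj X) r f (mem_land_spacePt.2 hf)) h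
    · obtain ⟨s, hs⟩ := hX.exists_sec (V := V)
        (fun {A} f h => Sections.on (U := spacePoints.obj X) ν f (mem_land_spacePt.2 h))
        (fun f ρ h h' => (ν.map_on (U := spacePoints.obj X) ρ f _).symm)
      exact ⟨s, Sections.ext_on fun A f h => hs A f (mem_land_spacePt.1 h)⟩

omit hX

/-- Morphisms from a geometric scheme are determined by their effect on functors of points. -/
lemma IsGeometric.spacePoints_injective (hX : IsGeometric X) {f g : X ⟶ Y}
    (h : spacePoints.map f = spacePoints.map g) : f = g :=
  (compat_spaceReal f).unique hX.spaceReal_isExact (h ▸ compat_spaceReal g)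

/-- A transformation of the functors of points comes from a morphism. -/
lemma IsGeometric.exists_map_eq (hX : IsGeometric X)
    (θ : spacePoints.obj X ⟶ spacePoints.obj Y) : ∃ f : X ⟶ Y, spacePoints.map f = θ := by
  obtain ⟨f, hf⟩ := Realization.exists_compat hX.spaceReal_isExact (spaceReal Y) θ
  refine ⟨f, ?_⟩
  ext A g
  refine (?_ : (show specSpace A ⟶ X from g) ≫ f = (show specSpace A ⟶ Y from θ.app A g))
  -- Both morphisms `Spec A → Y` are compatible with the transformation attached to the element
  -- `θ(g)`.
  refine ((compat_ofSpec _).comp hf).unique (specReal_isExact A) ?_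
  have : ofSpec (show specSpace A ⟶ X from g) ≫ θ = ofSpec (θ.app A g) :=
    ofElem_comp _ θ
  rw [this]
  exact compat_ofSpec _

end Geometric

end FOne

namespace FOne

open AlgebraicGeometry MonoidalSpace

/-! ## A criterion for open immersions -/

section Criterion

variable {Y : MonoidalSpace.{u}} {G : CommMonZ.{u} ⥤ Type u}

/-- The element `u` of `G(B)` identifies `Hom(B, -)` with the subfunctor `S` of `G`. -/
structure Represents {B : CommMonZ.{u}} (u : G.obj B) (S : Subfunctor G) : Prop where
  mem : u ∈ S.obj B
  injective : ∀ {A : CommMonZ.{u}} {φ ψ : B ⟶ A}, G.map φ u = G.map ψ u → φ = ψ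
  surjective : ∀ {A : CommMonZ.{u}} {g : G.obj A}, g ∈ S.obj A → ∃ φ : B ⟶ A, G.map φ u = g

lemma Represents.nonempty_iso {B : CommMonZ.{u}} {u : G.obj B} {S : Subfunctor G}
    (h : Represents u S) : Nonempty (S.toFunctor ≅ affineFunctor B) := by
  let θ : affineFunctor B ⟶ S.toFunctor :=
    ofElem (G := S.toFunctor) (⟨u, h.mem⟩ : S.toFunctor.obj B)
  have : ∀ A, IsIso (θ.app A) := fun A => by
    rw [isIso_iff_bijective]
    refine ⟨fun φ ψ e => h.injective (congrArg Subtype.val e), fun g => ?_⟩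
    obtain ⟨φ, hφ⟩ := h.surjective g.2
    exact ⟨φ, Subtype.ext hφ⟩
  have : IsIso θ := NatIso.isIso_of_isIso_app θ
  exact ⟨(asIso θ).symm⟩

/-- The Yoneda lemma: the universal element is the image of the identity of `B`. -/
lemma represents_of_iso {B : CommMonZ.{u}} {S : Subfunctor G} (e : S.toFunctor ≅ affineFunctor B) :
    Represents (e.inv.app B (𝟙 B)).1 S where
  mem := (e.inv.app B (𝟙 B)).2
  injective {A φ ψ} h := by
    have h1 : ∀ ρ : B ⟶ A, e.hom.app A (S.toFunctor.map ρ (e.inv.app B (𝟙 B))) = ρ := fun ρ => by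
      have h2 : S.toFunctor.map ρ (e.inv.app B (𝟙 B)) = e.inv.app A (𝟙 B ≫ ρ) :=
        (NatTrans.naturality_apply e.inv ρ (𝟙 B)).symm
      rw [h2, Category.id_comp]
      exact congrArg (fun k => k.app A ρ) e.inv_hom_id
    rw [← h1 φ, ← h1 ψ]
    exact congrArg _ (Subtype.ext h)
  surjective {A g} hg := by
    refine ⟨e.hom.app A ⟨g, hg⟩, ?_⟩
    have h2 : e.inv.app A (𝟙 B ≫ (e.hom.app A ⟨g, hg⟩ : B ⟶ A)) = S.toFunctor.map _ _ :=
      NatTrans.naturality_apply e.inv (e.hom.app A ⟨g, hg⟩ : B ⟶ A) (𝟙 B)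
    rw [Category.id_comp] at h2
    refine (congrArg Subtype.val h2).symm.trans ?_
    exact congrArg (fun k => (k.app A ⟨g, hg⟩).1) e.hom_inv_id

variable {R : Realization Y G} (hR : R.IsExact) {B : CommMonZ.{u}} {u : G.obj B}
  {W : Opens Y.carrier} (hu : Represents u (land G (R.pt ⁻¹' (W : Set Y.carrier))))
  {f : specSpace B ⟶ Y} (hf : Realization.Compat (specReal B) R (ofElem (G := G) u) f)
include hR hu hf

omit hR hu in
lemma Realization.Compat.base_eq (p : MSpec B) :
    f.toHom.base p = R.pt (G.map (chi p) u) := by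
  have h : affPt B (chi p) = p := comap_chi p
  exact (congrArg f.toHom.base h).symm.trans (hf.pt (chi p))

omit hR hu in
lemma Realization.Compat.pt_map {A : CommMonZ.{u}} (φ : B ⟶ A) (q : MSpec A) :
    R.pt (G.map (chi q) (G.map φ u)) = f.toHom.base (q.comap (CommMonZ.Hom.hom φ)) := by
  rw [map_chi_map, hf.base_eq]

/-- If two primes have the same image, their characters send `u` to the same point of `G`, so the
characters agree. -/
lemma Represents.base_injective : Function.Injective f.toHom.base := by
  intro p q h
  have h' : R.pt (G.map (chi (A := B) p) u) = R.pt (G.map (chi (A := B) q) u) :=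
    (hf.base_eq p).symm.trans (h.trans (hf.base_eq q))
  have e : chi (A := B) p = chi q := hu.injective (hR.bijective.1 h')
  exact (comap_chi (A := B) p).symm.trans ((congrArg (fun φ =>
    (closedPt monF1).comap (CommMonZ.Hom.hom φ)) e).trans (comap_chi (A := B) q))

lemma Represents.range_base : Set.range f.toHom.base = W := by
  ext y
  constructor
  · rintro ⟨p, rfl⟩
    have := hu.mem p
    rw [Set.mem_preimage] at this
    exact (congrArg (· ∈ W) (hf.base_eq p)).mpr this
  · intro hy
    obtain ⟨x, rfl⟩ := hR.bijective.2 y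
    obtain ⟨φ, rfl⟩ := hu.surjective (mem_land_monF1.2 hy)
    refine ⟨(closedPt monF1).comap (CommMonZ.Hom.hom φ), (hf.base_eq _).trans ?_⟩
    rw [chi_comap]

/-- Openness of the image of `U` is tested along an element `g` of `G(A)`, near a prime `p`. On some
`basicOpen h` around `p` the points of `g` lie in `W`, so `g` becomes over `A_h` the image of `u`
under a homomorphism `φ : B → A_h`. There the set in question contains the inverse image of `U`
under `φ`, an open subset of `Spec A_h`, and this has to be transported back to `Spec A`. -/
lemma Represents.isOpenMap : IsOpenMap f.toHom.base := by
  intro U hU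
  refine hR.isOpen _ fun A g => isOpen_iff_forall_mem_open.2 fun p hp => ?_
  have hp' := hp
  obtain ⟨b, hb, hbp⟩ := hp'
  have hpW : R.pt (G.map (chi p) g) ∈ W := by
    have := Represents.range_base hR hu hf
    have h : R.pt (G.map (chi p) g) ∈ Set.range f.toHom.base := ⟨b, hbp⟩
    rwa [this] at h
  obtain ⟨h, hh, hD⟩ := exists_basicOpen_le
    ⟨_, W.2.preimage (R.continuous g)⟩ (show p ∈ _ from hpW)
  have hg : G.map (locAway h) g ∈ (land G (R.pt ⁻¹' (W : Set Y.carrier))).obj _ := fun q => by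
    rw [map_chi_map]
    exact hD _ (comap_locAway_notMem h q)
  obtain ⟨φ, hφ⟩ := hu.surjective hg
  -- The prime of `A_h` that lies over `r`, obtained by extending the character of `r` to `A_h`.
  let q : ∀ r : MSpec A, h ∉ r.carrier → MSpec (locObj (Submonoid.powers h)) := fun r hr =>
    (closedPt monF1).comap (CommMonZ.Hom.hom (locLift (chi r) (isUnit_powers (chi_isUnit_iff.2 hr))))
  have hq : ∀ r hr, locAway h ≫ chi (q r hr) = chi r := fun r hr => by
    rw [chi_comap, chi_eq_locAway_comp hr]
  have hq2 : ∀ r hr, R.pt (G.map (chi r) g) = f.toHom.base ((q r hr).comap (CommMonZ.Hom.hom φ)) := by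
    intro r hr
    rw [← hf.pt_map, hφ, ← hq r hr, G.map_comp]
    rfl
  have hqm : ∀ r hr (a : A), CommMonZ.Hom.hom (locAway h) a ∉ (q r hr).carrier ↔ a ∉ r.carrier := by
    intro r hr a
    rw [← chi_eq_one_iff, ← chi_eq_one_iff, ← hq r hr]
    rfl
  have hinj := Represents.base_injective hR hu hf
  have hpU : q p hh ∈ (⟨_, hU.preimage (MSpec.continuous_comap (CommMonZ.Hom.hom φ))⟩ :
      Opens (MSpec (locObj (Submonoid.powers h)))) := by
    have e := hinj (hbp.trans (hq2 p hh))
    change (q p hh).comap (CommMonZ.Hom.hom φ) ∈ U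
    rwa [← e]
  obtain ⟨t, ht, hDt⟩ := exists_basicOpen_le _ hpU
  obtain ⟨a, n, han⟩ := exists_locAway_frac h t
  -- With `t = a / h ^ n`, the basic open set of `t` in `Spec A_h` corresponds to the intersection
  -- of the basic open sets of `h` and `a` in `Spec A`.
  have htl : ∀ r hr, t ∉ (q r hr).carrier ↔ a ∉ r.carrier := by
    intro r hr
    rw [← hqm r hr a, ← han]
    refine ⟨fun h1 => (q r hr).mul_notMem h1 ?_, fun h1 h2 => h1 ((q r hr).mul_mem _ h2)⟩
    intro h2
    refine MSpec.not_isUnit h2 ?_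
    rw [map_pow]
    exact (locAway_isUnit h).pow n
  refine ⟨(basicOpen h ⊓ basicOpen a : Opens (MSpec A)), ?_, (basicOpen h ⊓ basicOpen a).2,
    hh, (htl p hh).1 ht⟩
  rintro r ⟨hr, ha⟩
  exact ⟨_, hDt _ ((htl r hr).2 ha), (hq2 r hr).symm⟩

/-- A morphism from the spectrum of `B` to a realization of `G` is an open immersion if it
identifies `Hom(B, -)` with an open subfunctor of `G`. -/
theorem Represents.isOpenImm : IsOpenImm f := by
  have hr := Represents.range_base hR hu hf
  refine isOpenImm_of_bijective (.of_continuous_injective_isOpenMap f.toHom.base.hom.continuous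
    (Represents.base_injective hR hu hf) (Represents.isOpenMap hR hu hf)) fun V hV => ?_
  -- As `V` lies in the image of `f`, the elements of `G` over `V` are exactly the images of `u`
  -- under the homomorphisms that send spectra into `preim f V`. So sections over `V` and over
  -- `preim f V` are the same natural families.
  have hW : ∀ {A : CommMonZ.{u}} {g : G.obj A},
      g ∈ (land G (R.pt ⁻¹' (V : Set Y.carrier))).obj A → ∃ φ : B ⟶ A, G.map φ u = g :=
    fun {A g} hg => hu.surjective fun p => by
      have := hV _ (hg p)
      rwa [hr] at this
  have hev : ∀ (s : Y.Sec V) {A : CommMonZ.{u}} (φ : B ⟶ A) (h1) (h2),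
      secEval (U := preim f V) (pb f V s) φ h1 = (R.ev V s).on (G.map φ u) h2 :=
    fun s A φ h1 h2 => hf.ev V s A φ (mem_land_affPt.2 h1) h2
  have hm : ∀ {A : CommMonZ.{u}} {φ : B ⟶ A}, (∀ q : MSpec A, q.comap (CommMonZ.Hom.hom φ) ∈
      preim f V) ↔ G.map φ u ∈ (land G (R.pt ⁻¹' (V : Set Y.carrier))).obj A := fun {A φ} => by
    refine forall_congr' fun q => ?_
    rw [Set.mem_preimage, hf.pt_map]
    rfl
  constructor
  · intro s t h
    refine (hR.ev_bijective V).1 (Sections.ext_on fun A g hg => ?_)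
    obtain ⟨φ, rfl⟩ := hW hg
    rw [← hev s φ (hm.2 hg), ← hev t φ (hm.2 hg), h]
  · intro σ
    choose φ hφ using fun {A : CommMonZ.{u}} {g : G.obj A} => hW (A := A) (g := g)
    have hm' : ∀ {A : CommMonZ.{u}} {g : G.obj A}
        (hg : g ∈ (land G (R.pt ⁻¹' (V : Set Y.carrier))).obj A) (q : MSpec A),
        q.comap (CommMonZ.Hom.hom (φ hg)) ∈ preim f V := fun {A g} hg =>
      hm.2 (by rw [hφ]; exact hg)
    obtain ⟨s, hs⟩ := (hR.ev_bijective V).2 (Sections.mkOn _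
      (fun {A} g hg => secEval (U := preim f V) σ (φ hg) (hm' hg)) fun {A C} ρ g hg => by
        -- The chosen homomorphisms are natural in `g`, because the one that produces `g` from `u`
        -- is unique.
        have e : φ ((land G _).map ρ hg) = φ hg ≫ ρ := by
          refine hu.injective ?_
          rw [hφ, G.map_comp]
          exact congrArg (G.map ρ) (hφ hg).symm
        exact (secEval_congr (U := preim f V) σ e _).trans
          (secEval_comp (U := preim f V) σ (φ hg) ρ (hm' hg) _))
    refine ⟨s, sec_ext (U := preim f V) fun A ψ hψ => ?_⟩
    refine (hev s ψ hψ (hm.1 hψ)).trans ?_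
    rw [hs]
    exact secEval_congr (U := preim f V) σ (hu.injective (hφ (hm.1 hψ))) (hm' (hm.1 hψ))

end Criterion

/-! ## Charts -/

section Charts

variable {X : MonoidalSpace.{u}}

/-- The localization `B_h` represents the homomorphisms that make `h` a unit. These are the elements
of `Hom(B, -)` whose points lie in `basicOpen h`, so the criterion applies. -/
lemma range_specMap_locAway {B : CommMonZ.{u}} (h : B) :
    IsOpenImm (specMap (locAway h)) ∧
      Set.range (specMap (locAway h)).toHom.base = {p : MSpec B | h ∉ p.carrier} := by
  have hu : Represents (G := affineFunctor B) (locAway h) (land (affineFunctor B)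
      ((specReal B).pt ⁻¹' ((basicOpen h : Opens (MSpec B)) : Set (MSpec B)))) :=
    { mem := mem_land_affPt.2 fun q => comap_locAway_notMem h q
      injective := fun e => locObj_hom_ext e
      surjective := fun {A g} hg => by
        have hg' := mem_land_affPt.1 hg
        have : IsUnit (CommMonZ.Hom.hom (show B ⟶ A from g) h) :=
          isUnit_of_forall_notMem fun q => hg' q
        exact ⟨locLift g (isUnit_powers this), locHom_locLift _ _⟩ }
  exact ⟨hu.isOpenImm (specReal_isExact B) (compat_specMap (locAway h)),
    hu.range_base (specReal_isExact B) (compat_specMap (locAway h))⟩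

lemma IsOpenImm.represents {B : CommMonZ.{u}} {i : specSpace B ⟶ X} (hi : IsOpenImm i) :
    Represents (G := spacePoints.obj X) i
      (land (spacePoints.obj X) (spacePt X ⁻¹' (hi.range : Set X.carrier))) where
  mem := mem_land_spacePt.2 fun q => ⟨q, rfl⟩
  injective h := hi.specMap_injective h
  surjective hg := hi.exists_specMap _ (mem_land_spacePt.1 hg)

/-- The monoid in which `0 = 1`. -/
abbrev monTrivial : CommMonZ.{u} := CommMonZ.of PUnit.{u + 1}

lemma not_nontrivial_monTrivial : ¬ Nontrivial monTrivial.{u} :=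
  fun _ => not_subsingleton PUnit.{u + 1} inferInstance

/-- An open cover has to be non-empty even if `X` has no points. The empty spectrum always supplies
a member. -/
lemma exists_isOpenImm_monTrivial (X : MonoidalSpace.{u}) :
    ∃ i : specSpace monTrivial.{u} ⟶ X, IsOpenImm i := by
  obtain ⟨h⟩ := unique_of_trivial _ not_nontrivial_monTrivial X
  have := isEmpty_mspec _ not_nontrivial_monTrivial
  have hE : IsEmpty (specSpace monTrivial.{u}).carrier := this
  refine ⟨h.default, isOpenImm_of_bijective (.of_continuous_injective_isOpenMap
    h.default.toHom.base.hom.continuous (fun p => isEmptyElim p) fun U _ => ?_) fun V hV => ?_⟩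
  · rw [Set.eq_empty_of_isEmpty U, Set.image_empty]
    exact isOpen_empty
  -- The set `V` has no points, so it is covered by the empty family and any two sections on it
  -- agree.
  · have hV' : ∀ x ∈ V, ∃ i : PEmpty.{1}, x ∈ (fun _ => ⊥ : PEmpty → Opens X.carrier) i :=
      fun x hx => by
        obtain ⟨p, _⟩ := hV x hx
        exact isEmptyElim p
    refine ⟨fun s t _ => eq_of_locally_eq _ V (fun _ => bot_le) hV' fun i => i.elim,
      fun σ => ⟨1, (subsingleton_sec _ not_nontrivial_monTrivial _).elim _ _⟩⟩

/-- The functor of points of a geometric scheme is a scheme. -/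
theorem IsGeometric.isMScheme (hX : IsGeometric X) : IsMScheme (spacePoints.obj X) := by
  refine ⟨{S | ∃ (B : CommMonZ.{u}) (i : specSpace B ⟶ X) (hi : IsOpenImm i),
    S = land (spacePoints.obj X) (spacePt X ⁻¹' (hi.range : Set X.carrier))}, ⟨?_, ?_, ?_⟩, ?_⟩
  · obtain ⟨i, hi⟩ := exists_isOpenImm_monTrivial X
    exact ⟨_, _, i, hi, rfl⟩
  · rintro _ ⟨B, i, hi, rfl⟩
    exact isOpenSubfunctor_land fun A g => hi.range.2.preimage ((spaceReal X).continuous g)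
  · intro H hH f
    -- A chart around the image of the closed point of `Spec H` contains the whole image.
    have := hH.1
    obtain ⟨B, i, hi, hx⟩ := hX.exists_chart
      ((show specSpace H ⟶ X from f).toHom.base (closedPt H))
    exact ⟨_, ⟨B, i, hi, rfl⟩, mem_land_spacePt.2
      (forall_mem_of_closedPt (V := hi.range) (show specSpace H ⟶ X from f) hx)⟩
  · rintro _ ⟨B, i, hi, rfl⟩
    exact ⟨B, hi.represents.nonempty_iso⟩

end Charts

end FOne

namespace FOne

open AlgebraicGeometry MonoidalSpace

/-! ## The space attached to a functor -/

section Shrink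

variable (M : Type (u + 1)) [CommMonoidWithZero M] [Small.{u} M]

/-- A small monoid with zero as an object of the category of monoids with zero. -/
noncomputable def shrinkMon : CommMonZ.{u} :=
  @CommMonZ.mk (Shrink.{u} M) (equivShrink M).symm.commMonoidWithZero

/-- The isomorphism between a small monoid with zero and the attached object. -/
noncomputable def unshrink : shrinkMon M →*₀ M where
  toFun := (equivShrink M).symm
  map_zero' := (equivShrink M).symm_apply_apply 0
  map_one' := (equivShrink M).symm_apply_apply 1
  map_mul' _ _ := (equivShrink M).symm_apply_apply _

lemma unshrink_bijective : Function.Bijective (unshrink M) := (equivShrink M).symm.bijective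

variable {M} {N : Type (u + 1)} [CommMonoidWithZero N] [Small.{u} N]

/-- Homomorphisms between small monoids with zero. -/
noncomputable def shrinkHom (f : M →*₀ N) : shrinkMon M ⟶ shrinkMon N :=
  CommMonZ.ofHom (A := shrinkMon M) (B := shrinkMon N)
    { toFun := fun a => equivShrink N (f (unshrink M a))
      map_zero' := by
        rw [map_zero, map_zero]
        rfl
      map_one' := by
        rw [map_one, map_one]
        rfl
      map_mul' := fun a b => (unshrink_bijective N).1 (by
        refine ((equivShrink N).symm_apply_apply _).trans (Eq.trans ?_
          (map_mul (unshrink N) (equivShrink N (f (unshrink M a)) : shrinkMon N)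
            (equivShrink N (f (unshrink M b)) : shrinkMon N)).symm)
        refine (congrArg f (map_mul (unshrink M) a b)).trans ((map_mul f _ _).trans ?_)
        exact (congrArg₂ (· * ·) ((equivShrink N).symm_apply_apply _)
          ((equivShrink N).symm_apply_apply _)).symm) }

lemma unshrink_shrinkHom (f : M →*₀ N) (a : shrinkMon M) :
    unshrink N (CommMonZ.Hom.hom (shrinkHom f) a) = f (unshrink M a) :=
  (equivShrink N).symm_apply_apply _

end Shrink

section FunctorSpace

variable (F : CommMonZ.{u} ⥤ Type u)

/-- The topology on the points of a functor. -/
instance pointTopology : TopologicalSpace (F.obj monF1.{u}) where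
  IsOpen W := ∀ (A : CommMonZ.{u}) (g : F.obj A), IsOpen {p : MSpec A | F.map (chi p) g ∈ W}
  isOpen_univ A g := isOpen_univ
  isOpen_inter U V hU hV A g := (hU A g).inter (hV A g)
  isOpen_sUnion S hS A g := by
    have : {p : MSpec A | F.map (chi p) g ∈ ⋃₀ S} =
        ⋃ W ∈ S, {p : MSpec A | F.map (chi p) g ∈ W} := by
      ext p
      simp only [Set.mem_iUnion]
      exact ⟨fun ⟨W, hW, h⟩ => ⟨W, hW, h⟩, fun ⟨W, hW, h⟩ => ⟨W, hW, h⟩⟩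
    rw [this]
    exact isOpen_biUnion fun W hW => hS W hW A g

/-- The space of the points of a functor. -/
abbrev FPoints : TopCat.{u} := TopCat.of (F.obj monF1.{u})

/-- The open subfunctor attached to an open set of points. -/
def openLand (W : Opens (FPoints F)) : Subfunctor F :=
  land F (W : Set (F.obj monF1.{u}))

variable {F} in
lemma openLand_mono {V W : Opens (FPoints F)} (h : V ≤ W) : openLand F V ≤ openLand F W :=
  fun _ _ hg p => h (hg p)

variable {F} in
lemma mem_openLand_of_closedPt {W : Opens (FPoints F)} {A : CommMonZ.{u}} [Nontrivial A]
    {g : F.obj A} (h : (F.map (chi (closedPt A)) g : FPoints F) ∈ W) : g ∈ (openLand F W).obj A :=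
  mem_land_of_closedPt (W.2 A g) h

/-- Functors for which the sections over all open sets of points form a small set. -/
class HasSmallSections : Prop where
  small : ∀ W, Small.{u} (Sections (openLand F W).toFunctor)

attribute [instance] HasSmallSections.small

variable {F} in
/-- Restriction as a homomorphism. -/
def restrictHom {V W : Subfunctor F} (h : V ≤ W) : Sections W.toFunctor →*₀ Sections V.toFunctor where
  toFun s := s.restrict h
  map_zero' := rfl
  map_one' := rfl
  map_mul' _ _ := rfl

variable [HasSmallSections F]

/-- The structure presheaf on the points of a functor. -/
noncomputable def functorPresheaf : TopCat.Presheaf CommMonZ.{u} (FPoints F) where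
  obj W := shrinkMon (Sections (openLand F W.unop).toFunctor)
  map i := shrinkHom (restrictHom (openLand_mono i.unop.le))
  map_id W := CommMonZ.hom_ext fun s =>
    (unshrink_bijective (Sections (openLand F W.unop).toFunctor)).1 (unshrink_shrinkHom _ s)
  map_comp {U V W} i j := CommMonZ.hom_ext fun s =>
    (unshrink_bijective (Sections (openLand F W.unop).toFunctor)).1 (by
      refine (unshrink_shrinkHom (N := Sections (openLand F W.unop).toFunctor) _ s).trans
        (Eq.symm ?_)
      refine (unshrink_shrinkHom (N := Sections (openLand F W.unop).toFunctor) _ _).trans ?_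
      exact congrArg (restrictHom (openLand_mono j.unop.le))
        (unshrink_shrinkHom (restrictHom (openLand_mono i.unop.le)) s))

/-- The value of a section at an element. -/
noncomputable def secVal {W : Opens (FPoints F)} (s : (functorPresheaf F).obj (op W))
    {A : CommMonZ.{u}} (g : F.obj A) (h : g ∈ (openLand F W).obj A) : A :=
  (unshrink (Sections (openLand F W).toFunctor) s).on g h

variable {F} in
lemma secVal_res {V W : Opens (FPoints F)} (h : V ≤ W)
    (s : (functorPresheaf F).obj (op W)) {A : CommMonZ.{u}} (g : F.obj A)
    (hg : g ∈ (openLand F V).obj A) :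
    secVal F (CommMonZ.Hom.hom ((functorPresheaf F).map (homOfLE h).op) s) g hg =
      secVal F s g (openLand_mono h A hg) :=
  congrArg (fun t => Sections.on t g hg) (unshrink_shrinkHom (restrictHom (openLand_mono h)) s)

variable {F} in
lemma secVal_ext {W : Opens (FPoints F)} {s t : (functorPresheaf F).obj (op W)}
    (h : ∀ (A : CommMonZ.{u}) (g : F.obj A) (hg : g ∈ (openLand F W).obj A),
      secVal F s g hg = secVal F t g hg) : s = t :=
  (unshrink_bijective _).1 (Sections.ext_on h)

variable {F} in
lemma secVal_map {W : Opens (FPoints F)} (s : (functorPresheaf F).obj (op W))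
    {A B : CommMonZ.{u}} (ρ : A ⟶ B) (g : F.obj A) (h : g ∈ (openLand F W).obj A) (h') :
    secVal F s (F.map ρ g) h' = CommMonZ.Hom.hom ρ (secVal F s g h) :=
  (Sections.map_on _ ρ g h).symm

variable {F} in
lemma exists_secVal_eq {W : Opens (FPoints F)}
    (v : ∀ {A : CommMonZ.{u}} (g : F.obj A), g ∈ (openLand F W).obj A → A)
    (hv : ∀ {A B : CommMonZ.{u}} (ρ : A ⟶ B) (g : F.obj A) (h) (h'),
      v (F.map ρ g) h' = CommMonZ.Hom.hom ρ (v g h)) :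
    ∃ s : (functorPresheaf F).obj (op W), ∀ (A : CommMonZ.{u}) (g : F.obj A) (h),
      secVal F s g h = v g h := by
  obtain ⟨s, hs⟩ := (unshrink_bijective _).2
    (Sections.mkOn (openLand F W) v fun ρ g hg => hv ρ g hg _)
  exact ⟨s, fun A g h => congrArg (fun t => Sections.on t g h) hs⟩

open Classical in
lemma functorPresheaf_isSheaf :
    TopCat.Presheaf.IsSheaf (functorPresheaf F ⋙ forget CommMonZ.{u}) := by
  refine (TopCat.Presheaf.isSheaf_iff_isSheafUniqueGluing_types _).2 fun ι U s hs => ?_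
  have hs' : ∀ (i j : ι) (A : CommMonZ.{u}) (g : F.obj A) (hi : g ∈ (openLand F (U i)).obj A)
      (hj : g ∈ (openLand F (U j)).obj A), secVal F (s i) g hi = secVal F (s j) g hj :=
    fun i j A g hi hj => by
      have h : g ∈ (openLand F (U i ⊓ U j)).obj A := fun p => ⟨hi p, hj p⟩
      have e := congrArg (fun t => secVal F t g h) (hs i j)
      exact (secVal_res inf_le_left (s i) g h).symm.trans
        (e.trans (secVal_res inf_le_right (s j) g h))
  have hex : ∀ {A : CommMonZ.{u}} (_ : Nontrivial A) (g : F.obj A),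
      g ∈ (openLand F (iSup U)).obj A → ∃ i, g ∈ (openLand F (U i)).obj A := fun {A} hA g h => by
    obtain ⟨i, hi⟩ := Opens.mem_iSup.1 (h (closedPt A))
    exact ⟨i, mem_openLand_of_closedPt hi⟩
  choose k hk using @hex
  obtain ⟨t, ht⟩ := exists_secVal_eq (F := F) (W := iSup U)
    (fun {A} g h => if hA : Nontrivial A then secVal F (s (k hA g h)) g (hk hA g h) else 0)
    fun {A B} ρ g h h' => by
      by_cases hB : Nontrivial B
      · have hA : Nontrivial A := by
          by_contra hA
          have := not_nontrivial_iff_subsingleton.1 hA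
          exact zero_ne_one (α := B) (by
            rw [← map_zero (CommMonZ.Hom.hom ρ), Subsingleton.elim (0 : A) 1, map_one])
        rw [dif_pos hA, dif_pos hB, ← secVal_map (s (k hA g h)) ρ g (hk hA g h)
          ((openLand F _).map ρ (hk hA g h))]
        exact hs' _ _ _ _ _ _
      · have := not_nontrivial_iff_subsingleton.1 hB
        exact Subsingleton.elim _ _
  have htk : ∀ (i : ι) (A : CommMonZ.{u}) (g : F.obj A) (hi : g ∈ (openLand F (U i)).obj A) (h),
      secVal F t g h = secVal F (s i) g hi := fun i A g hi h => by
    by_cases hA : Nontrivial A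
    · rw [ht, dif_pos hA]
      exact hs' _ _ _ _ _ _
    · have := not_nontrivial_iff_subsingleton.1 hA
      exact Subsingleton.elim _ _
  refine ⟨t, fun i => secVal_ext fun A g hg => ?_, fun t' ht' => secVal_ext fun A g hg => ?_⟩
  · exact (secVal_res (le_iSup U i) t g hg).trans (htk i A g hg _)
  · by_cases hA : Nontrivial A
    · have hi := hk hA g hg
      refine Eq.trans ?_ (htk _ A g hi hg).symm
      refine (secVal_res (le_iSup U _) t' g hi).symm.trans ?_
      exact congrArg (fun t => secVal F t g hi) (ht' _)
    · have := not_nontrivial_iff_subsingleton.1 hA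
      exact Subsingleton.elim _ _

/-- The monoidal space attached to a functor. -/
noncomputable def functorSpace : MonoidalSpace.{u} where
  carrier := FPoints F
  presheaf := functorPresheaf F
  isSheaf := functorPresheaf_isSheaf F

/-- The space attached to a functor realizes it. -/
noncomputable def functorReal : Realization (functorSpace F) F where
  pt x := x
  continuous {A} g := continuous_def.2 fun W hW => hW A g
  ev (V : Opens (FPoints F)) := unshrink (Sections (openLand F V).toFunctor)
  ev_res {V W : Opens (FPoints F)} i s A g h := secVal_res i s g h
  isUnit_germ x (V : Opens (FPoints F)) hx s h := by
    obtain ⟨V', i, hV', hx', t, ht⟩ := exists_restrict_isUnit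
      (isOpenSubfunctor_land (G := F) (V := V) V.2)
      (unshrink (Sections (openLand F V).toFunctor) s)
    -- The unit locus of `s` is itself an open set of points, on which `s` has an inverse.
    let W : Opens (FPoints F) := ⟨V', hV'⟩
    have hW : W ≤ V := fun y hy => by
      exact mem_land_monF1.1 (i _ (mem_land_monF1.2 hy))
    obtain ⟨t', ht'⟩ := (unshrink_bijective (Sections (openLand F W).toFunctor)).2 t
    refine isUnit_germAt (X := functorSpace F) hx (W := W) ((hx' x).2 ⟨_, h⟩) hW (t := t') ?_
    refine (unshrink_bijective (Sections (openLand F W).toFunctor)).1 ?_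
    refine Eq.trans ?_ (map_one (unshrink (Sections (openLand F W).toFunctor))).symm
    refine (map_mul (unshrink (Sections (openLand F W).toFunctor)) _ t').trans ?_
    refine (congrArg₂ (· * ·) (unshrink_shrinkHom (restrictHom (openLand_mono hW)) s) ht').trans ht

lemma functorReal_isExact : (functorReal F).IsExact where
  bijective := Function.bijective_id
  isOpen _ hW := hW
  ev_bijective (V : Opens (FPoints F)) := unshrink_bijective (Sections (openLand F V).toFunctor)

end FunctorSpace

/-! ## Schemes as functors are functors of points -/

section MScheme

variable {F : CommMonZ.{u} ⥤ Type u}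

/-- The open set of points attached to an open subfunctor. -/
def IsOpenSubfunctor.opens {S : Subfunctor F} (hS : IsOpenSubfunctor S) :
    Opens (FPoints F) :=
  ⟨(S.obj monF1 : Set (F.obj monF1)), fun _ g => hS.isOpen g⟩

lemma IsOpenSubfunctor.openLand_opens {S : Subfunctor F} (hS : IsOpenSubfunctor S) :
    openLand F hS.opens = S := by
  ext A g
  exact (hS.mem_iff g).symm

/-- The monoid `{0,1}` is a group with zero, so a cover reaches every point of `F`. -/
lemma IsMScheme.exists_represents (hF : IsMScheme F) (x : FPoints F) :
    ∃ (W : Opens (FPoints F)) (B : CommMonZ.{u}) (u : F.obj B),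
      x ∈ W ∧ Represents u (openLand F W) := by
  obtain ⟨𝒰, ⟨_, h𝒰, hc⟩, ha⟩ := hF
  obtain ⟨S, hS, hx⟩ := hc monF1 isGroupZ_monF1 x
  obtain ⟨B, ⟨e⟩⟩ := ha S hS
  refine ⟨(h𝒰 S hS).opens, B, (e.inv.app B (𝟙 B)).1, hx, ?_⟩
  rw [(h𝒰 S hS).openLand_opens]
  exact represents_of_iso e

/-- The functor has exactly one value on a trivial monoid. -/
lemma IsMScheme.unique_of_trivial (hF : IsMScheme F) {A : CommMonZ.{u}} (hA : ¬ Nontrivial A) :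
    Nonempty (Unique (F.obj A)) := by
  obtain ⟨𝒰, ⟨⟨S, hS⟩, h𝒰, hc⟩, ha⟩ := hF
  obtain ⟨B, ⟨e⟩⟩ := ha S hS
  have hu := represents_of_iso e
  have := not_nontrivial_iff_subsingleton.1 hA
  let z : B ⟶ A := CommMonZ.ofHom (A := B) (B := A)
    { toFun := fun _ => 0
      map_zero' := rfl
      map_one' := Subsingleton.elim _ _
      map_mul' := fun _ _ => Subsingleton.elim _ _ }
  refine ⟨⟨⟨F.map z (e.inv.app B (𝟙 B)).1⟩, fun g => ?_⟩⟩
  -- A trivial monoid has no prime ideals, so every element over it lies in every open subfunctor,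
  -- and hence in an affine one.
  obtain ⟨φ, rfl⟩ := hu.surjective
    (((h𝒰 S hS).mem_iff g).2 fun p => (hA p.nontrivial).elim)
  rw [show φ = z from CommMonZ.hom_ext fun a => Subsingleton.elim (α := A) _ _]
  rfl

/-- In an affine neighbourhood given by `u` in `F(B)`, the point `x` is a prime `q` of `B`, and `O`
is `B_q` with the image of `u`. An element `g'` whose closed point goes to `x` comes from some `φ :
B → A` with `φ⁻¹` of the closed point equal to `q`, and such a `φ` extends to `B_q`. -/
lemma IsMScheme.exists_local (hF : IsMScheme F) (x : FPoints F) :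
    ∃ (O : CommMonZ.{u}) (_ : Nontrivial O) (g : F.obj O), F.map (chi (closedPt O)) g = x ∧
      ∀ (A : CommMonZ.{u}) [Nontrivial A] (g' : F.obj A), F.map (chi (closedPt A)) g' = x →
        ∃ φ : O ⟶ A, F.map φ g = g' := by
  obtain ⟨W, B, u, hx, hu⟩ := hF.exists_represents x
  obtain ⟨ψ, hψ⟩ := hu.surjective (mem_land_monF1.2 hx)
  let q : MSpec B := (closedPt monF1).comap (CommMonZ.Hom.hom ψ)
  refine ⟨locObj q.compl, inferInstance, F.map (locP q) u, ?_, fun A _ g' hg' => ?_⟩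
  · rw [map_chi_map, comap_locP_closedPt, chi_comap, hψ]
  · subst hg'
    obtain ⟨φ, rfl⟩ := hu.surjective (mem_openLand_of_closedPt hx)
    have hq : (closedPt A).comap (CommMonZ.Hom.hom φ) = q := by
      rw [map_chi_map] at hψ
      have : ψ = chi _ := hu.injective hψ
      change _ = (closedPt monF1).comap (CommMonZ.Hom.hom ψ)
      rw [this, comap_chi]
    have hu' : ∀ f : q.compl, IsUnit (CommMonZ.Hom.hom φ f) := fun f => by
      have h1 : f.1 ∉ ((closedPt A).comap (CommMonZ.Hom.hom φ)).carrier := by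
        rw [hq]
        exact f.2
      exact not_not.1 h1
    refine ⟨locLift φ hu', ?_⟩
    have := locHom_locLift φ hu'
    conv_rhs => rw [← this, F.map_comp]
    rfl

/-- Every element over a non-trivial monoid is an image of one of the local elements of
`exists_local`. So a section is determined by its values at these, of which there is one for each
point of `W`. -/
lemma IsMScheme.hasSmallSections (hF : IsMScheme F) : HasSmallSections F where
  small W := by
    choose O hO g hg hgu using hF.exists_local
    have hm : ∀ x : W, g x.1 ∈ (openLand F W).obj (O x.1) := fun x =>
      mem_openLand_of_closedPt ((hg x.1).symm ▸ x.2)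
    refine small_of_injective (β := ∀ x : W, O x.1)
      (f := fun s x => Sections.on s (g x.1) (hm x)) fun s t h => ?_
    refine Sections.ext_on fun A g' hg' => ?_
    by_cases hA : Nontrivial A
    · obtain ⟨φ, hφ⟩ := hgu _ A g' rfl
      have hx := hm ⟨_, hg' (closedPt A)⟩
      have e := congrArg (CommMonZ.Hom.hom φ) (congrFun h ⟨_, hg' (closedPt A)⟩)
      refine (Sections.on_congr s hφ.symm hg').trans (Eq.trans ?_
        (Sections.on_congr t hφ.symm hg').symm)
      exact (Sections.map_on s φ _ hx).symm.trans (e.trans (Sections.map_on t φ _ hx))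
    · have := not_nontrivial_iff_subsingleton.1 hA
      exact Subsingleton.elim _ _

variable [HasSmallSections F]

lemma Represents.exists_isOpenImm {B : CommMonZ.{u}} {u : F.obj B}
    {W : Opens (FPoints F)} (hu : Represents u (openLand F W)) :
    ∃ i : specSpace B ⟶ functorSpace F, IsOpenImm i ∧ Set.range i.toHom.base = (W : Set (FPoints F)) ∧
      Realization.Compat (specReal B) (functorReal F) (ofElem (G := F) u) i := by
  obtain ⟨i, hi⟩ := Realization.exists_compat (specReal_isExact B) (functorReal F)
    (ofElem (G := F) u)
  exact ⟨i, Represents.isOpenImm (R := functorReal F) (functorReal_isExact F) hu hi,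
    Represents.range_base (R := functorReal F) (functorReal_isExact F) hu hi, hi⟩

theorem IsMScheme.isGeometric (hF : IsMScheme F) : IsGeometric (functorSpace F) :=
  isGeometric_of_charts fun x => by
    obtain ⟨W, B, u, hx, hu⟩ := hF.exists_represents x
    obtain ⟨i, hi, hr, _⟩ := hu.exists_isOpenImm
    refine ⟨B, i, hi, ?_⟩
    rw [hr]
    exact hx

variable (F) in
-- An element `g` of `F(A)` is a transformation `Hom(A, -) → F`, which the exact realization `Spec
-- A` turns into a morphism `Spec A → functorSpace F`. Uniqueness of compatible morphisms gives
-- naturality.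
lemma exists_toSpacePoints : ∃ θ : F ⟶ spacePoints.obj (functorSpace F),
    ∀ (A : CommMonZ.{u}) (g : F.obj A), Realization.Compat (specReal A) (functorReal F)
      (ofElem g) (show specSpace A ⟶ functorSpace F from θ.app A g) := by
  choose f hf using fun (A : CommMonZ.{u}) (g : F.obj A) =>
    Realization.exists_compat (specReal_isExact A) (functorReal F) (ofElem (G := F) g)
  refine ⟨{ app := fun A => ↾ fun g => (f A g : (spacePoints.obj (functorSpace F)).obj A)
            naturality := fun A B ρ => ?_ }, hf⟩
  ext g
  refine (hf B (F.map ρ g)).unique (specReal_isExact B) ?_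
  have h := (compat_specMap ρ).comp (hf A g)
  have e : ofElem (G := affineFunctor A) ρ ≫ ofElem g = ofElem (F.map ρ g) := ofElem_comp _ _
  rw [e] at h
  exact h

/-- A scheme over monoids with zero is the functor of points of a geometric scheme. -/
theorem IsMScheme.nonempty_iso (hF : IsMScheme F) :
    Nonempty (F ≅ spacePoints.obj (functorSpace F)) := by
  obtain ⟨θ, hθ⟩ := exists_toSpacePoints F
  -- On the affine piece with universal element `u` and chart `i`, the transformation `θ` is `φ ↦
  -- specMap φ ≫ i`, which is injective in `φ` and reaches every morphism into the chart.
  have key : ∀ (W : Opens (FPoints F)) (B : CommMonZ.{u}) (u : F.obj B)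
      (hu : Represents u (openLand F W)) (i : specSpace B ⟶ functorSpace F)
      (hi : Realization.Compat (specReal B) (functorReal F) (ofElem (G := F) u) i)
      (A : CommMonZ.{u}) (φ : B ⟶ A), (θ.app A (F.map φ u) : specSpace A ⟶ functorSpace F) =
        specMap φ ≫ i := fun W B u hu i hi A φ => by
    refine (hθ A _).unique (specReal_isExact A) ?_
    have h := (compat_specMap φ).comp hi
    have e : ofElem (G := affineFunctor B) φ ≫ ofElem u = ofElem (F.map φ u) := ofElem_comp _ _
    rwa [e] at h
  have : ∀ A, IsIso (θ.app A) := fun A => by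
    rw [isIso_iff_bijective]
    by_cases hA : Nontrivial A
    -- The point of `g` at the closed point of `A` can be read off from `θ(g)`. Hence elements with
    -- the same image under `θ` lie in a common affine piece.
    · have hcl : ∀ g : F.obj A, (θ.app A g : specSpace A ⟶ functorSpace F).toHom.base
          (closedPt A) = (F.map (chi (closedPt A)) g : F.obj monF1) := fun g =>
        (hθ A g).base_eq (closedPt A)
      constructor
      · intro g g' e
        obtain ⟨W, B, u, hx, hu⟩ := hF.exists_represents (F.map (chi (closedPt A)) g)
        obtain ⟨i, hi, hr, hc⟩ := hu.exists_isOpenImm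
        have hx' : (F.map (chi (closedPt A)) g' : FPoints F) ∈ W := by
          have h1 := (hcl g).symm.trans ((congrArg (fun f : specSpace A ⟶ functorSpace F =>
            f.toHom.base (closedPt A)) e).trans (hcl g'))
          exact (congrArg (fun y : FPoints F => y ∈ W) h1).mp hx
        obtain ⟨φ, rfl⟩ := hu.surjective (mem_openLand_of_closedPt hx)
        obtain ⟨ψ, rfl⟩ := hu.surjective (mem_openLand_of_closedPt hx')
        rw [hi.specMap_injective ((key W B u hu i hc A φ).symm.trans
          (e.trans (key W B u hu i hc A ψ)))]
      · intro f
        let f' : specSpace A ⟶ functorSpace F := f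
        obtain ⟨W, B, u, hx, hu⟩ := hF.exists_represents (f'.toHom.base (closedPt A))
        obtain ⟨i, hi, hr, hc⟩ := hu.exists_isOpenImm
        obtain ⟨φ, hφ⟩ := hi.exists_specMap f'
          (forall_mem_of_closedPt (V := hi.range) f' (Set.ext_iff.1 hr _ |>.2 hx))
        exact ⟨F.map φ u, (key W B u hu i hc A φ).trans hφ⟩
    · obtain ⟨h1⟩ := hF.unique_of_trivial hA
      obtain ⟨h2⟩ := FOne.unique_of_trivial A hA (functorSpace F)
      refine ⟨fun _ _ _ => Subsingleton.elim _ _, fun f => ⟨h1.default, ?_⟩⟩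
      exact (h2.uniq _).trans (h2.uniq f).symm
  have : IsIso θ := NatIso.isIso_of_isIso_app θ
  exact ⟨asIso θ⟩

end MScheme

end FOne

namespace FOne

open AlgebraicGeometry MonoidalSpace

/-! ## The spectra of the stalks -/

lemma isUnit_germAt_globalSec_iff {B : CommMonZ.{u}} {U : Opens (specSpace B).carrier}
    {p : MSpec B} (hp : p ∈ U) {b : B} :
    IsUnit ((specSpace B).germAt hp (globalSec b)) ↔ b ∉ p.carrier := by
  constructor
  · intro h hb
    exact (isUnit_mk_iff p b 1).1 (h.map (CommMonZ.Hom.hom (stalkToLoc B p))) hb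
  · exact fun h => isUnit_of_isUnit_stalkToLoc B p _ ((isUnit_mk_iff p b 1).2 h)

section Stalks

variable {X : MonoidalSpace.{u}}

/-- Two morphisms from a spectrum agree if they factor through all neighbourhoods of a point and
pull back sections in the same way. -/
lemma IsGeometric.hom_ext_of_pull (hX : IsGeometric X) {x : X.carrier} {A : CommMonZ.{u}}
    {f g : specSpace A ⟶ X}
    (hf : ∀ V : Opens X.carrier, x ∈ V → ∀ q : MSpec A, f.toHom.base q ∈ V)
    (hg : ∀ V : Opens X.carrier, x ∈ V → ∀ q : MSpec A, g.toHom.base q ∈ V)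
    (h : ∀ (V : Opens X.carrier) (hx : x ∈ V) (s : X.Sec V),
      pull f (hf V hx) s = pull g (hg V hx) s) : f = g := by
  obtain ⟨B, i, hi, hx⟩ := hX.exists_chart x
  obtain ⟨φ, rfl⟩ := hi.exists_specMap f (hf hi.range hx)
  obtain ⟨ψ, rfl⟩ := hi.exists_specMap g (hg hi.range hx)
  congr 2
  ext b
  obtain ⟨s, hs⟩ := (hi.bijective (V := hi.range) fun y hy => hy).2 (globalSec b)
  have := h hi.range hx s
  rw [← pull_specMap_comp i φ (hf hi.range hx) (hf hi.range hx),
    ← pull_specMap_comp i ψ (hg hi.range hx) (hg hi.range hx), hs] at this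
  exact (secEval_globalSec b φ _).symm.trans (this.trans (secEval_globalSec b ψ _))

/-- The canonical morphism from the spectrum of the stalk at a point. -/
structure IsFromStalk (x : X.carrier) (f : specSpace (stalk X.presheaf x) ⟶ X) : Prop where
  nontrivial : Nontrivial (stalk X.presheaf x)
  base_closedPt : f.toHom.base (closedPt (stalk X.presheaf x)) = x
  mem : ∀ {V : Opens X.carrier}, x ∈ V → ∀ q : MSpec (stalk X.presheaf x), f.toHom.base q ∈ V
  pull_eq : ∀ {V : Opens X.carrier} (hx : x ∈ V) (s : X.Sec V),
    pull f (mem hx) s = X.germAt hx s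

lemma IsOpenImm.exists_isFromStalk {B : CommMonZ.{u}} {i : specSpace B ⟶ X} (hi : IsOpenImm i)
    (p : MSpec B) : ∃ φ : B ⟶ stalk X.presheaf (i.toHom.base p),
      IsFromStalk (i.toHom.base p) (specMap φ ≫ i) := by
  have hb : Function.Bijective (CommMonZ.Hom.hom (stalkMap i.toHom p)) :=
    ⟨@stalkMap_injective _ _ i.toHom hi p, @stalkMap_surjective _ _ i.toHom hi p⟩
  let e := MulEquiv.ofBijective (CommMonZ.Hom.hom (stalkMap i.toHom p)) hb
  let γ : B →*₀ stalk (specSpace B).presheaf p :=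
    ((specSpace B).germAt (x := p) (U := ⊤) trivial).comp (globalSecHom ⊤)
  -- As `i` is an open immersion, the stalk of `X` at `i(p)` is the stalk of `Spec B` at `p`; `φ`
  -- sends an element of `B` to its germ.
  let φ : B ⟶ stalk X.presheaf (i.toHom.base p) := CommMonZ.ofHom
    { toFun b := e.symm (γ b)
      map_zero' := (congrArg e.symm (map_zero γ)).trans (map_zero e.symm)
      map_one' := (congrArg e.symm (map_one γ)).trans (map_one e.symm)
      map_mul' a b := (congrArg e.symm (map_mul γ a b)).trans (map_mul e.symm _ _) }
  have hφ : ∀ b, CommMonZ.Hom.hom (stalkMap i.toHom p) (CommMonZ.Hom.hom φ b) = γ b :=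
    fun b => e.apply_symm_apply (γ b)
  have hu : ∀ b, IsUnit (CommMonZ.Hom.hom φ b) ↔ b ∉ p.carrier := fun b => by
    rw [← isUnit_germAt_globalSec_iff (U := ⊤) (p := p) trivial]
    refine ⟨fun h => hφ b ▸ h.map (CommMonZ.Hom.hom (stalkMap i.toHom p)), fun h => ?_⟩
    exact isUnit_of_map_of_bijective hb ((hφ b).symm ▸ h)
  have hn : Nontrivial (stalk X.presheaf (i.toHom.base p)) := by
    by_contra hn
    have := not_nontrivial_iff_subsingleton.1 hn
    exact (hu 0).1 (by rw [Subsingleton.elim (CommMonZ.Hom.hom φ 0) 1]; exact isUnit_one) p.zero_mem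
  have hc : (closedPt _).comap (CommMonZ.Hom.hom φ) = p :=
    MSpec.ext (Set.ext fun b => (not_congr (hu b)).trans not_not)
  have hm : ∀ {V : Opens X.carrier}, i.toHom.base p ∈ V →
      ∀ q : MSpec (stalk X.presheaf (i.toHom.base p)), (specMap φ ≫ i).toHom.base q ∈ V :=
    fun {V} hV => forall_mem_of_closedPt (V := V) _
      (show i.toHom.base ((closedPt _).comap (CommMonZ.Hom.hom φ)) ∈ V from hc.symm ▸ hV)
  refine ⟨φ, hn, congrArg i.toHom.base hc, hm, fun {V} hx s => ?_⟩
  rw [← pull_specMap_comp i φ (hm hx) (hm hx)]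
  -- Both sides are compared after multiplication with the unit `φ(f)`, where `a / f` is a fraction
  -- that represents the section near `p`.
  obtain ⟨W, hpW, hWV, a, f, hf, hs⟩ := exists_frac (pb i V s) (p := p) hx
  have h1 := secEval_mul_eq (pb i V s) φ (hm hx) (a := a) (f := f) (by
    rintro q ⟨r, hr⟩
    refine hs q (MSpec.mem_of_subset W hpW ?_)
    have h2 : ((closedPt _).comap (CommMonZ.Hom.hom φ)).carrier = p.carrier :=
      congrArg MSpec.carrier hc
    rw [← hr, ← h2]
    exact fun b hb => r.subset_closedPt hb)
  refine ((hu f).2 hf).mul_right_cancel (h1.trans (hb.1 (Eq.symm ?_)))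
  rw [map_mul, hφ, hφ]
  have hW : (W : Opens (specSpace B).carrier) ≤ preim i V := hWV
  have hWt : (W : Opens (specSpace B).carrier) ≤ ⊤ := fun _ _ => trivial
  change (specSpace B).germAt (hW hpW) (pb i V s) * (specSpace B).germAt (hWt hpW) (globalSec f) =
    (specSpace B).germAt (hWt hpW) (globalSec a)
  refine (congrArg₂ (· * ·) (germAt_res hW hpW (pb i V s)) (germAt_res hWt hpW (globalSec f))).symm
    |>.trans (Eq.trans ?_ (germAt_res hWt hpW (globalSec a)))
  refine (map_mul ((specSpace B).germAt hpW) _ _).symm.trans ?_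
  refine congrArg _ (Subtype.ext (funext fun q => ?_))
  obtain ⟨h2, h3⟩ := hs ⟨q.1, hWV q.2⟩ q.2
  change (pb i V s).1 ⟨q.1, hWV q.2⟩ * Localization.mk f 1 = Localization.mk a 1
  refine (congrArg (· * Localization.mk f 1) h3).trans ((Localization.mk_mul _ _ _ _).trans ?_)
  exact Localization.mk_eq_mk_iff.2 (Localization.r_iff_exists.2 ⟨1, by simp [mul_comm]⟩)

lemma IsGeometric.exists_isFromStalk (hX : IsGeometric X) (x : X.carrier) :
    ∃ f, IsFromStalk x f := by
  obtain ⟨B, i, hi, p, rfl⟩ := hX.exists_chart x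
  obtain ⟨φ, h⟩ := hi.exists_isFromStalk p
  exact ⟨_, h⟩

/-- The canonical morphism from the spectrum of a stalk. -/
noncomputable def IsGeometric.fromStalk (hX : IsGeometric X) (x : X.carrier) :
    specSpace (stalk X.presheaf x) ⟶ X := (hX.exists_isFromStalk x).choose

lemma IsGeometric.isFromStalk (hX : IsGeometric X) (x : X.carrier) :
    IsFromStalk x (hX.fromStalk x) := (hX.exists_isFromStalk x).choose_spec

/-- The homomorphism from the stalk at the image of the closed point that is attached to a
morphism from a spectrum. -/
noncomputable def stalkHom {A : CommMonZ.{u}} [Nontrivial A] (f : specSpace A ⟶ X) :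
    stalk X.presheaf (f.toHom.base (closedPt A)) ⟶ A :=
  stalkMap f.toHom (closedPt A) ≫ stalkClosedPt A

lemma stalkHom_germAt {A : CommMonZ.{u}} [Nontrivial A] (f : specSpace A ⟶ X)
    {V : Opens X.carrier} (hV : f.toHom.base (closedPt A) ∈ V) (s : X.Sec V) :
    CommMonZ.Hom.hom (stalkHom f) (X.germAt hV s) =
      pull f (forall_mem_of_closedPt (V := V) f hV) s :=
  Eq.symm ((secEval_of_nontrivial (pb f V s) (𝟙 A) (forall_mem_of_closedPt (V := V) f hV)).trans
    (congrArg (locClosedPt A) (locMap_id (closedPt A) _)))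

lemma exists_germAt (x : X.carrier) (t : stalk X.presheaf x) :
    ∃ (V : Opens X.carrier) (hx : x ∈ V) (s : X.Sec V), X.germAt hx s = t := exists_germ _ _ t

lemma stalkHom_ext {x : X.carrier} {A : CommMonZ.{u}} {f g : stalk X.presheaf x ⟶ A}
    (h : ∀ (V : Opens X.carrier) (hx : x ∈ V) (s : X.Sec V),
      CommMonZ.Hom.hom f (X.germAt hx s) = CommMonZ.Hom.hom g (X.germAt hx s)) : f = g := by
  ext t
  obtain ⟨V, hx, s, rfl⟩ := exists_germAt x t
  exact h V hx s

variable (hX : IsGeometric X)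
include hX

lemma IsGeometric.pull_specMap_fromStalk {x : X.carrier} {A : CommMonZ.{u}}
    (g : stalk X.presheaf x ⟶ A) {V : Opens X.carrier} (hx : x ∈ V)
    (h : ∀ q : MSpec A, (specMap g ≫ hX.fromStalk x).toHom.base q ∈ V) (s : X.Sec V) :
    pull (specMap g ≫ hX.fromStalk x) h s = CommMonZ.Hom.hom g (X.germAt hx s) :=
  (pull_comp _ g ((hX.isFromStalk x).mem hx) h s).trans
    (congrArg (CommMonZ.Hom.hom g) ((hX.isFromStalk x).pull_eq hx s))

/-- A morphism from a spectrum factors through the spectrum of a stalk. -/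
lemma IsGeometric.specMap_stalkHom {A : CommMonZ.{u}} [Nontrivial A] (f : specSpace A ⟶ X) :
    specMap (stalkHom f) ≫ hX.fromStalk (f.toHom.base (closedPt A)) = f := by
  refine hX.hom_ext_of_pull (x := f.toHom.base (closedPt A))
    (fun V hV q => (hX.isFromStalk _).mem hV _)
    (fun V hV => forall_mem_of_closedPt (V := V) f hV) fun V hV s => ?_
  exact (hX.pull_specMap_fromStalk _ hV _ s).trans (stalkHom_germAt f hV s)

lemma IsGeometric.specializes_of_specMap_fromStalk {x : X.carrier} {A : CommMonZ.{u}}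
    (g : stalk X.presheaf x ⟶ A) (p : MSpec A) :
    (specMap g ≫ hX.fromStalk x).toHom.base p ⤳ x :=
  specializes_iff_forall_open.2 fun V hV hx => (hX.isFromStalk x).mem (V := ⟨V, hV⟩) hx _

/-- The closed point of `A` may go to a proper generization of `x`. Then `g` factors through the
stalk at that generization. -/
lemma IsGeometric.stalkSpecializes_stalkHom {x : X.carrier} {A : CommMonZ.{u}} [Nontrivial A]
    (g : stalk X.presheaf x ⟶ A) :
    stalkSpecializes X.presheaf (hX.specializes_of_specMap_fromStalk g (closedPt A)) ≫
      stalkHom (specMap g ≫ hX.fromStalk x) = g := by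
  refine stalkHom_ext fun V hV s => ?_
  refine (stalkHom_germAt (specMap g ≫ hX.fromStalk x) (V := V) _ s).trans ?_
  exact hX.pull_specMap_fromStalk g hV _ s

lemma IsGeometric.specMap_stalkSpecializes {x y : X.carrier} (h : x ⤳ y) :
    specMap (stalkSpecializes X.presheaf h) ≫ hX.fromStalk y = hX.fromStalk x := by
  refine hX.hom_ext_of_pull (x := y) (fun V hV q => (hX.isFromStalk _).mem hV _)
    (fun V hV => (hX.isFromStalk x).mem (h.mem_open V.2 hV)) fun V hV s => ?_
  exact (hX.pull_specMap_fromStalk _ hV _ s).trans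
    ((hX.isFromStalk x).pull_eq (h.mem_open V.2 hV) s).symm

/-- Pulling a section back along `specMap f ≫ hX.fromStalk x` gives the image of its germ under `f`,
so the composite determines `f` on all germs. -/
lemma IsGeometric.fromStalk_injective {x : X.carrier} {A : CommMonZ.{u}}
    {f g : stalk X.presheaf x ⟶ A}
    (h : specMap f ≫ hX.fromStalk x = specMap g ≫ hX.fromStalk x) : f = g := by
  refine stalkHom_ext fun V hV s => ?_
  have hm : ∀ f' : stalk X.presheaf x ⟶ A, ∀ q : MSpec A,
      (specMap f' ≫ hX.fromStalk x).toHom.base q ∈ V := fun f' q => (hX.isFromStalk x).mem hV _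
  refine (hX.pull_specMap_fromStalk f hV (hm f) s).symm.trans
    (Eq.trans ?_ (hX.pull_specMap_fromStalk g hV (hm g) s))
  congr 1

end Stalks

end FOne

namespace FOne

open AlgebraicGeometry MonoidalSpace

/-! ## Morphisms from the base extension -/

/-- The universal homomorphism from a monoid to the multiplicative monoid of a ring. -/
noncomputable def mringUnit (A : CommMonZ.{u}) : A ⟶ forgetAdd.obj (mringFunctor.obj A) :=
  CommMonZ.ofHom (B := MRing A) (toMRing A)

lemma mringUnit_monToRing {A : CommMonZ.{u}} {R : CommRingCat.{u}} (g : A ⟶ forgetAdd.obj R) :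
    mringUnit A ≫ forgetAdd.map (monToRing g) = g :=
  CommMonZ.hom_ext fun a => monToRing_toMRing g a

lemma monToRing_mringUnit (A : CommMonZ.{u}) : monToRing (mringUnit A) = 𝟙 _ :=
  CommRingCat.hom_ext (mring_hom_ext fun a => monToRing_toMRing (mringUnit A) a)

lemma mringUnit_naturality {A B : CommMonZ.{u}} (g : A ⟶ B) :
    g ≫ mringUnit B = mringUnit A ≫ forgetAdd.map (mringFunctor.map g) :=
  CommMonZ.hom_ext fun a => (mringMap_toMRing g a).symm

section BaseExt

variable {X : MonoidalSpace.{u}}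

/-- The morphism from the base extension of the spectrum of a stalk. -/
noncomputable abbrev baseExtι (X : MonoidalSpace.{u}) (x : X.carrier) :
    specLRS.obj (op (mringFunctor.obj (stalk X.presheaf x))) ⟶ baseExt.obj X :=
  Limits.colimit.ι (stalkDiagram X.toPresheafedSpace) ⟨x⟩

lemma baseExtι_w {x y : X.carrier} (h : x ⤳ y) :
    specLRS.map (mringFunctor.map (stalkSpecializes X.presheaf h)).op ≫ baseExtι X y =
      baseExtι X x :=
  Limits.colimit.w (stalkDiagram X.toPresheafedSpace)
    (show (⟨x⟩ : PointCat X.carrier) ⟶ ⟨y⟩ from homOfLE h)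

/-- An `R`-valued point of `X` enters the colimit through the component at the image of the closed
point of the multiplicative monoid of `R`. -/
lemma specUnit_comp_baseExtMap {R : CommRingCat.{u}} [h0 : Nontrivial (forgetAdd.obj R)]
    (f : specSpace (forgetAdd.obj R) ⟶ X) :
    specUnit R ≫ baseExt.map f = specLRS.map (monToRing (stalkHom f)).op ≫
      baseExtι X (f.toHom.base (closedPt (forgetAdd.obj R))) := by
  have hR : specUnit R = specUnitAux R := dif_pos h0
  refine (congrArg (· ≫ baseExt.map f) hR).trans ((Category.assoc _ _ _).trans ?_)
  refine (congrArg (specLRS.map (monToRing (stalkClosedPt (forgetAdd.obj R))).op ≫ ·)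
    (ι_baseExtMap f.toHom ⟨closedPt (forgetAdd.obj R)⟩)).trans ?_
  refine (Category.assoc _ _ _).symm.trans (congrArg (· ≫ _) ?_)
  refine (specLRS.map_comp (monToRing (stalkClosedPt (forgetAdd.obj R))).op
    (mringFunctor.map (stalkMap f.toHom (closedPt (forgetAdd.obj R)))).op).symm.trans ?_
  exact congrArg (fun r => specLRS.map (Quiver.Hom.op r)) (map_monToRing _ _)

/-- The component at any point `x` through whose stalk the morphism factors may be used as well,
because the relations of the colimit identify it with the component at the image of the closed
point. The zero ring has an empty spectrum. -/
lemma IsGeometric.specUnit_comp_baseExtMap (hX : IsGeometric X) {R : CommRingCat.{u}}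
    {x : X.carrier} (g : stalk X.presheaf x ⟶ forgetAdd.obj R) :
    specUnit R ≫ baseExt.map (specMap g ≫ hX.fromStalk x) =
      specLRS.map (monToRing g).op ≫ baseExtι X x := by
  by_cases hR : Nontrivial (forgetAdd.obj R)
  · refine (FOne.specUnit_comp_baseExtMap _).trans ?_
    rw [← baseExtι_w (hX.specializes_of_specMap_fromStalk g (closedPt (forgetAdd.obj R)))]
    refine (Category.assoc _ _ _).symm.trans (congrArg (· ≫ _) ?_)
    refine (specLRS.map_comp _ _).symm.trans (congrArg (fun r => specLRS.map (Quiver.Hom.op r)) ?_)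
    refine (map_monToRing _ _).trans (congrArg monToRing ?_)
    exact hX.stalkSpecializes_stalkHom g
  · have : Subsingleton R := not_nontrivial_iff_subsingleton.1 hR
    exact (specLRSIsInitial R).hom_ext _ _

/-- Morphisms from the base extension are determined by their effect on points. -/
lemma IsGeometric.baseExt_hom_ext (hX : IsGeometric X) {S : LocallyRingedSpace.{u}}
    {d e : baseExt.obj X ⟶ S}
    (h : ∀ (R : CommRingCat.{u}) (f : specSpace (forgetAdd.obj R) ⟶ X),
      (specUnit R ≫ baseExt.map f) ≫ d = (specUnit R ≫ baseExt.map f) ≫ e) : d = e := by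
  refine Limits.colimit.hom_ext fun x => ?_
  -- The test point is the universal one over `x`, with values in `ℤ[O_x]/(1·0)`; the morphism that
  -- it gives is the component of the colimit at `x`.
  have := h _ (specMap (mringUnit _) ≫ hX.fromStalk x.pt)
  rw [hX.specUnit_comp_baseExtMap, monToRing_mringUnit] at this
  have e1 : specLRS.map (𝟙 (mringFunctor.obj (stalk X.presheaf x.pt))).op ≫ baseExtι X x.pt =
      baseExtι X x.pt := (congrArg (· ≫ _) (specLRS.map_id _)).trans (Category.id_comp _)
  rw [e1] at this
  exact this

/-- A natural family of maps on points comes from a morphism from the base extension. -/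
lemma IsGeometric.exists_baseExt_hom (hX : IsGeometric X) {S : LocallyRingedSpace.{u}}
    (ν : ∀ R : CommRingCat.{u}, (specSpace (forgetAdd.obj R) ⟶ X) → (specLRS.obj (op R) ⟶ S))
    (hν : ∀ {R R' : CommRingCat.{u}} (g : R ⟶ R') (f : specSpace (forgetAdd.obj R) ⟶ X),
      ν R' (specMap (forgetAdd.map g) ≫ f) = specLRS.map g.op ≫ ν R f) :
    ∃ e : baseExt.obj X ⟶ S, ∀ (R : CommRingCat.{u}) (f : specSpace (forgetAdd.obj R) ⟶ X),
      (specUnit R ≫ baseExt.map f) ≫ e = ν R f := by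
  -- The component at `x` has to be the value of `ν` at the universal point over `x`. By naturality
  -- it then determines `ν` at all points that factor through the stalk at `x`.
  let w : ∀ x : X.carrier, specLRS.obj (op (mringFunctor.obj (stalk X.presheaf x))) ⟶ S :=
    fun x => ν _ (specMap (mringUnit _) ≫ hX.fromStalk x)
  have hw : ∀ {R : CommRingCat.{u}} {x : X.carrier} (g : stalk X.presheaf x ⟶ forgetAdd.obj R),
      specLRS.map (monToRing g).op ≫ w x = ν R (specMap g ≫ hX.fromStalk x) := fun {R x} g => by
    refine (hν _ _).symm.trans (congrArg (ν R) ?_)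
    rw [← Category.assoc, ← specMap_comp, mringUnit_monToRing]
  let c : Limits.Cocone (stalkDiagram X.toPresheafedSpace) :=
    { pt := S
      ι :=
        { app x := w x.pt
          naturality x y h := by
            refine Eq.trans ?_ (Category.comp_id _).symm
            have hs : x.pt ⤳ y.pt := leOfHom h
            refine (?_ : specLRS.map (mringFunctor.map (stalkSpecializes X.presheaf hs)).op ≫
              w y.pt = w x.pt)
            refine (hν _ _).symm.trans (congrArg (ν _) ?_)
            rw [← Category.assoc, ← specMap_comp, ← mringUnit_naturality, specMap_comp,
              Category.assoc, hX.specMap_stalkSpecializes] } }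
  let e : baseExt.obj X ⟶ S := Limits.colimit.desc (stalkDiagram X.toPresheafedSpace) c
  have he : ∀ x, baseExtι X x ≫ e = w x := fun x => Limits.colimit.ι_desc c ⟨x⟩
  refine ⟨e, fun R f => ?_⟩
  by_cases hR : Nontrivial (forgetAdd.obj R)
  · rw [← hX.specMap_stalkHom f, hX.specUnit_comp_baseExtMap, Category.assoc, he]
    exact hw _
  · have : Subsingleton R := not_nontrivial_iff_subsingleton.1 hR
    exact (specLRSIsInitial R).hom_ext _ _

end BaseExt

end FOne

namespace FOne

open AlgebraicGeometry MonoidalSpace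

/-! ## Points with affine smallest neighbourhood -/

section Charts

variable {X : MonoidalSpace.{u}} (hX : IsGeometric X)

/-- The closed point of a chart has a smallest neighbourhood, which is the spectrum of the stalk. -/
lemma IsOpenImm.isOpenImm_fromStalk {B : CommMonZ.{u}} [Nontrivial B] {i : specSpace B ⟶ X}
    (hi : IsOpenImm i) : IsOpenImm (hX.fromStalk (i.toHom.base (closedPt B))) := by
  have hg := hX.specMap_stalkHom i
  obtain ⟨φ, hφ⟩ := hi.exists_specMap (hX.fromStalk (i.toHom.base (closedPt B)))
    ((hX.isFromStalk _).mem (V := hi.range) ⟨_, rfl⟩)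
  -- The chart and the spectrum of the stalk factor through each other. Composition with either of
  -- them is injective on homomorphisms, so the factorizations are mutually inverse.
  have h1 : φ ≫ stalkHom i = 𝟙 B := hi.specMap_injective (by
    rw [specMap_comp, Category.assoc, hφ, hg, specMap_id, Category.id_comp])
  have h2 : stalkHom i ≫ φ = 𝟙 _ := hX.fromStalk_injective (by
    rw [specMap_comp, Category.assoc, hg, hφ, specMap_id, Category.id_comp])
  have h3 : IsIso (specMap φ).toHom :=
    ⟨(specMap (stalkHom i)).toHom,
      (congrArg Hom.toHom ((specMap_comp _ _).symm.trans ((congrArg specMap h2).trans specMap_id)) :),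
      (congrArg Hom.toHom ((specMap_comp _ _).symm.trans ((congrArg specMap h1).trans specMap_id)) :)⟩
  rw [← hφ]
  exact IsOpenImm.comp (inferInstanceAs (PresheafedSpace.IsOpenImmersion (specMap φ).toHom)) hi

variable {hX}

/-- The image consists of generizations of `x`; if it is open, it contains all of them and is the
smallest neighbourhood of `x`. -/
lemma mem_range_fromStalk {x : X.carrier} (hx : IsOpenImm (hX.fromStalk x)) {y : X.carrier} :
    y ∈ Set.range (hX.fromStalk x).toHom.base ↔ y ⤳ x := by
  constructor
  · rintro ⟨q, rfl⟩
    exact specializes_iff_forall_open.2 fun V hV h => (hX.isFromStalk x).mem (V := ⟨V, hV⟩) h q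
  · exact fun h => h.mem_open hx.range.2 ⟨_, (hX.isFromStalk x).base_closedPt⟩

-- In a chart around `x`, a basic open set around `x` inside `V` is again a spectrum; `y` is its
-- closed point.
variable (hX) in
lemma IsGeometric.exists_specializes {x : X.carrier} {V : Opens X.carrier} (hx : x ∈ V) :
    ∃ y ∈ V, IsOpenImm (hX.fromStalk y) ∧ x ⤳ y := by
  obtain ⟨B, i, hi, p, rfl⟩ := hX.exists_chart x
  obtain ⟨h, hp, hV⟩ := exists_basicOpen_le (A := B) (preim i V) (p := p) hx
  obtain ⟨hl, hr⟩ := range_specMap_locAway h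
  obtain ⟨q, hq⟩ : p ∈ Set.range (specMap (locAway h)).toHom.base := by
    rw [hr]
    exact hp
  have : Nontrivial (locObj (Submonoid.powers h)) := MSpec.nontrivial q
  have hi' : IsOpenImm (specMap (locAway h) ≫ i) := hl.comp hi
  refine ⟨_, ?_, hi'.isOpenImm_fromStalk hX, specializes_iff_forall_open.2 fun W hW hc => ?_⟩
  · exact hV _ (comap_locAway_notMem h _)
  · have := forall_mem_of_closedPt (V := ⟨W, hW⟩) (specMap (locAway h) ≫ i) hc q
    exact (congrArg (fun r => i.toHom.base r ∈ W) hq).mp this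

-- The intersection of the smallest neighbourhoods of `y` and `z` is an open neighbourhood of `x`;
-- any `w` in it specializes to both.
variable (hX) in
lemma IsGeometric.exists_specializes₂ {x y z : X.carrier} (hy : IsOpenImm (hX.fromStalk y))
    (hz : IsOpenImm (hX.fromStalk z)) (hxy : x ⤳ y) (hxz : x ⤳ z) :
    ∃ w, IsOpenImm (hX.fromStalk w) ∧ x ⤳ w ∧ w ⤳ y ∧ w ⤳ z := by
  obtain ⟨w, hw, h, hxw⟩ := hX.exists_specializes (x := x) (V := hy.range ⊓ hz.range)
    ⟨(mem_range_fromStalk hy).2 hxy, (mem_range_fromStalk hz).2 hxz⟩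
  exact ⟨w, h, hxw, (mem_range_fromStalk hy).1 hw.1, (mem_range_fromStalk hz).1 hw.2⟩

/-- The prime ideal of a monoid attached to a prime ideal of its ring. -/
def primeOfRing {A : CommMonZ.{u}} (P : PrimeSpectrum (MRing A)) : MSpec A where
  carrier := {a | toMRing A a ∈ P.asIdeal}
  zero_mem := by
    rw [Set.mem_ofPred_eq, map_zero]
    exact P.asIdeal.zero_mem
  mul_mem a h := by
    rw [Set.mem_ofPred_eq, map_mul]
    exact P.asIdeal.mul_mem_right _ h
  one_notMem := by
    rw [Set.mem_ofPred_eq, map_one]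
    exact P.2.one_notMem
  mul_notMem h k := by
    rw [Set.mem_ofPred_eq, map_mul]
    exact fun e => (P.2.mem_or_mem e).elim h k

lemma comap_primeOfRing {A B : CommMonZ.{u}} (g : A ⟶ B) (P : PrimeSpectrum (MRing B)) :
    (primeOfRing P).comap (CommMonZ.Hom.hom g) = primeOfRing (P.comap (mringMap g)) :=
  MSpec.ext (Set.ext fun a => by
    change toMRing B _ ∈ P.asIdeal ↔ mringMap g (toMRing A a) ∈ P.asIdeal
    rw [mringMap_toMRing])

/-- If `g : A → B` is the localization at `h`, then the homomorphism of rings is the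
localization. -/
lemma isLocalization_mringMap {A B : CommMonZ.{u}} (g : A ⟶ B) (h : A)
    (hh : IsUnit (CommMonZ.Hom.hom g h))
    (hs : ∀ {C : CommMonZ.{u}} (f : A ⟶ C), IsUnit (CommMonZ.Hom.hom f h) → ∃ f', g ≫ f' = f)
    (hi : ∀ {C : CommMonZ.{u}} {f f' : B ⟶ C}, g ≫ f = g ≫ f' → f = f') :
    letI := (mringMap g).toAlgebra
    IsLocalization.Away (toMRing A h) (MRing B) := by
  let := (mringMap g).toAlgebra
  let L := Localization.Away (toMRing A h)
  let α : MRing A →+* L := algebraMap _ _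
  let R : CommRingCat.{u} := CommRingCat.of L
  let f : A ⟶ forgetAdd.obj R := mringUnit A ≫ forgetAdd.map (CommRingCat.ofHom α)
  -- The multiplicative map `A → L` makes `h` a unit, so it extends to `B`, and then to the ring of
  -- `B`. The universal property of the localization gives the inverse of this ring homomorphism.
  obtain ⟨f', hf'⟩ := hs f (IsLocalization.Away.algebraMap_isUnit (S := L) (toMRing A h))
  have hf1 : ∀ a : A, CommMonZ.Hom.hom f' (CommMonZ.Hom.hom g a) = α (toMRing A a) :=
    fun a => congrArg (fun k => CommMonZ.Hom.hom k a) hf'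
  let β : MRing B →+* L := mringLift (R := L) (CommMonZ.Hom.hom f')
  have hβ : ∀ b, β (toMRing B b) = CommMonZ.Hom.hom f' b := fun b => mringLift_toMRing (R := L) _ b
  have hαβ : β.comp (mringMap g) = α := mring_hom_ext (R := L) fun a => by
    rw [RingHom.comp_apply, mringMap_toMRing, hβ, hf1]
  have hu : IsUnit (mringMap g (toMRing A h)) := by
    rw [mringMap_toMRing]
    exact hh.map _
  let γ : L →+* MRing B := IsLocalization.Away.lift (toMRing A h) hu
  have hγ : ∀ r, γ (α r) = mringMap g r := fun r => IsLocalization.Away.lift_eq _ hu r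
  have h1 : β.comp γ = RingHom.id L := by
    refine IsLocalization.ringHom_ext (Submonoid.powers (toMRing A h)) (RingHom.ext fun r => ?_)
    change β (γ (α r)) = α r
    rw [hγ]
    exact RingHom.congr_fun hαβ r
  have h2 : γ.comp β = RingHom.id (MRing B) := by
    refine mring_hom_ext (R := MRing B) fun b => ?_
    have : f' ≫ forgetAdd.map (CommRingCat.ofHom (R := L) (S := MRing B) γ) = mringUnit B :=
      hi (CommMonZ.hom_ext fun a => by
        change γ (CommMonZ.Hom.hom f' (CommMonZ.Hom.hom g a)) = toMRing B (CommMonZ.Hom.hom g a)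
        rw [hf1, hγ, mringMap_toMRing])
    rw [RingHom.comp_apply, hβ]
    exact congrArg (fun k => CommMonZ.Hom.hom k b) this
  let e : L ≃ₐ[MRing A] MRing B :=
    { RingEquiv.ofRingHom γ β h2 h1 with
      commutes' := hγ }
  exact IsLocalization.isLocalization_of_algEquiv _ e

/-- If `x` specializes to `y` and if the stalks at these points are the sections over open
neighbourhoods, then the stalk at `x` is a localization of the stalk at `y`. -/
lemma exists_isLocalization_stalk {x y : X.carrier} (hx : IsOpenImm (hX.fromStalk x))
    (hy : IsOpenImm (hX.fromStalk y)) (h : x ⤳ y) : ∃ f : stalk X.presheaf y,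
    (∀ p : MSpec (stalk X.presheaf y), f ∉ p.carrier ↔ (hX.fromStalk y).toHom.base p ⤳ x) ∧
    letI := (mringMap (stalkSpecializes X.presheaf h)).toAlgebra
    IsLocalization.Away (toMRing _ f) (MRing (stalk X.presheaf x)) := by
  have := (hX.isFromStalk x).nontrivial
  have hsp := hX.specMap_stalkSpecializes h
  set sp := stalkSpecializes X.presheaf h
  let q := (closedPt (stalk X.presheaf x)).comap (CommMonZ.Hom.hom sp)
  have hb : ∀ r : MSpec (stalk X.presheaf x), (hX.fromStalk y).toHom.base
      (r.comap (CommMonZ.Hom.hom sp)) = (hX.fromStalk x).toHom.base r :=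
    fun r => congrArg (fun k => k.toHom.base r) hsp
  have hq : (hX.fromStalk y).toHom.base q = x :=
    (hb _).trans (hX.isFromStalk x).base_closedPt
  -- The prime `q` of the stalk at `y` corresponds to `x`. The generizations of `x` form an open
  -- set, so `f` can be chosen with its basic open set inside; conversely every prime over a
  -- generization of `x` is contained in `q` and so avoids `f`.
  obtain ⟨f, hf, hV⟩ := exists_basicOpen_le (A := stalk X.presheaf y)
    (preim (hX.fromStalk y) hx.range) (p := q) (show _ ∈ hx.range from hq.symm ▸ (mem_range_fromStalk hx).2 specializes_rfl)
  have hfp : ∀ p : MSpec (stalk X.presheaf y),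
      f ∉ p.carrier ↔ (hX.fromStalk y).toHom.base p ⤳ x := fun p => by
    rw [← mem_range_fromStalk hx]
    refine ⟨hV p, ?_⟩
    rintro ⟨r, hr⟩
    have hpr : r.comap (CommMonZ.Hom.hom sp) = p := hy.injective ((hb r).trans hr)
    rw [← hpr]
    exact fun hc => hf (r.subset_closedPt hc)
  refine ⟨f, hfp, isLocalization_mringMap sp f (not_not.1 hf) (fun {C} g hg => ?_)
    fun {C g g'} e => ?_⟩
  -- A homomorphism that makes `f` a unit sends its spectrum into the open set `Spec O_x`, hence
  -- factors through `O_x`.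
  · obtain ⟨g', hg'⟩ := hx.exists_specMap (specMap g ≫ hX.fromStalk y) fun p =>
      hV _ fun hc => MSpec.not_isUnit (p := p) (a := CommMonZ.Hom.hom g f) hc hg
    refine ⟨g', hX.fromStalk_injective ?_⟩
    rw [specMap_comp, Category.assoc, hsp, hg']
  · refine hx.specMap_injective ?_
    rw [← hsp, ← Category.assoc, ← Category.assoc, ← specMap_comp, ← specMap_comp, e]

end Charts

end FOne

namespace FOne

open AlgebraicGeometry MonoidalSpace

/-! ## The base extension is a scheme -/

section BaseExtScheme

variable {X : MonoidalSpace.{u}} (hX : IsGeometric X)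

/-- The points that have a smallest neighbourhood which is affine. -/
abbrev ChartPoint : Type u := {x : PointCat X.carrier // IsOpenImm (hX.fromStalk x.pt)}

/-- The inclusion of the points that have a smallest neighbourhood which is affine. -/
def chartIncl : ChartPoint hX ⥤ PointCat X.carrier :=
  Monotone.functor (f := Subtype.val) fun _ _ h => h

/-- Every point specializes to a chart point, and two chart points to which `d` specializes are
dominated by a third between them and `d`; so the comma categories are non-empty and connected. -/
instance : (chartIncl hX).Final where
  out d := by
    have hn : Nonempty (StructuredArrow d (chartIncl hX)) := by
      obtain ⟨y, -, hy, h⟩ := hX.exists_specializes (x := d.pt) (V := ⊤) trivial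
      exact ⟨StructuredArrow.mk (Y := (⟨⟨y⟩, hy⟩ : ChartPoint hX)) (homOfLE h)⟩
    refine zigzag_isConnected fun a b => ?_
    obtain ⟨w, hw, h, h1, h2⟩ := hX.exists_specializes₂ a.right.2 b.right.2
      (show d.pt ⤳ _ from leOfHom a.hom) (show d.pt ⤳ _ from leOfHom b.hom)
    let c : StructuredArrow d (chartIncl hX) :=
      StructuredArrow.mk (Y := (⟨⟨w⟩, hw⟩ : ChartPoint hX)) (homOfLE h)
    have ha : c ⟶ a := StructuredArrow.homMk (homOfLE h1) (Subsingleton.elim _ _)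
    have hb : c ⟶ b := StructuredArrow.homMk (homOfLE h2) (Subsingleton.elim _ _)
    exact (Zigzag.of_inv ha).trans (Zigzag.of_hom hb)

/-- The affine schemes attached to the points that have a smallest neighbourhood which is affine. -/
noncomputable def chartDiagram : ChartPoint hX ⥤ Scheme.{u} where
  obj x := Spec (mringFunctor.obj (stalk X.presheaf x.1.pt))
  map h := Spec.map (mringFunctor.map (stalkSpecializes X.presheaf (leOfHom h)))
  map_id x := Scheme.forgetToLocallyRingedSpace.map_injective
    ((chartIncl hX ⋙ stalkDiagram X.toPresheafedSpace).map_id x)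
  map_comp h k := Scheme.forgetToLocallyRingedSpace.map_injective
    ((chartIncl hX ⋙ stalkDiagram X.toPresheafedSpace).map_comp h k)

instance {x y : ChartPoint hX} (h : x ⟶ y) : IsOpenImmersion ((chartDiagram hX).map h) := by
  obtain ⟨f, -, hf⟩ := exists_isLocalization_stalk x.2 y.2 (leOfHom h)
  let := (mringMap (stalkSpecializes X.presheaf (leOfHom h))).toAlgebra
  exact @IsOpenImmersion.of_isLocalization (MRing _) (MRing _) _ _ _ (toMRing _ f) hf

/-- The point of `X` attached to a point of one of the affine schemes. -/
noncomputable def chartPt (x : ChartPoint hX) (P : (chartDiagram hX).obj x) : X.carrier :=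
  (hX.fromStalk x.1.pt).toHom.base
    (primeOfRing (show PrimeSpectrum (MRing (stalk X.presheaf x.1.pt)) from P))

lemma chartPt_specializes (x : ChartPoint hX) (P : (chartDiagram hX).obj x) :
    chartPt hX x P ⤳ x.1.pt :=
  (mem_range_fromStalk x.2).1 ⟨_, rfl⟩

lemma chartPt_map {x y : ChartPoint hX} (h : x ⟶ y) (P : (chartDiagram hX).obj x) :
    chartPt hX y ((chartDiagram hX).map h P) = chartPt hX x P := by
  have e := hX.specMap_stalkSpecializes (leOfHom h)
  refine Eq.trans (congrArg (hX.fromStalk y.1.pt).toHom.base ?_)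
    (congrArg (fun k => k.toHom.base (primeOfRing
      (show PrimeSpectrum (MRing (stalk X.presheaf x.1.pt)) from P))) e)
  exact (comap_primeOfRing (stalkSpecializes X.presheaf (leOfHom h)) _).symm

/-- The transition map is the localization at an element `f`, and `f` avoids exactly the primes that
lie over generizations of `x`. -/
lemma mem_range_chartDiagram_map {x y : ChartPoint hX} (h : x ⟶ y)
    {P : (chartDiagram hX).obj y} (hP : chartPt hX y P ⤳ x.1.pt) :
    ∃ Q, (chartDiagram hX).map h Q = P := by
  obtain ⟨f, hf, hl⟩ := exists_isLocalization_stalk x.2 y.2 (leOfHom h)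
  let := (mringMap (stalkSpecializes X.presheaf (leOfHom h))).toAlgebra
  have hr := @PrimeSpectrum.localization_away_comap_range (MRing (stalk X.presheaf y.1.pt)) _
    (MRing (stalk X.presheaf x.1.pt)) _ _ (toMRing _ f) hl
  have : (show PrimeSpectrum (MRing (stalk X.presheaf y.1.pt)) from P) ∈
      PrimeSpectrum.basicOpen (toMRing _ f) := (hf (primeOfRing _)).2 hP
  exact (Set.ext_iff.1 hr _).2 this

/-- Points of two charts with the same image lie over the same point of `X`, which lies in the
smallest neighbourhood of a chart point `l` below both. One of the points lifts to the chart at `l`,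
and its image in the other chart is the other point because the transition maps are injective. -/
instance : (chartDiagram hX ⋙ Scheme.forget).IsLocallyDirected where
  cond {i j k} fi fj P Q e := by
    have e1 : chartPt hX i P = chartPt hX j Q := (chartPt_map hX fi P).symm.trans
      ((congrArg (chartPt hX k) e).trans (chartPt_map hX fj Q))
    obtain ⟨w, hw, h, h1, h2⟩ := hX.exists_specializes₂ i.2 j.2 (chartPt_specializes hX i P)
      (e1.symm ▸ chartPt_specializes hX j Q)
    let l : ChartPoint hX := ⟨⟨w⟩, hw⟩
    let fli : l ⟶ i := homOfLE h1
    let flj : l ⟶ j := homOfLE h2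
    obtain ⟨R, hR⟩ := mem_range_chartDiagram_map hX fli (P := P) h
    refine ⟨l, fli, flj, R, hR, ?_⟩
    refine ((chartDiagram hX).map fj).isOpenEmbedding.injective ?_
    have e2 : (chartDiagram hX).map flj ≫ (chartDiagram hX).map fj =
        (chartDiagram hX).map fli ≫ (chartDiagram hX).map fi := by
      rw [← Functor.map_comp, ← Functor.map_comp]
      rfl
    refine (congrArg (fun m : (chartDiagram hX).obj l ⟶ (chartDiagram hX).obj k => m R) e2).trans ?_
    exact (congrArg ((chartDiagram hX).map fi) hR).trans e

/-- The base extension, as a scheme. -/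
noncomputable abbrev baseExtScheme : Scheme.{u} := Limits.colimit (chartDiagram hX)

/-- The base extension is a scheme. -/
noncomputable def baseExtSchemeIso :
    (baseExtScheme hX).toLocallyRingedSpace ≅ baseExt.obj X :=
  -- The colimit of this locally directed diagram of open immersions is preserved by the passage to
  -- locally ringed spaces, and by finality it is the colimit over all points.
  preservesColimitIso Scheme.forgetToLocallyRingedSpace (chartDiagram hX) ≪≫
    Functor.Final.colimitIso (chartIncl hX) (stalkDiagram X.toPresheafedSpace)

lemma ι_baseExtSchemeIso (x : ChartPoint hX) :
    Scheme.forgetToLocallyRingedSpace.map (Limits.colimit.ι (chartDiagram hX) x) ≫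
      (baseExtSchemeIso hX).hom = baseExtι X x.1.pt := by
  refine (Category.assoc _ _ _).symm.trans ?_
  refine (congrArg (· ≫ _) (ι_preservesColimitIso_hom Scheme.forgetToLocallyRingedSpace
    (chartDiagram hX) x)).trans ?_
  exact Functor.Final.ι_colimitIso_hom (chartIncl hX) (stalkDiagram X.toPresheafedSpace) x

end BaseExtScheme

end FOne

namespace FOne

open AlgebraicGeometry MonoidalSpace

/-! ## Points with values in fields -/

lemma monToRing_injective {A : CommMonZ.{u}} {R : CommRingCat.{u}} {f g : A ⟶ forgetAdd.obj R}
    (h : monToRing f = monToRing g) : f = g := by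
  rw [← mringUnit_monToRing f, h, mringUnit_monToRing]

lemma exists_monToRing {A : CommMonZ.{u}} {R : CommRingCat.{u}} (r : mringFunctor.obj A ⟶ R) :
    ∃ f : A ⟶ forgetAdd.obj R, monToRing f = r :=
  ⟨mringUnit A ≫ forgetAdd.map r, by
    rw [← monToRing_comp, monToRing_mringUnit, Category.id_comp]⟩

section FieldPoints

/-- A morphism from the spectrum of a field lifts along an open immersion. -/
lemma exists_lift_of_field {k : Type u} [Field k] {U V : Scheme.{u}} (i : U ⟶ V)
    [IsOpenImmersion i] (a : Spec (CommRingCat.of k) ⟶ V) {y : Spec (CommRingCat.of k)}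
    {x : U} (h : i x = a y) : ∃ b : Spec (CommRingCat.of k) ⟶ U, b ≫ i = a := by
  have hs : Subsingleton (Spec (CommRingCat.of k)) :=
    inferInstanceAs (Subsingleton (PrimeSpectrum k))
  refine ⟨IsOpenImmersion.lift i a ?_, IsOpenImmersion.lift_fac _ _ _⟩
  rintro _ ⟨z, rfl⟩
  exact ⟨x, h.trans (congrArg a (hs.elim y z))⟩

variable {X : MonoidalSpace.{u}} (hX : IsGeometric X)

/-- The morphism factors through the stalk at the image of the closed point, and this point
specializes to a chart point. -/
lemma IsGeometric.exists_chartPoint {A : CommMonZ.{u}} [Nontrivial A] (f : specSpace A ⟶ X) :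
    ∃ (j : ChartPoint hX) (g : stalk X.presheaf j.1.pt ⟶ A),
      specMap g ≫ hX.fromStalk j.1.pt = f := by
  obtain ⟨y, -, hy, h⟩ :=
    hX.exists_specializes (x := f.toHom.base (closedPt A)) (V := ⊤) trivial
  refine ⟨⟨⟨y⟩, hy⟩, stalkSpecializes X.presheaf h ≫ stalkHom f, ?_⟩
  rw [specMap_comp, Category.assoc, hX.specMap_stalkSpecializes, hX.specMap_stalkHom]

variable {hX}

lemma specUnit_comp_chart {R : CommRingCat.{u}} (j : ChartPoint hX)
    (g : stalk X.presheaf j.1.pt ⟶ forgetAdd.obj R) :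
    specUnit R ≫ baseExt.map (specMap g ≫ hX.fromStalk j.1.pt) =
      Scheme.forgetToLocallyRingedSpace.map
        (Spec.map (monToRing g) ≫ Limits.colimit.ι (chartDiagram hX) j) ≫
        (baseExtSchemeIso hX).hom := by
  refine (hX.specUnit_comp_baseExtMap g).trans ?_
  rw [← ι_baseExtSchemeIso hX j]
  exact (Category.assoc _ _ _).symm

/-- The points of the base extension with values in a field are the points of the geometric scheme
with values in the multiplicative monoid of the field. -/
lemma IsGeometric.fieldPoints_bijective (hX : IsGeometric X) (k : Type u) [Field k] :
    Function.Bijective (fun f : specSpace (forgetAdd.obj (CommRingCat.of k)) ⟶ X =>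
      specUnit (CommRingCat.of k) ≫ baseExt.map f) := by
  have hk : Nontrivial (forgetAdd.obj (CommRingCat.of k)) := inferInstanceAs (Nontrivial k)
  let y : Spec (CommRingCat.of k) := (⊥ : PrimeSpectrum k)
  constructor
  · intro f f' e
    obtain ⟨j, g, rfl⟩ := hX.exists_chartPoint f
    obtain ⟨j', g', rfl⟩ := hX.exists_chartPoint f'
    have e1 := (specUnit_comp_chart j g).symm.trans (Eq.trans e (specUnit_comp_chart j' g'))
    have e2 := Scheme.forgetToLocallyRingedSpace.map_injective
      ((cancel_mono (baseExtSchemeIso hX).hom).1 e1)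
    -- The two points of the charts have the same image in the glued scheme, so they come from a
    -- common chart `l`; the `k`-valued points then lift to it.
    obtain ⟨l, hj, hj', x, h1, h2⟩ := (Scheme.IsLocallyDirected.ι_eq_ι_iff (F := chartDiagram hX)
      (xi := Spec.map (monToRing g) y) (xj := Spec.map (monToRing g') y)).1
        (congrArg (fun m : Spec (CommRingCat.of k) ⟶ baseExtScheme hX => m y) e2)
    obtain ⟨a, ha⟩ := exists_lift_of_field ((chartDiagram hX).map hj) _ h1
    obtain ⟨a', ha'⟩ := exists_lift_of_field ((chartDiagram hX).map hj') _ h2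
    -- The lifts agree since the inclusion of a chart into the glued scheme is a monomorphism.
    have e3 : a = a' := by
      refine (cancel_mono (Limits.colimit.ι (chartDiagram hX) l)).1 ?_
      have h3 : ∀ {i : ChartPoint hX} (hi : l ⟶ i) {b : Spec (CommRingCat.of k) ⟶ _} {c},
          b ≫ (chartDiagram hX).map hi = c → b ≫ Limits.colimit.ι (chartDiagram hX) l =
            c ≫ Limits.colimit.ι (chartDiagram hX) i := by
        rintro i hi b _ rfl
        rw [Category.assoc, Limits.colimit.w]
      exact (h3 hj ha).trans (e2.trans (h3 hj' ha').symm)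
    subst e3
    obtain ⟨r, rfl⟩ := Spec.map_surjective a
    obtain ⟨t, rfl⟩ := exists_monToRing r
    have key : ∀ {i : ChartPoint hX} (hi : l ⟶ i)
        {g : stalk X.presheaf i.1.pt ⟶ forgetAdd.obj (CommRingCat.of k)},
        Spec.map (monToRing t) ≫ (chartDiagram hX).map hi = Spec.map (monToRing g) →
        specMap g ≫ hX.fromStalk i.1.pt = specMap t ≫ hX.fromStalk l.1.pt := by
      intro i hi g h
      have hs : l.1.pt ⤳ i.1.pt := leOfHom hi
      have h3 := Spec.map_injective ((Spec.map_comp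
        (mringFunctor.map (stalkSpecializes X.presheaf hs)) (monToRing t)).trans h)
      rw [map_monToRing] at h3
      rw [← monToRing_injective h3, specMap_comp, Category.assoc, hX.specMap_stalkSpecializes]
    exact (key hj ha).trans (key hj' ha').symm
  · intro p
    let q : Spec (CommRingCat.of k) ⟶ baseExtScheme hX :=
      Scheme.fullyFaithfulForgetToLocallyRingedSpace.preimage
        (X := Spec (CommRingCat.of k)) (Y := baseExtScheme hX) (p ≫ (baseExtSchemeIso hX).inv)
    -- The image of the only point of `Spec k` lies in a chart, so the `k`-valued point lifts to it;
    -- there it is a ring homomorphism, hence a homomorphism of monoids.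
    obtain ⟨j, x, hx⟩ := Scheme.IsLocallyDirected.ι_jointly_surjective (chartDiagram hX) (q y)
    obtain ⟨a, ha⟩ := exists_lift_of_field (Limits.colimit.ι (chartDiagram hX) j) q hx
    obtain ⟨r, rfl⟩ := Spec.map_surjective a
    obtain ⟨t, rfl⟩ := exists_monToRing r
    refine ⟨specMap t ≫ hX.fromStalk j.1.pt, (specUnit_comp_chart j t).trans ?_⟩
    refine (congrArg (fun m => Scheme.forgetToLocallyRingedSpace.map m ≫ (baseExtSchemeIso hX).hom)
      ha).trans ?_
    refine (congrArg (· ≫ (baseExtSchemeIso hX).hom) (Scheme.fullyFaithfulForgetToLocallyRingedSpace.map_preimage _)).trans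
      ?_
    refine (Category.assoc _ _ _).trans ?_
    exact (congrArg (p ≫ ·) (baseExtSchemeIso hX).inv_hom_id).trans (Category.comp_id _)

end FieldPoints

end FOne

namespace FOne

open AlgebraicGeometry MonoidalSpace

/-! ## Evaluation at fields and morphisms of functors of points -/

/-- The only covering sieve of the spectrum of a field is the maximal one. -/
lemma eq_top_of_mem_zariskiAff (k : Type u) [Field k] (S : Sieve (op (CommRingCat.of k)))
    (hS : S ∈ zariskiAff (op (CommRingCat.of k))) : S = ⊤ := by
  rw [mem_zariskiAff_iff, Scheme.mem_grothendieckTopology_iff] at hS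
  obtain ⟨𝒰, h𝒰⟩ := hS
  let y : Spec (CommRingCat.of k) := (⊥ : PrimeSpectrum k)
  obtain ⟨i, x, hx⟩ := 𝒰.exists_eq y
  have : IsOpenImmersion (𝒰.f i) := 𝒰.map_prop i
  -- A member of the covering that contains the point admits a section, so the sieve contains the
  -- identity.
  obtain ⟨c, hc⟩ := exists_lift_of_field (y := y) (𝒰.f i) (𝟙 _) hx
  obtain ⟨R, g, b, hg, e⟩ := h𝒰 _ _ ⟨i⟩
  obtain ⟨r, hr⟩ := Scheme.Spec.map_surjective (X := op (CommRingCat.of k)) (Y := R) (c ≫ b)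
  rw [← Sieve.id_mem_iff_eq_top]
  have : r ≫ g = 𝟙 _ := Scheme.Spec.map_injective (by
    rw [Functor.map_comp, hr, Category.assoc, ← e]
    exact hc.trans (Scheme.Spec.map_id _).symm)
  rw [← this]
  exact S.downward_closed hg r

/-- Sheafification does not change the values at fields. -/
lemma toSheafify_app_bijective (P : (CommRingCat.{u}ᵒᵖ)ᵒᵖ ⥤ Type (u + 1)) (k : Type u) [Field k] :
    Function.Bijective ((toSheafify zariskiAff P).app (op (op (CommRingCat.of k)))) := by
  constructor
  · intro a b h
    -- Elements with the same image in the sheafification agree on a covering sieve, which here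
    -- contains the identity. Surjectivity follows in the same way from the sieve on which a section
    -- lifts.
    have h1 := eq_top_of_mem_zariskiAff k _
      (Presheaf.equalizerSieve_mem zariskiAff (toSheafify zariskiAff P) a b h)
    have h2 : (Presheaf.equalizerSieve (F := P) (X := op (op (CommRingCat.of k))) a b).arrows
        (𝟙 _) := by
      rw [h1]
      trivial
    have h3 : P.map (𝟙 _) a = P.map (𝟙 _) b := h2
    simpa using h3
  · intro s
    have h1 := eq_top_of_mem_zariskiAff k _
      (Presheaf.imageSieve_mem zariskiAff (toSheafify zariskiAff P) s)
    have h2 : (Presheaf.imageSieve (toSheafify zariskiAff P) s).arrows (𝟙 _) := by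
      rw [h1]
      trivial
    obtain ⟨t, ht⟩ := h2
    exact ⟨t, ht.trans (by simp)⟩

/-- The evaluation of points with values in a field is bijective if and only if the morphism from
the base extension is bijective on such points. -/
lemma IsGeometric.evTransform_bijective_iff {X : MonoidalSpace.{u}} (hX : IsGeometric X)
    {S : Scheme.{u}} (e : baseExt.obj X ⟶ S.toLocallyRingedSpace) (k : Type u) [Field k] :
    Function.Bijective ((evTransform e).app (CommRingCat.of k)) ↔
      Function.Bijective (fieldPointsMap e k) := by
  let K := CommRingCat.of k
  have h1 : toSheafify zariskiAff _ ≫ sheafifyLift zariskiAff (evPre e) (affPresheaf_isSheaf S) =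
      evPre e := toSheafify_sheafifyLift _ _ _
  have h2 : (evTransform e).app K ∘
      (toSheafify zariskiAff (multPresheaf.obj (spacePoints.obj X))).app (op (op K)) =
      fun f => ULift.up (evPoint e K f.down) :=
    funext fun f => congrArg (fun η => η.app (op (op K)) f) h1
  -- Composition with the bijections from `X(k)` to the value of the sheafification and to `X_ℤ(k)`
  -- turns both maps into `evPoint e`, up to the identification of morphisms of schemes with
  -- morphisms of locally ringed spaces.
  refine (Function.Bijective.of_comp_iff ((evTransform e).app K)
    (toSheafify_app_bijective _ k)).symm.trans ((iff_of_eq (congrArg Function.Bijective h2)).trans ?_)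
  have h3 : (fun f : specSpace (forgetAdd.obj K) ⟶ X => fieldPointsMap e k
      (specUnit K ≫ baseExt.map f)) = fun f => Scheme.forgetToLocallyRingedSpace.map
        (X := Scheme.Spec.obj (op K)) (Y := S) (evPoint e K f) :=
    funext fun f => (Category.assoc _ _ _).trans (evPoint_toLRSHom e K f).symm
  rw [← Function.Bijective.of_comp_iff _ (hX.fieldPoints_bijective k)]
  refine Iff.trans ?_ (iff_of_eq (congrArg Function.Bijective h3.symm))
  have h4 : Function.Bijective (fun m : Scheme.Spec.obj (op K) ⟶ S =>
      Scheme.forgetToLocallyRingedSpace.map m) :=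
    ⟨Scheme.forgetToLocallyRingedSpace.map_injective, fun m =>
      ⟨Scheme.fullyFaithfulForgetToLocallyRingedSpace.preimage m,
        Scheme.fullyFaithfulForgetToLocallyRingedSpace.map_preimage m⟩⟩
  refine Iff.trans ?_ (Function.Bijective.of_comp_iff' h4 (evPoint e K)).symm
  exact (Function.Bijective.of_comp_iff' Equiv.ulift.symm.bijective (evPoint e K ∘ Equiv.ulift)).trans
    (Function.Bijective.of_comp_iff _ Equiv.ulift.bijective)

/-- Morphisms of schemes are transformations of functors of points. -/
lemma schemePoints_map_bijective (S T : Scheme.{u}) :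
    Function.Bijective (schemePoints.map : (S ⟶ T) → _) := by
  have hT : Presheaf.IsSheaf Scheme.zariskiTopology (yoneda.obj T) :=
    (isSheaf_iff_isSheaf_of_type _ _).2
      (GrothendieckTopology.Subcanonical.isSheaf_of_isRepresentable _)
  -- Affine schemes are dense in the Zariski topology, so transformations into the sheaf `Hom(-, T)`
  -- are determined by, and may be prescribed on, affine schemes.
  let E := Functor.IsCoverDense.restrictHomEquivHom (K := Scheme.zariskiTopology.{u})
    (G := Scheme.Spec.{u}) (ℱ := yoneda.obj S) (ℱ' := ⟨yoneda.obj T, hT⟩)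
  constructor
  · intro p q h
    refine yoneda.map_injective (E.symm.injective ?_)
    ext R f
    exact congrArg (fun η => η.app R.unop.unop f) h
  · intro θ
    obtain ⟨p, hp⟩ := yoneda.map_surjective (E (Functor.whiskerLeft (unopUnop CommRingCat.{u}) θ))
    refine ⟨p, ?_⟩
    have h := (congrArg E.symm hp).trans (E.symm_apply_apply _)
    ext R f
    exact congrArg (fun η => η.app (op (op R)) f) h

end FOne

namespace FOne

open AlgebraicGeometry MonoidalSpace

/-! ## The equivalence -/

lemma evTransform_toSheafify {X : MonoidalSpace.{u}} {S : Scheme.{u}}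
    (e : baseExt.obj X ⟶ S.toLocallyRingedSpace) (R : CommRingCat.{u})
    (f : (multPresheaf.obj (spacePoints.obj X)).obj (op (op R))) :
    (evTransform e).app R ((toSheafify zariskiAff
      (multPresheaf.obj (spacePoints.obj X))).app (op (op R)) f) =
      ULift.up (evPoint e R f.down) :=
  congrArg (fun η => η.app (op (op R)) f)
    (toSheafify_sheafifyLift zariskiAff (evPre e) (affPresheaf_isSheaf S))

/-- A transformation to the functor of points of a scheme is determined by its values on the
presheaf. -/
lemma functorBaseExt_hom_ext {F : CommMonZ.{u} ⥤ Type u} {S : Scheme.{u}}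
    {α β : functorBaseExt.obj F ⟶ schemePoints.obj S ⋙ uliftFunctor.{u + 1, u}}
    (h : ∀ (R : CommRingCat.{u}) (f : (multPresheaf.obj F).obj (op (op R))),
      α.app R ((toSheafify zariskiAff (multPresheaf.obj F)).app (op (op R)) f) =
        β.app R ((toSheafify zariskiAff (multPresheaf.obj F)).app (op (op R)) f)) : α = β := by
  let α' : sheafify zariskiAff (multPresheaf.obj F) ⟶ affPresheaf.obj S :=
    Functor.whiskerLeft (unopUnop CommRingCat.{u}) α
  let β' : sheafify zariskiAff (multPresheaf.obj F) ⟶ affPresheaf.obj S :=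
    Functor.whiskerLeft (unopUnop CommRingCat.{u}) β
  have : α' = β' := by
    refine sheafify_hom_ext _ _ _ (affPresheaf_isSheaf S) ?_
    ext R f
    exact h R.unop.unop f
  exact congrArg (Functor.whiskerLeft (opOp CommRingCat.{u})) this

/-- Morphisms of base extensions are determined by the evaluation. -/
lemma IsGeometric.evTransform_injective {X : MonoidalSpace.{u}} (hX : IsGeometric X)
    {S : Scheme.{u}} {d e : baseExt.obj X ⟶ S.toLocallyRingedSpace}
    (h : evTransform d = evTransform e) : d = e := by
  refine hX.baseExt_hom_ext fun R f => ?_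
  have h1 := congrArg (fun η => η.app R ((toSheafify zariskiAff
      (multPresheaf.obj (spacePoints.obj X))).app (op (op R)) (ULift.up f))) h
  have h2 := (evTransform_toSheafify d R (ULift.up f)).symm.trans
    (h1.trans (evTransform_toSheafify e R (ULift.up f)))
  have h3 : evPoint d R f = evPoint e R f := congrArg ULift.down h2
  refine (Category.assoc _ _ _).trans (((evPoint_toLRSHom d R f).symm.trans ?_).trans
    ((evPoint_toLRSHom e R f).trans (Category.assoc _ _ _).symm))
  rw [h3]

/-- Every evaluation is induced by a morphism from the base extension. -/
lemma IsGeometric.exists_evTransform_eq {X : MonoidalSpace.{u}} (hX : IsGeometric X)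
    {S : Scheme.{u}}
    (α : functorBaseExt.obj (spacePoints.obj X) ⟶ schemePoints.obj S ⋙ uliftFunctor.{u + 1, u}) :
    ∃ e : baseExt.obj X ⟶ S.toLocallyRingedSpace, evTransform e = α := by
  let a : ∀ R : CommRingCat.{u}, (specSpace (forgetAdd.obj R) ⟶ X) →
      (Scheme.Spec.obj (op R) ⟶ S) := fun R f =>
    ULift.down (α.app R ((toSheafify zariskiAff
      (multPresheaf.obj (spacePoints.obj X))).app (op (op R)) (ULift.up f)))
  have ha : ∀ {R R' : CommRingCat.{u}} (g : R ⟶ R') (f : specSpace (forgetAdd.obj R) ⟶ X),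
      a R' (specMap (forgetAdd.map g) ≫ f) = Scheme.Spec.map g.op ≫ a R f := fun {R R'} g f => by
    let f' : (multPresheaf.obj (spacePoints.obj X)).obj (op (op R)) := ULift.up f
    have h1 := NatTrans.naturality_apply (toSheafify zariskiAff
      (multPresheaf.obj (spacePoints.obj X))) g.op.op f'
    have h2 := NatTrans.naturality_apply α g ((toSheafify zariskiAff
      (multPresheaf.obj (spacePoints.obj X))).app (op (op R)) f')
    exact congrArg ULift.down ((congrArg (α.app R') h1).trans h2)
  obtain ⟨e, he⟩ := hX.exists_baseExt_hom (S := S.toLocallyRingedSpace)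
    (fun R f => Scheme.forgetToLocallyRingedSpace.map (a R f)) (fun g f =>
      (congrArg Scheme.forgetToLocallyRingedSpace.map (ha g f)).trans
        (Scheme.forgetToLocallyRingedSpace.map_comp _ _))
  refine ⟨e, functorBaseExt_hom_ext fun R f => (evTransform_toSheafify e R f).trans ?_⟩
  have h1 : evPoint e R f.down = a R f.down := Scheme.forgetToLocallyRingedSpace.map_injective
    ((evPoint_toLRSHom e R f.down).trans ((Category.assoc _ _ _).symm.trans (he R f.down)))
  exact congrArg ULift.up h1

/-- The functor from generalized torified schemes to CC-schemes. -/
noncomputable def torifiedToCC : GenTorified.{u} ⥤ CCScheme.{u} where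
  obj X :=
    { torifiedToTriple.obj X with
      isMScheme := X.space.property.isMScheme
      isScheme := ⟨X.scheme, ⟨Iso.refl _⟩⟩
      bijective := fun k _ => (X.space.property.evTransform_bijective_iff X.e k).2 (X.bijective k) }
  map f := ⟨torifiedToTriple.map f, isLocalTransform _⟩
  map_id X := CCScheme.Hom.ext (torifiedToTriple.map_id X)
  map_comp f g := CCScheme.Hom.ext (torifiedToTriple.map_comp f g)

instance : torifiedToCC.{u}.Faithful where
  map_injective {X Y f g} h := by
    have h1 : torifiedToTriple.map f = torifiedToTriple.map g := congrArg CCScheme.Hom.toTriple h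
    refine GenTorified.Hom.ext ?_ ?_
    · exact ObjectProperty.hom_ext _
        (X.space.property.spacePoints_injective (congrArg Triple.Hom.F h1))
    · exact (schemePoints_map_bijective _ _).1 (congrArg Triple.Hom.G h1)

/-- Each component comes from a morphism by full faithfulness of the functors of points. Their
compatibility on base extensions follows from that on evaluations, since the evaluation determines
the morphism from the base extension. -/
instance : torifiedToCC.{u}.Full where
  map_surjective {X Y} h := by
    obtain ⟨p, hp⟩ := X.space.property.exists_map_eq (Y := Y.space.obj) h.toTriple.F
    obtain ⟨q, hq⟩ := (schemePoints_map_bijective X.scheme Y.scheme).2 h.toTriple.G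
    have hc : functorBaseExt.map (spacePoints.map p) ≫ evTransform Y.e = evTransform X.e ≫
        Functor.whiskerRight (schemePoints.map q) uliftFunctor.{u + 1, u} := by
      rw [hp, hq]
      exact h.toTriple.comm
    have w : baseExt.map p ≫ Y.e = X.e ≫ Scheme.forgetToLocallyRingedSpace.map q := by
      refine X.space.property.evTransform_injective ?_
      -- The evaluations induced by the two composites are computed by the naturality of
      -- `evTransform`, used once with an identity on the side of the schemes and once with an
      -- identity on the side of the spaces.
      have h1 := evTransform_map (p := p) (q := 𝟙 Y.scheme) (d := baseExt.map p ≫ Y.e) (e := Y.e)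
        (Category.comp_id _).symm
      have h2 := evTransform_map (p := 𝟙 X.space.obj) (q := q) (d := X.e)
        (e := X.e ≫ Scheme.forgetToLocallyRingedSpace.map q)
        ((congrArg (· ≫ _) (baseExt.map_id _)).trans (Category.id_comp _))
      have h3 : Functor.whiskerRight (schemePoints.map (𝟙 Y.scheme)) uliftFunctor.{u + 1, u} =
          𝟙 _ := by
        rw [schemePoints.map_id]
        exact Functor.whiskerRight_id _
      have h4 : functorBaseExt.map (spacePoints.map (𝟙 X.space.obj)) = 𝟙 _ := by
        rw [spacePoints.map_id, functorBaseExt.map_id]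
      refine ((Category.comp_id _).symm.trans ((congrArg (_ ≫ ·) h3.symm).trans h1.symm)).trans
        (hc.trans (h2.symm.trans ((congrArg (· ≫ _) h4).trans (Category.id_comp _))))
    refine ⟨⟨ObjectProperty.homMk p, q, w⟩, CCScheme.Hom.ext (Triple.Hom.ext hp hq)⟩

instance : torifiedToCC.{u}.EssSurj where
  mem_essImage Z := by
    have := Z.isMScheme.hasSmallSections
    obtain ⟨S, ⟨β⟩⟩ := Z.isScheme
    obtain ⟨α⟩ := Z.isMScheme.nonempty_iso
    have hX := Z.isMScheme.isGeometric
    -- The given evaluation is transported along the isomorphisms of `Z.F` and `Z.G` with functors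
    -- of points; the resulting transformation is induced by a morphism from the base extension.
    obtain ⟨e, he⟩ := hX.exists_evTransform_eq (S := S) (functorBaseExt.map α.inv ≫ Z.ev ≫
      Functor.whiskerRight β.hom uliftFunctor.{u + 1, u})
    have hb : ∀ (k : Type u) [Field k], Function.Bijective (fieldPointsMap e k) := fun k _ => by
      rw [← hX.evTransform_bijective_iff, he]
      have h1 : Function.Bijective ((functorBaseExt.map α.inv).app (CommRingCat.of k)) :=
        (isIso_iff_bijective _).1 inferInstance
      have h2 : Function.Bijective
          ((Functor.whiskerRight β.hom uliftFunctor.{u + 1, u}).app (CommRingCat.of k)) :=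
        (isIso_iff_bijective _).1 inferInstance
      exact h2.comp ((Z.bijective k).comp h1)
    let Y : GenTorified.{u} := ⟨⟨functorSpace Z.F, hX⟩, S, e, hb⟩
    have hβ : Functor.whiskerRight β.hom uliftFunctor.{u + 1, u} ≫
        Functor.whiskerRight β.inv uliftFunctor.{u + 1, u} = 𝟙 _ :=
      (((Functor.whiskeringRight _ _ _).obj uliftFunctor.{u + 1, u}).mapIso β).hom_inv_id
    have hf : functorBaseExt.map α.inv ≫ Z.ev =
        evTransform e ≫ Functor.whiskerRight β.inv uliftFunctor.{u + 1, u} := by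
      rw [he, Category.assoc, Category.assoc, hβ, Category.comp_id]
    have hα : functorBaseExt.map α.hom ≫ functorBaseExt.map α.inv = 𝟙 _ :=
      (functorBaseExt.mapIso α).hom_inv_id
    have hg : functorBaseExt.map α.hom ≫ evTransform e =
        Z.ev ≫ Functor.whiskerRight β.hom uliftFunctor.{u + 1, u} := by
      rw [he, ← Category.assoc, hα, Category.id_comp]
    let f : torifiedToCC.obj Y ⟶ Z := ⟨⟨α.inv, β.inv, hf⟩, isLocalTransform _⟩
    let g : Z ⟶ torifiedToCC.obj Y := ⟨⟨α.hom, β.hom, hg⟩, isLocalTransform _⟩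
    exact ⟨Y, ⟨⟨f, g, CCScheme.Hom.ext (Triple.Hom.ext α.inv_hom_id β.inv_hom_id),
      CCScheme.Hom.ext (Triple.Hom.ext α.hom_inv_id β.hom_inv_id)⟩⟩⟩

end FOne

theorem mainTheorem1 :
    (∀ X : FOne.GeomScheme.{u}, ∃ S : AlgebraicGeometry.Scheme.{u},
      Nonempty (S.toLocallyRingedSpace ≅ FOne.baseExt.obj X.obj)) ∧
    ∃ I : FOne.GenTorified.{u} ⥤ FOne.CCScheme.{u},
      I ⋙ FOne.CCScheme.forget = FOne.torifiedToTriple ∧ I.IsEquivalence :=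
  ⟨fun X => ⟨_, ⟨FOne.baseExtSchemeIso X.property⟩⟩, FOne.torifiedToCC, rfl, { }⟩
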